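/- Let $D=[0,L]^3$, $L>0$, with periodic boundary conditions, and let $\mathbb L^p=L^p(D)^3$, $\mathbb H^k=W^{k,2}(D)^3$ (periodic, in the sense of weak derivatives tested against smooth periodic functions). Let $H=\{u\in\mathbb L^2:\operatorname{div}u=0\}$, with inner product $(\cdot,\cdot)$ of $\mathbb L^2$, and $V=H\cap\mathbb H^1$ with $\|u\|_V^2=\|u\|_{\mathbb L^2}^2+\|\nabla u\|_{\mathbb L^2}^2$; let $\Pi:\mathbb L^2\to H$ be the Leray (orthogonal) projection, $A=-\Pi\Delta$ with domain $V\cap\mathbb H^2$, and $\langle B(u,v),w\rangle=\int_D([u\cdot\nabla]v)\cdot w\,dx$ for $u,v,w\in V$. Let $T,\nu,a>0$ and $\alpha\in[1,\frac32]$. Let $W$ be a Wiener process on $[0,T]$ with values in a separable real Hilbert space $K$, with symmetric positive trace-class covariance operator $Q$, relative to a filtration $(\mathcal F_t)$ on a probability space $(\Omega,\mathcal F,\mathbb P)$. Let $u_0\in L^2(\Omega;V)$ be $\mathcal F_0$-measurable. Let $G:V\to\mathcal L(K;V)$ satisfy condition (G): there are positive constants $K_0,K_1,\tilde K_0,\tilde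 K_1,\Lambda$ such that for all $u,v\in V$ \[ \|G(u)\|_{\mathcal L(K;H)}^2\le K_0+K_1\|u\|_H^2,\quad \|G(u)\|_{\mathcal L(K;V)}^2\le \tilde K_0+\tilde K_1\|u\|_V^2,\quad \|G(u)-G(v)\|_{\mathcal L(K;H)}^2\le \Lambda\|u-v\|_H^2 . \] For an integer $N\ge1$ put $h=T/N$ and $t_k=kh$. A solution of the fully implicit Euler scheme is a sequence $u^0,\dots,u^N$ of $V$-valued random variables such that $u^k$ is $\mathcal F_{t_k}$-measurable, $u^0=u_0$ almost surely, $u^k\in V\cap\mathbb H^2$ almost surely for $1\le k\le N$, and almost surely, for all $k=1,\dots,N$ and all $\varphi\in V$, \[ (u^k-u^{k-1},\varphi)+h\Big[\nu(Au^k,\varphi)+\langle B(u^k,u^k),\varphi\rangle+a\int_D|u^k|^{2\alpha}u^k\cdot\varphi\,dx\Big] =\big(G(u^{k-1})[W(t_k)-W(t_{k-1})],\varphi\big). \] Then: (i) for every $N\ge1$ the scheme has a solution; (ii) suppose in addition, when $\alpha=1$, that $4\nu a>1$. Then the following moments are bounded uniformly in $N$: there is $C<\infty$ such that for every $N\ge1$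 and every solution $\{u^k\}_{k=0,\dots,N}$ of the scheme \[ \mathbb E\Big(\max_{0\le k\le N}\|u^k\|_V^2+\frac TN\sum_{k=1}^N\Big[\|Au^k\|_{\mathbb L^2}^2+\|u^k\|_{\mathbb L^{2\alpha+2}}^{2\alpha+2}+\big\||u^k|^\alpha\nabla u^k\big\|_{\mathbb L^2}^2\Big]\Big)\le C . \] -/

import Mathlib

open MeasureTheory ProbabilityTheory
open scoped NNReal ENNReal InnerProductSpace

noncomputable section

namespace BFEuler

/-! ### Function spaces on the periodic box `D = [0, ℓ]³` -/

/-- Physical space `ℝ³` with the Euclidean norm. -/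
abbrev E3 : Type := EuclideanSpace ℝ (Fin 3)

/-- The box `D = [0, ℓ]³`. -/
def box (ℓ : ℝ) : Set E3 := {x | ∀ i, x i ∈ Set.Icc 0 ℓ}

/-- Lebesgue measure on `D`. -/
def boxMeasure (ℓ : ℝ) : Measure E3 := volume.restrict (box ℓ)

/-- The space `𝕃² = L²(D)³`. -/
abbrev L2 (ℓ : ℝ) : Type := Lp E3 2 (boxMeasure ℓ)

/-- The canonical basis vectors of `ℝ³`. -/
def basisVec (i : Fin 3) : E3 := EuclideanSpace.single i 1

/-- Smooth scalar test functions that are `ℓ`-periodic in every coordinate direction. -/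
def IsPeriodicTest (ℓ : ℝ) (ψ : E3 → ℝ) : Prop :=
  ContDiff ℝ ((⊤ : ℕ∞) : WithTop ℕ∞) ψ ∧ ∀ x i, ψ (x + ℓ • basisVec i) = ψ x

/-- `g` is the weak derivative `∂ⱼ f` on `D` with periodic boundary conditions: the test functions
are all smooth periodic functions, not only the compactly supported ones. -/
def IsWeakDeriv (ℓ : ℝ) (j : Fin 3) (f g : L2 ℓ) : Prop :=
  ∀ ψ : E3 → ℝ, IsPeriodicTest ℓ ψ →
    ∫ x, fderiv ℝ ψ x (basisVec j) • f x ∂boxMeasure ℓ = -∫ x, ψ x • g x ∂boxMeasure ℓ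

/-- `div u = 0` weakly in `D` with periodic boundary conditions. -/
def IsWeakDivFree (ℓ : ℝ) (u : L2 ℓ) : Prop :=
  ∀ ψ : E3 → ℝ, IsPeriodicTest ℓ ψ → ∫ x, ⟪gradient ψ x, u x⟫_ℝ ∂boxMeasure ℓ = 0

lemma isCompact_box (ℓ : ℝ) : IsCompact (box ℓ) := by
  have h : box ℓ = (EuclideanSpace.equiv (Fin 3) ℝ) ⁻¹' (Set.pi Set.univ fun _ => Set.Icc 0 ℓ) := by
    ext x
    simp only [box, Set.mem_preimage, Set.mem_univ_pi]
    rfl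
  rw [h]
  exact (EuclideanSpace.equiv (Fin 3) ℝ).toHomeomorph.isCompact_preimage.2
    (isCompact_univ_pi fun _ => isCompact_Icc)

instance (ℓ : ℝ) : IsFiniteMeasure (boxMeasure ℓ) :=
  ⟨by simpa [boxMeasure] using (isCompact_box ℓ).measure_lt_top⟩

lemma memLp_of_continuous {F : Type*} [NormedAddCommGroup F] (ℓ : ℝ) (p : ℝ≥0∞) {f : E3 → F}
    (hf : Continuous f) : MemLp f p (boxMeasure ℓ) := by
  obtain ⟨C, hC⟩ := (isCompact_box ℓ).exists_bound_of_continuousOn hf.continuousOn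
  refine MemLp.of_bound hf.aestronglyMeasurable C ?_
  exact ae_restrict_of_forall_mem (isCompact_box ℓ).measurableSet hC

lemma integrable_smul_of_continuous (ℓ : ℝ) {c : E3 → ℝ} (hc : Continuous c) (f : L2 ℓ) :
    Integrable (fun x => c x • f x) (boxMeasure ℓ) :=
  memLp_one_iff_integrable.1 ((Lp.memLp f).smul (memLp_of_continuous ℓ 2 hc))

lemma IsPeriodicTest.continuous_fderiv {ℓ : ℝ} {ψ : E3 → ℝ} (h : IsPeriodicTest ℓ ψ) (v : E3) :
    Continuous fun x => fderiv ℝ ψ x v :=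
  (h.1.continuous_fderiv (by simp)).clm_apply continuous_const

lemma IsPeriodicTest.continuous_gradient {ℓ : ℝ} {ψ : E3 → ℝ} (h : IsPeriodicTest ℓ ψ) :
    Continuous fun x => gradient ψ x :=
  (InnerProductSpace.toDual ℝ E3).symm.continuous.comp (h.1.continuous_fderiv (by simp))

lemma isWeakDivFree_iff (ℓ : ℝ) (u : L2 ℓ) :
    IsWeakDivFree ℓ u ↔ ∀ (ψ : E3 → ℝ) (h : IsPeriodicTest ℓ ψ),
      ⟪(memLp_of_continuous ℓ 2 h.continuous_gradient).toLp _, u⟫_ℝ = 0 := by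
  refine forall₂_congr fun ψ h => ?_
  rw [L2.inner_def]
  have : ∫ x, ⟪((memLp_of_continuous ℓ 2 h.continuous_gradient).toLp _ : L2 ℓ) x, u x⟫_ℝ
      ∂boxMeasure ℓ = ∫ x, ⟪gradient ψ x, u x⟫_ℝ ∂boxMeasure ℓ := by
    refine integral_congr_ae ?_
    filter_upwards [(memLp_of_continuous ℓ 2 h.continuous_gradient).coeFn_toLp] with x hx
    rw [hx]
  rw [this]

lemma IsWeakDeriv.add {ℓ : ℝ} {j : Fin 3} {f g f' g' : L2 ℓ} (h : IsWeakDeriv ℓ j f g)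
    (h' : IsWeakDeriv ℓ j f' g') : IsWeakDeriv ℓ j (f + f') (g + g') := by
  intro ψ hψ
  have e1 : ∫ x, fderiv ℝ ψ x (basisVec j) • (f + f') x ∂boxMeasure ℓ =
      ∫ x, (fderiv ℝ ψ x (basisVec j) • f x + fderiv ℝ ψ x (basisVec j) • f' x) ∂boxMeasure ℓ := by
    refine integral_congr_ae ?_
    filter_upwards [Lp.coeFn_add f f'] with x hx
    rw [hx, Pi.add_apply, smul_add]
  have e2 : ∫ x, ψ x • (g + g') x ∂boxMeasure ℓ =
      ∫ x, (ψ x • g x + ψ x • g' x) ∂boxMeasure ℓ := by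
    refine integral_congr_ae ?_
    filter_upwards [Lp.coeFn_add g g'] with x hx
    rw [hx, Pi.add_apply, smul_add]
  rw [e1, e2, integral_add (integrable_smul_of_continuous ℓ (hψ.continuous_fderiv _) f)
    (integrable_smul_of_continuous ℓ (hψ.continuous_fderiv _) f'),
    integral_add (integrable_smul_of_continuous ℓ hψ.1.continuous g)
    (integrable_smul_of_continuous ℓ hψ.1.continuous g'), h ψ hψ, h' ψ hψ, neg_add]

lemma IsWeakDeriv.smul {ℓ : ℝ} {j : Fin 3} {f g : L2 ℓ} (c : ℝ) (h : IsWeakDeriv ℓ j f g) :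
    IsWeakDeriv ℓ j (c • f) (c • g) := by
  intro ψ hψ
  have e1 : ∫ x, fderiv ℝ ψ x (basisVec j) • (c • f) x ∂boxMeasure ℓ =
      ∫ x, c • (fderiv ℝ ψ x (basisVec j) • f x) ∂boxMeasure ℓ := by
    refine integral_congr_ae ?_
    filter_upwards [Lp.coeFn_smul c f] with x hx
    rw [hx, Pi.smul_apply, smul_comm]
  have e2 : ∫ x, ψ x • (c • g) x ∂boxMeasure ℓ = ∫ x, c • (ψ x • g x) ∂boxMeasure ℓ := by
    refine integral_congr_ae ?_
    filter_upwards [Lp.coeFn_smul c g] with x hx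
    rw [hx, Pi.smul_apply, smul_comm]
  rw [e1, e2, integral_smul, integral_smul, h ψ hψ, smul_neg]

lemma isWeakDeriv_zero (ℓ : ℝ) (j : Fin 3) : IsWeakDeriv ℓ j 0 0 := by
  intro ψ _
  have e (c : E3 → ℝ) : ∫ x, c x • (0 : L2 ℓ) x ∂boxMeasure ℓ = 0 := by
    rw [← integral_zero E3 E3 (μ := boxMeasure ℓ)]
    refine integral_congr_ae ?_
    filter_upwards [Lp.coeFn_zero E3 2 (boxMeasure ℓ)] with x hx
    rw [hx, Pi.zero_apply, smul_zero]
  rw [e, e, neg_zero]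

/-- The space `H` of weakly divergence-free fields in `𝕃²`, with the norm of `𝕃²`. -/
def H (ℓ : ℝ) : Submodule ℝ (L2 ℓ) where
  carrier := {u | IsWeakDivFree ℓ u}
  add_mem' {u v} hu hv := by
    simp only [Set.mem_ofPred_eq, isWeakDivFree_iff] at *
    intro ψ h
    rw [inner_add_right, hu ψ h, hv ψ h, add_zero]
  zero_mem' := by
    simp only [Set.mem_ofPred_eq, isWeakDivFree_iff]
    intro ψ h
    exact inner_zero_right _
  smul_mem' c u hu := by
    simp only [Set.mem_ofPred_eq, isWeakDivFree_iff] at *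
    intro ψ h
    rw [inner_smul_right, hu ψ h, mul_zero]

instance (ℓ : ℝ) : CompleteSpace (H ℓ) := by
  have h : IsClosed (H ℓ : Set (L2 ℓ)) := by
    have : (H ℓ : Set (L2 ℓ)) = ⋂ (ψ : E3 → ℝ) (h : IsPeriodicTest ℓ ψ),
        {u : L2 ℓ | ⟪(memLp_of_continuous ℓ 2 h.continuous_gradient).toLp _, u⟫_ℝ = 0} := by
      ext u
      simp only [Set.mem_iInter, Set.mem_ofPred_eq]
      exact isWeakDivFree_iff ℓ u
    rw [this]
    exact isClosed_iInter fun ψ => isClosed_iInter fun h =>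
      isClosed_eq (continuous_const.inner continuous_id) continuous_const
  exact h.completeSpace_coe

/-- The Leray projection `Π : 𝕃² → H`. -/
def leray (ℓ : ℝ) : L2 ℓ →L[ℝ] H ℓ := (H ℓ).orthogonalProjectionOnto

/-- The Hilbert space `V = H ∩ 𝕎^{1,2}`. A field `u ∈ V` is stored together with its (unique) weak
gradient, as the element `(u, (∂₁u, ∂₂u, ∂₃u))` of the Hilbert sum `𝕃² ⊕ (𝕃²)³`; the induced norm
is `‖u‖_V² = ‖u‖² + ∑ⱼ ‖∂ⱼu‖²`. -/
def V (ℓ : ℝ) : Submodule ℝ (WithLp 2 (L2 ℓ × PiLp 2 fun _ : Fin 3 => L2 ℓ)) where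
  carrier := {u | u.fst ∈ H ℓ ∧ ∀ j, IsWeakDeriv ℓ j u.fst (u.snd j)}
  add_mem' {_ _} hu hv := ⟨(H ℓ).add_mem hu.1 hv.1, fun j => (hu.2 j).add (hv.2 j)⟩
  zero_mem' := ⟨(H ℓ).zero_mem, isWeakDeriv_zero ℓ⟩
  smul_mem' c _ hu := ⟨(H ℓ).smul_mem c hu.1, fun j => (hu.2 j).smul c⟩

/-- The continuous inclusion `V → H`. -/
def toH (ℓ : ℝ) : V ℓ →L[ℝ] H ℓ :=
  ((WithLp.fstL 2 ℝ (L2 ℓ) (PiLp 2 fun _ : Fin 3 => L2 ℓ)).comp (V ℓ).subtypeL).codRestrict (H ℓ)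
    fun u => u.2.1

/-- The velocity field `D → ℝ³` of an element of `V`. -/
def vel {ℓ : ℝ} (u : V ℓ) : L2 ℓ := u.1.fst

/-- The weak partial derivative `∂ⱼ u ∈ 𝕃²` of `u ∈ V`. -/
def pd {ℓ : ℝ} (u : V ℓ) (j : Fin 3) : L2 ℓ := u.1.snd j

open Classical in
/-- The weak derivative `∂ⱼ f` of a field that has one in `𝕃²` (and `0` otherwise). -/
def weakDeriv (ℓ : ℝ) (j : Fin 3) (f : L2 ℓ) : L2 ℓ :=
  if h : ∃ g, IsWeakDeriv ℓ j f g then h.choose else 0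

/-- `u ∈ Dom(A) = 𝕎^{2,2} ∩ H = V ∩ ℍ²`: all second weak derivatives exist in `𝕃²`. -/
def InDomA {ℓ : ℝ} (u : V ℓ) : Prop :=
  ∀ i j, ∃ g : L2 ℓ, IsWeakDeriv ℓ i (pd u j) g

/-- The Stokes operator `A u = -Π Δ u`, meaningful for `u ∈ Dom(A)`. -/
def stokes {ℓ : ℝ} (u : V ℓ) : H ℓ :=
  -leray ℓ (∑ j, weakDeriv ℓ j (pd u j))

/-- The trilinear form `b(u, v, w) = ∫_D ([u·∇]v)·w dx`, i.e. the pairing `⟨B(u, v), w⟩`. -/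
def trilinear {ℓ : ℝ} (u v w : V ℓ) : ℝ :=
  ∫ x, ⟪∑ i, vel u x i • pd v i x, vel w x⟫_ℝ ∂boxMeasure ℓ

/-- The Brinkman–Forchheimer pairing `(|u|^{2α} u, w) = ∫_D |u|^{2α} u·w dx`. -/
def forchheimer {ℓ : ℝ} (α : ℝ) (u w : V ℓ) : ℝ :=
  ∫ x, ⟪‖vel u x‖ ^ (2 * α) • vel u x, vel w x⟫_ℝ ∂boxMeasure ℓ

/-! ### The noise -/

/-- Symmetric, positive, trace-class operators on a real Hilbert space. -/
def IsPosTraceClass {K : Type*} [NormedAddCommGroup K] [InnerProductSpace ℝ K] [CompleteSpace K]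
    (Q : K →L[ℝ] K) : Prop :=
  Q.IsPositive ∧ ∃ (s : Set K) (ζ : HilbertBasis s ℝ K), Summable fun j => ⟪Q (ζ j), ζ j⟫_ℝ

/-- `W` is a `K`-valued Wiener process on `[0, T]` with covariance operator `Q`, relative to the
filtration `ℱ`. -/
structure IsWiener {Ω K : Type*} [mΩ : MeasurableSpace Ω] [NormedAddCommGroup K]
    [InnerProductSpace ℝ K] [MeasurableSpace K] (P : Measure Ω)
    (ℱ : Filtration ℝ≥0 mΩ) (T : ℝ≥0) (Q : K →L[ℝ] K) (W : ℝ≥0 → Ω → K) : Prop where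
  adapted : ∀ t ≤ T, StronglyMeasurable[ℱ t] (W t)
  zero : ∀ᵐ ω ∂P, W 0 ω = 0
  continuous : ∀ᵐ ω ∂P, ContinuousOn (fun t => W t ω) (Set.Icc 0 T)
  indep : ∀ s t, s ≤ t → t ≤ T →
    Indep (MeasurableSpace.comap (fun ω => W t ω - W s ω) ‹MeasurableSpace K›) (ℱ s) P
  /-- The increments are centred Gaussian with covariance operator `(t - s) Q`. -/
  gaussian : ∀ s t, s ≤ t → t ≤ T → ∀ x : K,
    P.map (fun ω => ⟪W t ω - W s ω, x⟫_ℝ) =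
      gaussianReal 0 (Real.toNNReal (((t : ℝ) - s) * ⟪Q x, x⟫_ℝ))

/-- Condition (G) on the diffusion coefficient `G : V → 𝓛(K; V)`: growth in the norms of
`𝓛(K; H)` and `𝓛(K; V)`, and Lipschitz continuity from the `H`-norm to the norm of `𝓛(K; H)`. -/
structure ConditionG {K : Type*} [NormedAddCommGroup K] [InnerProductSpace ℝ K] {ℓ : ℝ}
    (G : V ℓ → K →L[ℝ] V ℓ) : Prop where
  growth_H : ∃ K₀ > (0 : ℝ), ∃ K₁ > (0 : ℝ), ∀ u, ‖(toH ℓ).comp (G u)‖ ^ 2 ≤ K₀ + K₁ * ‖toH ℓ u‖ ^ 2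
  growth_V : ∃ K₀ > (0 : ℝ), ∃ K₁ > (0 : ℝ), ∀ u, ‖G u‖ ^ 2 ≤ K₀ + K₁ * ‖u‖ ^ 2
  lipschitz : ∃ Λ > (0 : ℝ), ∀ u v,
    ‖(toH ℓ).comp (G u) - (toH ℓ).comp (G v)‖ ^ 2 ≤ Λ * ‖toH ℓ u - toH ℓ v‖ ^ 2

/-! ### The scheme -/

/-- The grid point `t_k = k T / N`. -/
def grid (T : ℝ≥0) (N k : ℕ) : ℝ≥0 := k * (T / N)

/-- `u⁰, …, u^N` is an adapted solution with values in `V ∩ ℍ²` (for `k ≥ 1`) of the fully implicit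
Euler scheme with time step `T / N` and initial condition `u₀`. -/
structure IsEulerSolution {Ω K : Type*} [mΩ : MeasurableSpace Ω] [NormedAddCommGroup K]
    [InnerProductSpace ℝ K] {ℓ : ℝ} (P : Measure Ω) (ℱ : Filtration ℝ≥0 mΩ) (T : ℝ≥0)
    (ν a α : ℝ) (G : V ℓ → K →L[ℝ] V ℓ) (W : ℝ≥0 → Ω → K) (u₀ : Ω → V ℓ) (N : ℕ)
    (u : ℕ → Ω → V ℓ) : Prop where
  adapted : ∀ k ≤ N, StronglyMeasurable[ℱ (grid T N k)] (u k)
  initial : ∀ᵐ ω ∂P, u 0 ω = u₀ ω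
  mem_domA : ∀ k ∈ Finset.Icc 1 N, ∀ᵐ ω ∂P, InDomA (u k ω)
  scheme : ∀ k ∈ Finset.Icc 1 N, ∀ᵐ ω ∂P, ∀ φ : V ℓ,
    ⟪toH ℓ (u k ω) - toH ℓ (u (k - 1) ω), toH ℓ φ⟫_ℝ
      + (T / N : ℝ) * (ν * ⟪stokes (u k ω), toH ℓ φ⟫_ℝ
        + trilinear (u k ω) (u k ω) φ + a * forchheimer α (u k ω) φ)
    = ⟪toH ℓ (G (u (k - 1) ω) (W (grid T N k) ω - W (grid T N (k - 1)) ω)), toH ℓ φ⟫_ℝ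

/-- `‖Au‖²_{𝕃²} + ‖u‖^{2α+2}_{𝕃^{2α+2}} + ‖|u|^α ∇u‖²_{𝕃²}` as an extended nonnegative number. -/
def dissipation {ℓ : ℝ} (α : ℝ) (u : V ℓ) : ℝ≥0∞ :=
  ‖stokes u‖ₑ ^ 2 + ∫⁻ x, ‖vel u x‖ₑ ^ (2 * α + 2) ∂boxMeasure ℓ
    + ∫⁻ x, ‖vel u x‖ₑ ^ (2 * α) * ∑ j, ‖pd u j x‖ₑ ^ 2 ∂boxMeasure ℓ

/-- The moment
`𝔼(max_{0≤k≤N} ‖u^k‖_V² + (T/N) ∑_{k=1}^N [‖Au^k‖² + ‖u^k‖^{2α+2}_{𝕃^{2α+2}} + ‖|u^k|^α∇u^k‖²])`. -/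
def eulerMoment {Ω : Type*} [MeasurableSpace Ω] {ℓ : ℝ} (P : Measure Ω) (T : ℝ≥0) (α : ℝ) (N : ℕ)
    (u : ℕ → Ω → V ℓ) : ℝ≥0∞ :=
  ∫⁻ ω, ((⨆ k ∈ Finset.range (N + 1), ‖u k ω‖ₑ ^ 2)
    + ((T / N : ℝ≥0) : ℝ≥0∞) * ∑ k ∈ Finset.Icc 1 N, dissipation α (u k ω)) ∂P

end BFEuler

end

/-! ### Zeros of coercive continuous maps in finite dimension -/

section CoerciveZero

open Metric Set Filter Topology

variable {E : Type*} [NormedAddCommGroup E] [InnerProductSpace ℝ E] [FiniteDimensional ℝ E]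

/-! Existence is a deterministic statement about one step, repeated `N` times. Given `f = u^{k-1} +
G(u^{k-1})ΔW` in `H`, the stationary problem is solved on finite-dimensional spaces of
divergence-free trigonometric polynomials. There the residual tested with `u` itself is positive for
large `‖u‖`, because `b(u,u,u) = 0` and the drag is monotone, so a Brouwer-type argument
(`exists_zero_of_coercive`) yields a zero bounded in `V` independently of the dimension. On the
torus `-Δ` maps the Galerkin space to itself and commutes with the Leray projection, so `-Δu` is an
admissible test function. The drag paired with `-Δu` dominates `∫|u|^{2α}|∇u|²`
(`HasLap.integral_le_inner_drag`), and the convection is absorbed by `‖u‖_∞ ≤ δ‖Δu‖ + C‖u‖`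
(`exists_sum_coef_le`). The resulting `ℍ²` bound gives compactness in `V` and a limit solving the
full equation. Uniqueness is not available, so adaptedness comes from a measurable selection in the
closed, compact-valued solution graph (`exists_measurable_selection`).

The uniform moments rest on testing with `λu + Au`. Young's inequality bounds the convection by
`η‖Au‖² + (4η)⁻¹∫|u|²|∇u|²`. For `α = 1` both terms are absorbed by viscosity and drag exactly when
some `η < ν` has `(4η)⁻¹ < a`, that is `4νa > 1`. For `α > 1`, `|u|² ≤ ε|u|^{2α} + R`, and the
remainder `R‖∇u‖²` is absorbed by `λν‖∇u‖²` with `λ` large. Writing `E(u) = λ‖u‖² + ‖∇u‖²`, one step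
gives `E(u^k) + hc·(dissipation) ≤ E(u^{k-1} + G(u^{k-1})ΔW)` (`exists_energy_le`).

The rest is probability for a chain `‖x_{k+1}‖ ≤ ‖x_k + g_k‖` in a Hilbert space, with conditionally
centred noise of size at most `√C₀·√(1+‖x_k‖²)·η_k`. The initial value has only two moments, so the
maximal inequality is applied to a process of the size of the norm: the increments of `√(1+‖·‖²)`
caused by the noise alone are summed into a process `Y` that dominates `√(1+‖x_k‖²)` and is a
submartingale by convexity. A discrete Gronwall argument bounds `E Y_N²` by `exp(2C₀ T tr Q)` times
the initial moment, and a pathwise Doob inequality bounds the maximum. Summing the squared energy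
inequality then bounds the dissipation (`EnergyChain.exists_bound`). The step size enters only
through `N·(T/N)·tr Q`, whence uniformity in `N`. -/

lemma exists_interpolation_det (s : Finset ℝ) (hs : Module.finrank ℝ E < s.card) :
    ∃ c : ℝ → ℝ, ∑ t ∈ s, c t = 1 ∧
      ∀ A : E →L[ℝ] E, (1 + A).det = ∑ t ∈ s, c t * (1 + t • A).det := by
  classical
  have hne : s.Nonempty := Finset.card_pos.1 (by omega)
  -- `t ↦ det(1 + tA)` is a polynomial of degree at most `dim E`, so its value at `1` is
  -- extrapolated from more than `dim E` nodes with weights that do not depend on `A`.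
  refine ⟨fun t => (Lagrange.basis s id t).eval 1, ?_, fun A => ?_⟩
  · rw [← Polynomial.eval_finsetSum, Lagrange.sum_basis (Set.injOn_id _) hne, Polynomial.eval_one]
  · let b := Module.finBasis ℝ E
    let M := LinearMap.toMatrix b b (A : E →ₗ[ℝ] E)
    let p : Polynomial ℝ := Matrix.det ((Polynomial.X : Polynomial ℝ) • M.map Polynomial.C +
      (1 : Matrix _ _ ℝ).map Polynomial.C)
    have hp : ∀ t : ℝ, p.eval t = (1 + t • A).det := by
      intro t
      rw [eval_det, ContinuousLinearMap.det, ← LinearMap.det_toMatrix b]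
      congr 1
      ext i j
      simp only [matPolyEquiv_eval, Matrix.add_apply, Matrix.smul_apply, Matrix.map_apply,
        smul_eq_mul, Polynomial.eval_add, Polynomial.eval_mul, Polynomial.eval_X,
        Polynomial.eval_C, M]
      have : ((1 + t • A : E →L[ℝ] E) : E →ₗ[ℝ] E) = LinearMap.id + t • (A : E →ₗ[ℝ] E) := rfl
      rw [this, map_add, map_smul, LinearMap.toMatrix_id, Matrix.add_apply, Matrix.smul_apply,
        smul_eq_mul, add_comm]
    have hdeg : p.degree < s.card := by
      refine lt_of_le_of_lt Polynomial.degree_le_natDegree ?_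
      have := Polynomial.natDegree_det_X_add_C_le M (1 : Matrix _ _ ℝ)
      rw [Fintype.card_fin] at this
      exact_mod_cast this.trans_lt hs
    have h1 := Lagrange.eq_interpolate (s := s) (v := id) (Set.injOn_id _) hdeg
    have h2 := hp 1
    rw [one_smul] at h2
    rw [← h2, h1, Lagrange.interpolate_apply, Polynomial.eval_finsetSum]
    refine Finset.sum_congr rfl fun t _ => ?_
    rw [Polynomial.eval_mul, Polynomial.eval_C, mul_comm, id, hp]

/-- Since `‖g‖²` is locally constant, the range of `g'` is orthogonal to the nonzero vector `g x`;
hence `g'` is not onto. -/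
lemma det_eq_zero_of_norm_eq {g : E → E} {g' : E →L[ℝ] E} {x : E} {ρ : ℝ} (hρ : 0 < ρ)
    (hg : HasFDerivAt g g' x) (hn : ∀ᶠ y in 𝓝 x, ‖g y‖ = ρ) : g'.det = 0 := by
  by_contra h
  have h1 : HasFDerivAt (fun y => ‖g y‖ ^ 2) (2 • (innerSL ℝ (g x)).comp g') x := hg.norm_sq
  have h2 : HasFDerivAt (fun y => ‖g y‖ ^ 2) (0 : E →L[ℝ] ℝ) x := by
    refine (hasFDerivAt_const (ρ ^ 2) x).congr_of_eventuallyEq ?_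
    filter_upwards [hn] with y hy
    rw [hy]
  have h3 := h1.unique h2
  have hsurj : Function.Surjective g' := by
    have : IsUnit (LinearMap.det (g' : E →ₗ[ℝ] E)) := isUnit_iff_ne_zero.2 h
    exact (LinearEquiv.ofIsUnitDet (f := (g' : E →ₗ[ℝ] E)) (v := Module.finBasis ℝ E)
      (v' := Module.finBasis ℝ E) (by rwa [LinearMap.det_toMatrix])).surjective
  obtain ⟨v, hv⟩ := hsurj (g x)
  have h4 := congrArg (fun L : E →L[ℝ] ℝ => L v) h3
  simp only [smul_apply, ContinuousLinearMap.comp_apply, innerSL_apply_apply,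
    zero_apply, hv, real_inner_self_eq_norm_sq, hn.self_of_nhds] at h4
  simp [hρ.ne'] at h4

/-- There is no `C¹` map sending a ball into its boundary sphere and fixing that sphere. -/
lemma not_sphere_retraction [Nontrivial E] {ρ : ℝ} (hρ : 0 < ρ) {g : E → E} (hg : ContDiff ℝ 1 g)
    (hn : ∀ x, ‖x‖ ≤ ρ → ‖g x‖ = ρ) (hid : ∀ x, ‖x‖ = ρ → g x = x) : False := by
  borelize E
  -- The displacement `g - id`, extended by zero outside the ball; it stays globally Lipschitz
  -- because it vanishes on the sphere.
  set p : E → E := fun x => if ‖x‖ ≤ ρ then g x - x else 0 with hp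
  set A : E → E →L[ℝ] E := fun x => fderiv ℝ g x - 1 with hA
  have hAc : Continuous A := (hg.continuous_fderiv one_ne_zero).sub continuous_const
  have hd : ∀ x, HasFDerivAt (fun x => g x - x) (A x) x := fun x =>
    ((hg.differentiable one_ne_zero x).hasFDerivAt).sub (hasFDerivAt_id x)
  obtain ⟨K', hK'⟩ := (isCompact_closedBall (0 : E) ρ).exists_bound_of_continuousOn hAc.continuousOn
  set K : ℝ≥0 := K'.toNNReal + 1 with hK
  have hKb : ∀ x ∈ closedBall (0 : E) ρ, ‖A x‖₊ ≤ K := by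
    intro x hx
    have : ‖A x‖ ≤ K := (hK' x hx).trans ((Real.le_coe_toNNReal K').trans (by simp [hK]))
    exact_mod_cast this
  have hlip : LipschitzOnWith K (fun x => g x - x) (closedBall 0 ρ) :=
    (convex_closedBall (0 : E) ρ).lipschitzOnWith_of_nnnorm_hasFDerivWithin_le
      (fun x _ => (hd x).hasFDerivWithinAt) hKb
  have hpout : ∀ x, ρ ≤ ‖x‖ → p x = 0 := by
    intro x hx
    by_cases h : ‖x‖ ≤ ρ
    · simp [hp, h, hid x (le_antisymm h hx)]
    · simp [hp, h]
  have hlip1 : ∀ x y, ‖x‖ ≤ ρ → ρ ≤ ‖y‖ → ‖p x‖ ≤ K * ‖x - y‖ := by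
    intro x y hx hy
    obtain ⟨t, ht, hz⟩ : ∃ t ∈ Icc (0 : ℝ) 1, ‖x + t • (y - x)‖ = ρ := by
      have hc : ContinuousOn (fun t : ℝ => ‖x + t • (y - x)‖) (Icc 0 1) := by fun_prop
      exact intermediate_value_Icc zero_le_one hc ⟨by simpa using hx, by simpa using hy⟩
    have h1 := hlip.norm_sub_le (show x ∈ closedBall (0 : E) ρ by simpa using hx)
      (show x + t • (y - x) ∈ closedBall (0 : E) ρ by simp [hz])
    rw [hid _ hz, sub_self, sub_zero] at h1
    have h2 : p x = g x - x := by simp [hp, hx]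
    rw [h2]
    refine h1.trans (mul_le_mul_of_nonneg_left ?_ K.2)
    have : x - (x + t • (y - x)) = t • (x - y) := by module
    rw [this, norm_smul, Real.norm_of_nonneg ht.1]
    exact mul_le_of_le_one_left (norm_nonneg _) ht.2
  have hplip : ∀ x y, ‖p x - p y‖ ≤ K * ‖x - y‖ := by
    intro x y
    rcases le_total ‖x‖ ρ with hx | hx <;> rcases le_total ‖y‖ ρ with hy | hy
    · have := hlip.norm_sub_le (show x ∈ closedBall (0 : E) ρ by simpa using hx)
        (show y ∈ closedBall (0 : E) ρ by simpa using hy)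
      simpa [hp, hx, hy] using this
    · rw [hpout y hy, sub_zero]; exact hlip1 x y hx hy
    · rw [hpout x hx, zero_sub, norm_neg, norm_sub_rev]; exact hlip1 y x hy hx
    · rw [hpout x hx, hpout y hy]; simp; positivity
  obtain ⟨ε, hε, hdet⟩ : ∃ ε > 0, ∀ B : E →L[ℝ] E, ‖B‖ < ε → 0 < (1 + B).det := by
    have hc : Continuous fun B : E →L[ℝ] E => (1 + B).det :=
      ContinuousLinearMap.continuous_det.comp (continuous_const.add continuous_id)
    have h0 : 0 < (1 + (0 : E →L[ℝ] E)).det := by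
      rw [add_zero, ContinuousLinearMap.det]
      have : ((1 : E →L[ℝ] E) : E →ₗ[ℝ] E) = LinearMap.id := rfl
      rw [this, LinearMap.det_id]; norm_num
    obtain ⟨ε, hε, h⟩ := Metric.eventually_nhds_iff.1 (hc.continuousAt.eventually (lt_mem_nhds h0))
    exact ⟨ε, hε, fun B hB => h (by simpa using hB)⟩
  -- For small `t` the map `id + t p` is a Lipschitz perturbation of the identity, hence a bijection
  -- of `E`. It fixes everything outside the open ball, so it maps the ball onto itself, and the
  -- change of variables shows that the integral of its Jacobian is the volume.
  have hvol : ∀ t : ℝ, 0 ≤ t → t * K < 1 → t * K < ε →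
      ∫ x in ball (0 : E) ρ, (1 + t • A x).det = volume.real (ball (0 : E) ρ) := by
    intro t ht ht1 htε
    set f : E → E := fun x => x + t • p x with hf
    have happ : ApproximatesLinearOn f ((ContinuousLinearEquiv.refl ℝ E : E ≃L[ℝ] E) : E →L[ℝ] E)
        univ (t.toNNReal * K) := by
      intro x _ y _
      have : f x - f y - (ContinuousLinearEquiv.refl ℝ E : E →L[ℝ] E) (x - y) =
          t • (p x - p y) := by
        simp [hf, smul_sub]; abel
      rw [this, norm_smul, Real.norm_of_nonneg ht]
      push_cast
      rw [Real.coe_toNNReal _ ht, mul_assoc]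
      exact mul_le_mul_of_nonneg_left (hplip x y) ht
    have hc : Subsingleton E ∨ t.toNNReal * K <
        ‖((ContinuousLinearEquiv.refl ℝ E).symm : E →L[ℝ] E)‖₊⁻¹ := by
      right
      have : ‖((ContinuousLinearEquiv.refl ℝ E).symm : E →L[ℝ] E)‖₊ = 1 := by
        ext
        exact ContinuousLinearMap.norm_id
      rw [this, inv_one]
      have h : ((t.toNNReal * K : ℝ≥0) : ℝ) < 1 := by
        push_cast; rwa [Real.coe_toNNReal _ ht]
      exact_mod_cast h
    have hbij : Function.Bijective f := (happ.toHomeomorph f hc).bijective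
    have hfout : ∀ x, ρ ≤ ‖x‖ → f x = x := by
      intro x hx; simp [hf, hpout x hx]
    have himg : f '' ball 0 ρ = ball 0 ρ := by
      apply Subset.antisymm
      · rintro _ ⟨x, hx, rfl⟩
        by_contra h
        have h1 : ρ ≤ ‖f x‖ := by simpa using h
        have h2 := hbij.1 (hfout _ h1)
        rw [h2] at h1
        simp at hx; linarith
      · intro y hy
        obtain ⟨x, rfl⟩ := hbij.2 y
        refine ⟨x, ?_, rfl⟩
        by_contra h
        have h1 : ρ ≤ ‖x‖ := by simpa using h
        rw [hfout x h1] at hy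
        simp at hy; linarith
    have hderiv : ∀ x ∈ ball (0 : E) ρ, HasFDerivWithinAt f (1 + t • A x) (ball 0 ρ) x := by
      intro x hx
      have h1 : HasFDerivAt (fun x => x + t • (g x - x)) (1 + t • A x) x :=
        (hasFDerivAt_id x).add ((hd x).const_smul t)
      refine h1.hasFDerivWithinAt.congr (fun y hy => ?_) ?_
      · have : ‖y‖ ≤ ρ := by simp at hy; exact hy.le
        simp [hf, hp, this]
      · have : ‖x‖ ≤ ρ := by simp at hx; exact hx.le
        simp [hf, hp, this]
    have hpos : ∀ x ∈ ball (0 : E) ρ, 0 < (1 + t • A x).det := by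
      intro x hx
      refine hdet _ ?_
      rw [norm_smul, Real.norm_of_nonneg ht]
      refine lt_of_le_of_lt (mul_le_mul_of_nonneg_left ?_ ht) htε
      exact_mod_cast hKb x (ball_subset_closedBall hx)
    have h1 := lintegral_abs_det_fderiv_eq_addHaar_image volume measurableSet_ball hderiv
      hbij.1.injOn
    rw [himg] at h1
    rw [integral_eq_lintegral_of_nonneg_ae]
    · rw [Measure.real, ← h1]
      congr 1
      refine setLIntegral_congr_fun measurableSet_ball fun x hx => ?_
      simp only [abs_of_pos (hpos x hx)]
    · exact ae_restrict_of_forall_mem measurableSet_ball fun x hx => (hpos x hx).le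
    · exact (ContinuousLinearMap.continuous_det.comp
        (continuous_const.add (hAc.const_smul t))).aestronglyMeasurable
  set τ : ℝ := min 1 ε / (2 * K) with hτ
  have hK0 : (0 : ℝ) < K := by rw [hK]; positivity
  have hτ0 : 0 < τ := by positivity
  obtain ⟨s, hs1, hs2⟩ : ∃ s : Finset ℝ, ↑s ⊆ Ioo 0 τ ∧ s.card = Module.finrank ℝ E + 1 :=
    (Ioo_infinite hτ0).exists_subset_card_eq _
  -- The volume identity, known for small `t`, is extrapolated to `t = 1`. There the Jacobian is
  -- that of `g`, which vanishes identically on the ball: a contradiction.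
  obtain ⟨c, hc1, hc2⟩ := exists_interpolation_det (E := E) s (by omega)
  have hint : ∀ t : ℝ, IntegrableOn (fun x => (1 + t • A x).det) (ball (0 : E) ρ) := fun t =>
    ((ContinuousLinearMap.continuous_det.comp
      (continuous_const.add (hAc.const_smul t))).continuousOn.integrableOn_compact
        (isCompact_closedBall (0 : E) ρ)).mono_set ball_subset_closedBall
  have e1 : ∫ x in ball (0 : E) ρ, (1 + A x).det = volume.real (ball (0 : E) ρ) := by
    rw [integral_congr_ae (Eventually.of_forall fun x => hc2 (A x))]
    rw [integral_finsetSum _ fun t _ => (hint t).const_mul _]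
    have : ∀ t ∈ s, ∫ x in ball (0 : E) ρ, c t * (1 + t • A x).det =
        c t * volume.real (ball (0 : E) ρ) := by
      intro t ht
      have ht' := hs1 ht
      have h3 : t * K < min 1 ε := by
        have : t * K < τ * K := mul_lt_mul_of_pos_right ht'.2 hK0
        have e : τ * K = min 1 ε / 2 := by rw [hτ]; field_simp
        have : 0 < min 1 ε := by positivity
        linarith
      rw [integral_const_mul, hvol t ht'.1.le (h3.trans_le (min_le_left _ _))
        (h3.trans_le (min_le_right _ _))]
    rw [Finset.sum_congr rfl this, ← Finset.sum_mul, hc1, one_mul]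
  have e2 : ∫ x in ball (0 : E) ρ, (1 + A x).det = 0 := by
    refine setIntegral_eq_zero_of_forall_eq_zero fun x hx => ?_
    have : 1 + A x = fderiv ℝ g x := by simp [hA]
    rw [this]
    refine det_eq_zero_of_norm_eq hρ (hg.differentiable one_ne_zero x).hasFDerivAt ?_
    filter_upwards [isOpen_ball.mem_nhds hx] with y hy
    exact hn y (by simp at hy; exact hy.le)
  have hpos : 0 < volume.real (ball (0 : E) ρ) := by
    rw [Measure.real]
    exact ENNReal.toReal_pos (measure_ball_pos _ _ hρ).ne' measure_ball_lt_top.ne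
  rw [e1] at e2
  exact hpos.ne' e2

/-- Without a zero, blend `F` into the identity between the radii `R` and `R + 1`. The blend cannot
vanish, as its inner product with `x` is positive there, and normalising it to length `R + 1` would
retract a ball onto its sphere. -/
lemma exists_zero_of_contDiff {F : E → E} (hF : ContDiff ℝ 1 F) {R : ℝ} (hR : 0 < R)
    (hpos : ∀ x, R ≤ ‖x‖ → 0 < ⟪F x, x⟫_ℝ) : ∃ x, F x = 0 := by
  rcases subsingleton_or_nontrivial E with hE | hE
  · exact ⟨0, Subsingleton.elim _ _⟩
  by_contra! hne
  let χ : ContDiffBump (0 : E) := ⟨R, R + 1, hR, by linarith⟩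
  set f : E → E := fun x => χ x • F x + (1 - χ x) • x with hf
  have hfc : ContDiff ℝ 1 f :=
    (χ.contDiff.smul hF).add ((contDiff_const.sub χ.contDiff).smul contDiff_id)
  have hf0 : ∀ x, f x ≠ 0 := by
    intro x
    rcases le_total ‖x‖ R with hx | hx
    · have : χ x = 1 := χ.one_of_mem_closedBall (by simpa using hx)
      simpa [hf, this] using hne x
    · intro h
      have h1 : ⟪f x, x⟫_ℝ = χ x * ⟪F x, x⟫_ℝ + (1 - χ x) * ‖x‖ ^ 2 := by
        simp only [hf, inner_add_left, real_inner_smul_left, real_inner_self_eq_norm_sq]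
      rw [h, inner_zero_left] at h1
      have h2 := hpos x hx
      have h3 : 0 < ‖x‖ ^ 2 := by have : 0 < ‖x‖ := hR.trans_le hx
                                  positivity
      have h4 := χ.nonneg' x
      have h5 := χ.le_one (x := x)
      rcases h4.eq_or_lt with h6 | h6
      · rw [← h6] at h1; linarith
      · have : 0 < χ x * ⟪F x, x⟫_ℝ := mul_pos h6 h2
        have : 0 ≤ (1 - χ x) * ‖x‖ ^ 2 := mul_nonneg (by linarith) h3.le
        linarith
  have hout : ∀ x, R + 1 ≤ ‖x‖ → f x = x := by
    intro x hx
    have : χ x = 0 := χ.zero_of_le_dist (by simpa using hx)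
    simp [hf, this]
  have hR1 : 0 < R + 1 := by linarith
  refine not_sphere_retraction hR1 (g := fun x => ((R + 1) * ‖f x‖⁻¹) • f x) ?_ ?_ ?_
  · exact (contDiff_const.mul ((hfc.norm ℝ hf0).inv fun x => norm_ne_zero_iff.2 (hf0 x))).smul hfc
  · intro x _
    have := norm_ne_zero_iff.2 (hf0 x)
    rw [norm_smul, norm_mul, norm_inv, norm_norm, Real.norm_of_nonneg hR1.le, mul_assoc,
      inv_mul_cancel₀ this, mul_one]
  · intro x hx
    simp only [hout x hx.ge, hx]
    rw [mul_inv_cancel₀ hR1.ne', one_smul]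

/-- A continuous map of a finite-dimensional space that points outwards on every sphere of radius
at least `R` has a zero. -/
theorem exists_zero_of_coercive {F : E → E} (hF : Continuous F) {R : ℝ} (hR : 0 < R)
    (hpos : ∀ x, R ≤ ‖x‖ → 0 < ⟪F x, x⟫_ℝ) : ∃ x, F x = 0 := by
  by_contra! hne
  have hR1 : 0 < R + 1 := by linarith
  -- Smoothing of `F`: closeness to `F` within `‖F‖` (which excludes the value zero) and pointing
  -- outwards are convex conditions on the value, satisfied locally by constants. A partition of
  -- unity therefore produces a `C¹` map with both properties.
  have hpos' : ∀ x, ∃ c : E, ∀ᶠ y in 𝓝 x, c ∈ {c : E | (‖F y - c‖ < ‖F y‖) ∧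
      (R ≤ ‖y‖ → 0 < ⟪c, y⟫_ℝ)} := by
    intro x
    have h1 : ∀ᶠ y in 𝓝 x, ‖F y - F x‖ < ‖F y‖ := by
      have : ContinuousAt (fun y => ‖F y‖ - ‖F y - F x‖) x := by fun_prop
      have := this.eventually (lt_mem_nhds (show 0 < ‖F x‖ - ‖F x - F x‖ by simpa using hne x))
      filter_upwards [this] with y hy using by linarith
    rcases lt_or_ge ‖x‖ R with hx | hx
    · refine ⟨F x, ?_⟩
      filter_upwards [h1, continuous_norm.continuousAt.eventually (gt_mem_nhds hx)] with y hy hy'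
      exact ⟨hy, fun h => absurd h (not_le.2 hy')⟩
    · refine ⟨F x, ?_⟩
      have : ContinuousAt (fun y => ⟪F x, y⟫_ℝ) x := by fun_prop
      filter_upwards [h1, this.eventually (lt_mem_nhds (hpos x hx))] with y hy hy'
      exact ⟨hy, fun _ => hy'⟩
  have hconv : ∀ y, Convex ℝ {c : E | (‖F y - c‖ < ‖F y‖) ∧ (R ≤ ‖y‖ → 0 < ⟪c, y⟫_ℝ)} := by
    intro y
    have h1 : Convex ℝ {c : E | ‖F y - c‖ < ‖F y‖} := by
      have : {c : E | ‖F y - c‖ < ‖F y‖} = ball (F y) ‖F y‖ := by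
        ext c; simp [dist_eq_norm, norm_sub_rev]
      rw [this]; exact convex_ball _ _
    have h2 : Convex ℝ {c : E | R ≤ ‖y‖ → 0 < ⟪c, y⟫_ℝ} := by
      by_cases hy : R ≤ ‖y‖
      · have : {c : E | R ≤ ‖y‖ → 0 < ⟪c, y⟫_ℝ} = {c : E | 0 < innerSL ℝ y c} := by
          ext c; simp [hy, real_inner_comm]
        rw [this]
        exact convex_halfSpace_gt (innerSL ℝ y).toLinearMap.isLinear _
      · simp [hy, convex_univ]
    exact h1.inter h2
  obtain ⟨g, hg⟩ := exists_contMDiffMap_forall_mem_convex_of_local_const (n := 1)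
    (modelWithCornersSelf ℝ E) hconv hpos'
  have hgc : ContDiff ℝ 1 g := g.contMDiff.contDiff
  obtain ⟨x, hx⟩ := exists_zero_of_contDiff hgc hR fun x h => (hg x).2 h
  have := (hg x).1
  rw [hx, sub_zero] at this
  exact lt_irrefl _ this

end CoerciveZero

noncomputable section

namespace BFEuler

open Set Filter Topology

/-! ### Integration by parts on the periodic box -/

lemma box_eq_preimage (ℓ : ℝ) :
    box ℓ = (WithLp.ofLp : E3 → Fin 3 → ℝ) ⁻¹' Icc 0 (fun _ => ℓ) := by
  ext x
  simp [box, Pi.le_def, forall_and]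

lemma setIntegral_box {F : Type*} [NormedAddCommGroup F] [NormedSpace ℝ F] (ℓ : ℝ) (g : E3 → F) :
    ∫ x, g x ∂boxMeasure ℓ = ∫ y in Icc (0 : Fin 3 → ℝ) (fun _ => ℓ), g (WithLp.toLp 2 y) := by
  rw [boxMeasure, box_eq_preimage]
  exact ((PiLp.volume_preserving_ofLp (Fin 3)).setIntegral_preimage_emb
    (MeasurableEquiv.toLp 2 (Fin 3 → ℝ)).symm.measurableEmbedding
      (fun y => g (WithLp.toLp 2 y)) _)

/-- The integral over a period cell of a derivative of a periodic function vanishes. -/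
lemma integral_fderiv_eq_zero {ℓ : ℝ} (hℓ : 0 < ℓ) {ψ : E3 → ℝ} (hψ : ContDiff ℝ 1 ψ)
    (hper : ∀ x i, ψ (x + ℓ • basisVec i) = ψ x) (j : Fin 3) :
    ∫ x, fderiv ℝ ψ x (basisVec j) ∂boxMeasure ℓ = 0 := by
  rw [setIntegral_box]
  let L : (Fin 3 → ℝ) →L[ℝ] E3 := (EuclideanSpace.equiv (Fin 3) ℝ).symm.toContinuousLinearMap
  -- The divergence theorem is applied to the field `ψ eⱼ`; its two face integrals in direction `j`
  -- cancel by periodicity.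
  let f : Fin 3 → (Fin 3 → ℝ) → ℝ := fun i y => if i = j then ψ (L y) else 0
  let f' : Fin 3 → (Fin 3 → ℝ) → (Fin 3 → ℝ) →L[ℝ] ℝ := fun i y =>
    if i = j then (fderiv ℝ ψ (L y)).comp L else 0
  have hsum : ∀ y, ∑ i, f' i y (Pi.single i 1) = fderiv ℝ ψ (WithLp.toLp 2 y) (basisVec j) := by
    intro y
    rw [Finset.sum_eq_single j]
    · simp only [f', if_true]
      rfl
    · intro i _ hi
      simp [f', hi]
    · simp
  have hLc : Continuous fun y => fderiv ℝ ψ (L y) (basisVec j) :=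
    ((hψ.continuous_fderiv one_ne_zero).comp L.continuous).clm_apply continuous_const
  have key := integral_divergence_of_hasFDerivAt_off_countable' (0 : Fin 3 → ℝ) (fun _ => ℓ)
    (fun _ => hℓ.le) f f' ∅ countable_empty (fun i => ?_) (fun x _ i => ?_) ?_
  · simp_rw [hsum] at key
    rw [key]
    refine Finset.sum_eq_zero fun i _ => ?_
    rw [sub_eq_zero]
    refine setIntegral_congr_fun measurableSet_Icc fun y _ => ?_
    simp only [f]
    split_ifs with h
    · have : L (i.insertNth ℓ y) = L (i.insertNth ((0 : Fin 3 → ℝ) i) y) + ℓ • basisVec i := by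
        ext m
        change (i.insertNth ℓ y : Fin 3 → ℝ) m =
          (i.insertNth ((0 : Fin 3 → ℝ) i) y : Fin 3 → ℝ) m + ℓ * basisVec i m
        refine Fin.succAboveCases i ?_ (fun p => ?_) m
        · simp [basisVec]
        · simp [basisVec, Fin.succAbove_ne]
      rw [this, hper]
    · rfl
  · by_cases h : i = j
    · simp only [f, h, if_true]
      exact (hψ.continuous.comp L.continuous).continuousOn
    · simp only [f, h, if_false]
      exact continuousOn_const
  · by_cases h : i = j
    · simp only [f, f', h, if_true]
      exact ((hψ.differentiable one_ne_zero _).hasFDerivAt).comp x L.hasFDerivAt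
    · simp only [f, f', h, if_false]
      exact hasFDerivAt_const _ _
  · simp_rw [hsum]
    exact (hLc.continuousOn).integrableOn_compact isCompact_Icc

lemma integral_mul_fderiv_eq {ℓ : ℝ} (hℓ : 0 < ℓ) {φ ψ : E3 → ℝ} (hφ : ContDiff ℝ 1 φ)
    (hψ : ContDiff ℝ 1 ψ) (hφp : ∀ x i, φ (x + ℓ • basisVec i) = φ x)
    (hψp : ∀ x i, ψ (x + ℓ • basisVec i) = ψ x) (j : Fin 3) :
    ∫ x, fderiv ℝ φ x (basisVec j) * ψ x ∂boxMeasure ℓ =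
      -∫ x, φ x * fderiv ℝ ψ x (basisVec j) ∂boxMeasure ℓ := by
  have h := integral_fderiv_eq_zero hℓ (hφ.mul hψ) (fun x i => by simp [hφp, hψp]) j
  have e : ∀ x, fderiv ℝ (fun x => φ x * ψ x) x (basisVec j) =
      fderiv ℝ φ x (basisVec j) * ψ x + φ x * fderiv ℝ ψ x (basisVec j) := by
    intro x
    have := ((hφ.differentiable one_ne_zero x).hasFDerivAt.mul
      (hψ.differentiable one_ne_zero x).hasFDerivAt).fderiv
    have h2 : fderiv ℝ (fun x => φ x * ψ x) x = φ x • fderiv ℝ ψ x + ψ x • fderiv ℝ φ x := this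
    rw [h2]
    simp; ring
  have hi : ∀ {c : E3 → ℝ}, Continuous c → Integrable c (boxMeasure ℓ) := fun hc =>
    memLp_one_iff_integrable.1 (memLp_of_continuous ℓ 1 hc)
  change ∫ x, fderiv ℝ (fun x => φ x * ψ x) x (basisVec j) ∂boxMeasure ℓ = 0 at h
  simp_rw [e] at h
  rw [integral_add] at h
  · linarith
  · exact hi (((hφ.continuous_fderiv one_ne_zero).clm_apply continuous_const).mul hψ.continuous)
  · exact hi (hφ.continuous.mul ((hψ.continuous_fderiv one_ne_zero).clm_apply continuous_const))

/-! ### Trigonometric system -/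

/-- Indices of the real trigonometric system: a frequency, and the choice between cosine and
sine. -/
abbrev Idx : Type := (Fin 3 → ℤ) × Bool

/-- The phase `(2π/ℓ) k·x`, as a linear form in `x`. -/
def phase (ℓ : ℝ) (k : Fin 3 → ℤ) : E3 →L[ℝ] ℝ :=
  (2 * Real.pi / ℓ) • ∑ m, (k m : ℝ) • EuclideanSpace.proj m

lemma phase_apply (ℓ : ℝ) (k : Fin 3 → ℤ) (x : E3) :
    phase ℓ k x = 2 * Real.pi / ℓ * ∑ m, (k m : ℝ) * x m := by
  simp [phase]

/-- The functions `cos((2π/ℓ) k·x)` and `sin((2π/ℓ) k·x)`. -/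
def trig (ℓ : ℝ) (i : Idx) (x : E3) : ℝ :=
  if i.2 then Real.sin (phase ℓ i.1 x) else Real.cos (phase ℓ i.1 x)

/-- Exchange of cosine and sine. -/
def Idx.flip (i : Idx) : Idx := (i.1, !i.2)

/-- The factor in `∂ⱼ trig i = freq j i * trig i.flip`. -/
def freq (ℓ : ℝ) (j : Fin 3) (i : Idx) : ℝ :=
  (if i.2 then 1 else -1) * (2 * Real.pi / ℓ * i.1 j)

@[simp] lemma Idx.flip_flip (i : Idx) : i.flip.flip = i := by
  simp [Idx.flip]

@[simp] lemma freq_flip (ℓ : ℝ) (j : Fin 3) (i : Idx) : freq ℓ j i.flip = -freq ℓ j i := by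
  rcases i with ⟨k, b⟩
  cases b <;> simp [freq, Idx.flip]

/-- `flip` as an equivalence. -/
def flipEquiv : Idx ≃ Idx := ⟨Idx.flip, Idx.flip, Idx.flip_flip, Idx.flip_flip⟩

lemma abs_trig_le (ℓ : ℝ) (i : Idx) (x : E3) : |trig ℓ i x| ≤ 1 := by
  unfold trig
  split_ifs
  · exact Real.abs_sin_le_one _
  · exact Real.abs_cos_le_one _

lemma contDiff_trig (ℓ : ℝ) (i : Idx) {n : WithTop ℕ∞} : ContDiff ℝ n (trig ℓ i) := by
  unfold trig
  split_ifs
  · exact Real.contDiff_sin.comp (phase ℓ i.1).contDiff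
  · exact Real.contDiff_cos.comp (phase ℓ i.1).contDiff

lemma phase_basisVec (ℓ : ℝ) (k : Fin 3 → ℤ) (j : Fin 3) :
    phase ℓ k (basisVec j) = 2 * Real.pi / ℓ * k j := by
  rw [phase_apply, Finset.sum_eq_single j]
  · simp [basisVec]
  · intro m _ hm
    simp [basisVec, hm]
  · simp

lemma isPeriodicTest_trig {ℓ : ℝ} (hℓ : 0 < ℓ) (i : Idx) : IsPeriodicTest ℓ (trig ℓ i) := by
  refine ⟨contDiff_trig ℓ i, fun x j => ?_⟩
  have h : phase ℓ i.1 (x + ℓ • basisVec j) = phase ℓ i.1 x + (i.1 j : ℝ) * (2 * Real.pi) := by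
    rw [map_add, map_smul, phase_basisVec]
    field_simp
    simp only [smul_eq_mul]
    field_simp
  unfold trig
  rw [h]
  split_ifs
  · exact Real.sin_add_int_mul_two_pi _ _
  · exact Real.cos_add_int_mul_two_pi _ _

lemma hasFDerivAt_trig (ℓ : ℝ) (i : Idx) (x : E3) :
    HasFDerivAt (trig ℓ i) (((if i.2 then 1 else -1) * trig ℓ i.flip x) • phase ℓ i.1) x := by
  rcases i with ⟨k, b⟩
  cases b
  · have := (phase ℓ k).hasFDerivAt (x := x) |>.cos
    have h : trig ℓ (k, false) = fun x => Real.cos (phase ℓ k x) := rfl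
    simpa [h, trig, Idx.flip] using! this
  · have := (phase ℓ k).hasFDerivAt (x := x) |>.sin
    have h : trig ℓ (k, true) = fun x => Real.sin (phase ℓ k x) := rfl
    simpa [h, trig, Idx.flip] using! this

lemma fderiv_trig (ℓ : ℝ) (i : Idx) (x : E3) (j : Fin 3) :
    fderiv ℝ (trig ℓ i) x (basisVec j) = freq ℓ j i * trig ℓ i.flip x := by
  rw [(hasFDerivAt_trig ℓ i x).fderiv, smul_apply, phase_basisVec, freq,
    smul_eq_mul]
  ring

/-! ### Parseval's identity -/

/-- The map from the unit torus onto the period cell. -/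
def cellMap (ℓ : ℝ) (t : UnitAddTorus (Fin 3)) : E3 :=
  ℓ • WithLp.toLp 2 (UnitAddTorus.measurableEquivPiIoc (fun _ => (0 : ℝ)) t : Fin 3 → ℝ)

/-- The normalised Haar measure of the torus. -/
def torusMeasure : Measure (UnitAddTorus (Fin 3)) :=
  Measure.pi fun _ => (AddCircle.haarAddCircle : Measure (AddCircle (1 : ℝ)))

/-- The torus is represented by a half-open cell, which differs from the closed box by a null set;
`ℓ⁻³` normalises the volume. -/
lemma measurePreserving_cellMap {ℓ : ℝ} (hℓ : 0 < ℓ) :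
    MeasurePreserving (cellMap ℓ) torusMeasure (ENNReal.ofReal (ℓ ^ 3)⁻¹ • boxMeasure ℓ) := by
  have hS : MeasurableSet {x : Fin 3 → ℝ | ∀ i, x i ∈ Ioc (0 : ℝ) (0 + 1)} :=
    MeasurableSet.univ_pi' fun i => measurableSet_Ioc
  have m1 : MeasurePreserving (UnitAddTorus.measurableEquivPiIoc (fun _ : Fin 3 => (0 : ℝ)))
      torusMeasure (volume.comap Subtype.val) :=
    UnitAddTorus.measurePreserving_equivPiIoc (fun _ : Fin 3 => (0 : ℝ))
  have m2 := measurePreserving_subtype_coe (μa := (volume : Measure (Fin 3 → ℝ))) hS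
  have m3 := (PiLp.volume_preserving_toLp (Fin 3)).restrict_preimage_emb
    (MeasurableEquiv.toLp 2 (Fin 3 → ℝ)).measurableEmbedding
    {x : E3 | ∀ i, x i ∈ Ioc (0 : ℝ) (0 + 1)}
  have m4 : MeasurePreserving (fun x : E3 => ℓ • x) volume
      (ENNReal.ofReal (ℓ ^ 3)⁻¹ • volume) := by
    refine ⟨measurable_const_smul ℓ, ?_⟩
    rw [Measure.map_addHaar_smul _ hℓ.ne', finrank_euclideanSpace_fin, abs_of_pos (by positivity)]
  have m5 := m4.restrict_preimage_emb (MeasurableEquiv.smul₀ ℓ hℓ.ne').measurableEmbedding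
    {x : E3 | ∀ i, x i ∈ Ioc (0 : ℝ) ℓ}
  have hpre : (fun x : E3 => ℓ • x) ⁻¹' {x : E3 | ∀ i, x i ∈ Ioc (0 : ℝ) ℓ} =
      {x : E3 | ∀ i, x i ∈ Ioc (0 : ℝ) (0 + 1)} := by
    ext x
    simp only [mem_preimage, mem_ofPred_eq, PiLp.smul_apply, smul_eq_mul, mem_Ioc, zero_add]
    refine forall_congr' fun i => ?_
    rw [mul_pos_iff_of_pos_left hℓ, mul_le_iff_le_one_right hℓ]
  rw [hpre] at m5
  have hbox : (volume : Measure E3).restrict {x : E3 | ∀ i, x i ∈ Ioc (0 : ℝ) ℓ} = boxMeasure ℓ := by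
    refine Measure.restrict_congr_set ?_
    have h1 : {x : E3 | ∀ i, x i ∈ Ioc (0 : ℝ) ℓ} = (WithLp.ofLp : E3 → Fin 3 → ℝ) ⁻¹'
        (Set.pi univ fun _ => Ioc 0 ℓ) := by ext x; simp
    rw [h1, box_eq_preimage]
    refine (PiLp.volume_preserving_ofLp (Fin 3)).quasiMeasurePreserving.preimage_ae_eq ?_
    exact Measure.univ_pi_Ioc_ae_eq_Icc
  rw [Measure.restrict_smul, hbox] at m5
  exact m5.comp (m3.comp (m2.comp m1))

/-- The character of frequency `-k` is the one integrated in `mFourierCoeff`, so the cosine and sine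
integrals are the real part and minus the imaginary part of the complex coefficient of a real
function. -/
lemma mFourier_eq {ℓ : ℝ} (hℓ : 0 < ℓ) (k : Fin 3 → ℤ) (t : UnitAddTorus (Fin 3)) :
    UnitAddTorus.mFourier (-k) t =
      (trig ℓ (k, false) (cellMap ℓ t) : ℂ) - trig ℓ (k, true) (cellMap ℓ t) * Complex.I := by
  set y : Fin 3 → ℝ := (UnitAddTorus.measurableEquivPiIoc (fun _ => (0 : ℝ)) t : Fin 3 → ℝ) with hy
  have ht : t = fun i => ((y i : ℝ) : UnitAddCircle) := by
    have := (UnitAddTorus.measurableEquivPiIoc (fun _ : Fin 3 => (0 : ℝ))).symm_apply_apply t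
    rw [UnitAddTorus.coe_symm_measurableEquivPiIoc_apply] at this
    exact this.symm
  have hph : phase ℓ k (cellMap ℓ t) = 2 * Real.pi * ∑ m, (k m : ℝ) * y m := by
    rw [cellMap, map_smul, phase_apply, smul_eq_mul]
    simp only [← hy]
    field_simp
  have h1 : UnitAddTorus.mFourier (-k) t =
      Complex.exp (-(phase ℓ k (cellMap ℓ t) : ℂ) * Complex.I) := by
    have h2 : UnitAddTorus.mFourier (-k) t = ∏ i, fourier ((-k) i) (t i) := rfl
    rw [h2, hph]
    have : ∀ i, fourier ((-k) i) (t i) =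
        Complex.exp (-(2 * Real.pi * Complex.I * (k i : ℂ) * (y i : ℂ))) := by
      intro i
      rw [congrFun ht i, fourier_coe_apply]
      congr 1
      simp
    simp_rw [this]
    rw [← Complex.exp_sum]
    congr 1
    push_cast
    rw [Finset.sum_neg_distrib, Finset.mul_sum, neg_mul, Finset.sum_mul]
    congr 1
    refine Finset.sum_congr rfl fun i _ => ?_
    ring
  rw [h1, Complex.exp_mul_I, Complex.cos_neg, Complex.sin_neg]
  simp [trig, sub_eq_add_neg]

/-- Complex Parseval on the torus, split into real and imaginary parts. The real system is
redundant, since `k` and `-k` give the same functions up to sign: this is a tight frame identity and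
not an orthonormal expansion. -/
lemma hasSum_sq_integral_trig {ℓ : ℝ} (hℓ : 0 < ℓ) {g : E3 → ℝ} (hg : MemLp g 2 (boxMeasure ℓ)) :
    HasSum (fun i : Idx => (∫ x, trig ℓ i x * g x ∂boxMeasure ℓ) ^ 2)
      (ℓ ^ 3 * ∫ x, g x ^ 2 ∂boxMeasure ℓ) := by
  have hmp := measurePreserving_cellMap hℓ
  have hg' : MemLp g 2 (ENNReal.ofReal (ℓ ^ 3)⁻¹ • boxMeasure ℓ) :=
    hg.smul_measure ENNReal.ofReal_ne_top
  have hF : MemLp (fun t => (g (cellMap ℓ t) : ℂ)) 2 torusMeasure :=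
    (hg'.comp_measurePreserving hmp).ofReal
  have hcomp : ∀ h : E3 → ℝ, AEStronglyMeasurable h (boxMeasure ℓ) →
      ∫ t, h (cellMap ℓ t) ∂torusMeasure = (ℓ ^ 3)⁻¹ * ∫ x, h x ∂boxMeasure ℓ := by
    intro h hh
    have := hmp.map_eq ▸ (integral_map hmp.measurable.aemeasurable (f := h)
      (hmp.map_eq ▸ hh.smul_measure _)).symm
    rw [this, integral_smul_measure, ENNReal.toReal_ofReal (by positivity), smul_eq_mul]
  have hP : HasSum (fun k => ‖UnitAddTorus.mFourierCoeff (hF.toLp _ : Lp ℂ 2 torusMeasure) k‖ ^ 2)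
      (∫ t, ‖(hF.toLp _ : Lp ℂ 2 torusMeasure) t‖ ^ 2 ∂torusMeasure) :=
    UnitAddTorus.hasSum_sq_mFourierCoeff (d := Fin 3) (hF.toLp _)
  have hnorm : ∫ t, ‖(hF.toLp _ : Lp ℂ 2 torusMeasure) t‖ ^ 2 ∂torusMeasure =
      (ℓ ^ 3)⁻¹ * ∫ x, g x ^ 2 ∂boxMeasure ℓ := by
    rw [← hcomp (fun x => g x ^ 2) (hg.1.pow 2)]
    refine integral_congr_ae ?_
    filter_upwards [hF.coeFn_toLp] with t ht
    rw [ht, Complex.norm_real, Real.norm_eq_abs, sq_abs]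
  have hti : ∀ i, Integrable (fun x => trig ℓ i x * g x) (boxMeasure ℓ) := fun i =>
    ((memLp_of_continuous ℓ 2 (contDiff_trig ℓ i (n := 0)).continuous).integrable_mul hg)
  have hcoef : ∀ k, ‖UnitAddTorus.mFourierCoeff (hF.toLp _ : Lp ℂ 2 torusMeasure) k‖ ^ 2 =
      ((ℓ ^ 3)⁻¹) ^ 2 * ((∫ x, trig ℓ (k, false) x * g x ∂boxMeasure ℓ) ^ 2 +
        (∫ x, trig ℓ (k, true) x * g x ∂boxMeasure ℓ) ^ 2) := by
    intro k
    have e : UnitAddTorus.mFourierCoeff (hF.toLp _ : Lp ℂ 2 torusMeasure) k =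
        ∫ t, (((trig ℓ (k, false) (cellMap ℓ t) * g (cellMap ℓ t) : ℝ) : ℂ) -
          ((trig ℓ (k, true) (cellMap ℓ t) * g (cellMap ℓ t) : ℝ) : ℂ) * Complex.I)
          ∂torusMeasure := by
      refine integral_congr_ae ?_
      filter_upwards [hF.coeFn_toLp] with t ht
      rw [ht, mFourier_eq hℓ, smul_eq_mul]
      push_cast
      ring
    have hint : ∀ i, Integrable (fun t => trig ℓ i (cellMap ℓ t) * g (cellMap ℓ t))
        torusMeasure := fun i =>
      hmp.integrable_comp_of_integrable ((hti i).smul_measure ENNReal.ofReal_ne_top)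
    rw [e, integral_sub (hint _).ofReal ((hint _).ofReal.mul_const _), integral_mul_const,
      integral_complex_ofReal, integral_complex_ofReal, hcomp _ (hti _).1, hcomp _ (hti _).1, ← Complex.normSq_eq_norm_sq,
      Complex.normSq_apply]
    simp only [Complex.sub_re, Complex.sub_im, Complex.ofReal_re, Complex.ofReal_im,
      Complex.mul_re, Complex.mul_im, Complex.I_re, Complex.I_im]
    ring
  rw [hnorm] at hP
  simp_rw [hcoef] at hP
  set f : Idx → ℝ := fun i => (∫ x, trig ℓ i x * g x ∂boxMeasure ℓ) ^ 2 with hf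
  have hP' : HasSum (fun k => f (k, false) + f (k, true)) (ℓ ^ 3 * ∫ x, g x ^ 2 ∂boxMeasure ℓ) := by
    have := hP.mul_left ((ℓ ^ 3) ^ 2)
    convert! this using 1
    · funext k
      rw [← mul_assoc, ← mul_pow, mul_inv_cancel₀ (by positivity), one_pow, one_mul]
    · field_simp
  have hf0 : 0 ≤ f := fun i => sq_nonneg _
  have hfib : ∀ k, HasSum (fun b => f (k, b)) (f (k, false) + f (k, true)) := by
    intro k
    have := hasSum_fintype fun b => f (k, b)
    rwa [Fintype.sum_bool, add_comm] at this
  have hS : Summable f := by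
    refine (summable_prod_of_nonneg hf0).2 ⟨fun k => (hfib k).summable, ?_⟩
    simp_rw [fun k => (hfib k).tsum_eq]
    exact hP'.summable
  have := hS.hasSum.prod_fiberwise hfib
  rw [← this.unique hP']
  exact hS.hasSum

end BFEuler

end

noncomputable section

namespace BFEuler

open Set Filter Topology

/-! ### Fourier coefficients of vector fields -/

/-- The field `x ↦ c x • v`, as a linear function of `v`. -/
def tens (ℓ : ℝ) (c : C(E3, ℝ)) : E3 →L[ℝ] L2 ℓ :=
  LinearMap.toContinuousLinearMap
    { toFun := fun v => (memLp_of_continuous ℓ 2 (c.continuous.smul continuous_const)).toLp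
        (fun x => c x • v)
      map_add' := fun v w => by
        rw [← MemLp.toLp_add]
        congr 1
        ext x : 1
        simp [smul_add]
      map_smul' := fun r v => by
        rw [RingHom.id_apply, ← MemLp.toLp_const_smul]
        congr 1
        ext x : 1
        exact smul_comm _ _ _ }

lemma coeFn_tens (ℓ : ℝ) (c : C(E3, ℝ)) (v : E3) :
    tens ℓ c v =ᵐ[boxMeasure ℓ] fun x => c x • v :=
  MemLp.coeFn_toLp (memLp_of_continuous ℓ 2 (c.continuous.smul continuous_const))

lemma adjoint_tens_apply (ℓ : ℝ) (c : C(E3, ℝ)) (f : L2 ℓ) :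
    (tens ℓ c).adjoint f = ∫ x, c x • f x ∂boxMeasure ℓ := by
  refine ext_inner_left ℝ fun v => ?_
  rw [ContinuousLinearMap.adjoint_inner_right, L2.inner_def,
    ← integral_inner (integrable_smul_of_continuous ℓ c.continuous f)]
  refine integral_congr_ae ?_
  filter_upwards [coeFn_tens ℓ c v] with x hx
  rw [hx, real_inner_smul_left, real_inner_smul_right]

/-- `trig` as a bundled continuous map. -/
def trigC (ℓ : ℝ) (i : Idx) : C(E3, ℝ) := ⟨trig ℓ i, (contDiff_trig ℓ i (n := 0)).continuous⟩

/-- The field `x ↦ trig i x • v`. -/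
def mode (ℓ : ℝ) (i : Idx) : E3 →L[ℝ] L2 ℓ := tens ℓ (trigC ℓ i)

/-- The Fourier coefficient `∫ trig i x • f x dx`. -/
def coef (ℓ : ℝ) (i : Idx) : L2 ℓ →L[ℝ] E3 := (mode ℓ i).adjoint

lemma coef_apply (ℓ : ℝ) (i : Idx) (f : L2 ℓ) :
    coef ℓ i f = ∫ x, trig ℓ i x • f x ∂boxMeasure ℓ := adjoint_tens_apply ℓ _ f

lemma coeFn_mode (ℓ : ℝ) (i : Idx) (v : E3) :
    mode ℓ i v =ᵐ[boxMeasure ℓ] fun x => trig ℓ i x • v := coeFn_tens ℓ _ v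

lemma memLp_coord {ℓ : ℝ} (f : L2 ℓ) (m : Fin 3) :
    MemLp (fun x => f x m) 2 (boxMeasure ℓ) :=
  (EuclideanSpace.proj m : E3 →L[ℝ] ℝ).comp_memLp' (Lp.memLp f)

lemma coef_coord (ℓ : ℝ) (i : Idx) (f : L2 ℓ) (m : Fin 3) :
    coef ℓ i f m = ∫ x, trig ℓ i x * f x m ∂boxMeasure ℓ := by
  rw [coef_apply]
  exact ((EuclideanSpace.proj m : E3 →L[ℝ] ℝ).integral_comp_comm
    (integrable_smul_of_continuous ℓ (trigC ℓ i).continuous f)).symm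

lemma norm_sq_eq_integral {ℓ : ℝ} (f : L2 ℓ) : ‖f‖ ^ 2 = ∫ x, ‖f x‖ ^ 2 ∂boxMeasure ℓ := by
  rw [← real_inner_self_eq_norm_sq, L2.inner_def]
  simp_rw [real_inner_self_eq_norm_sq]

lemma hasSum_norm_sq_coef {ℓ : ℝ} (hℓ : 0 < ℓ) (f : L2 ℓ) :
    HasSum (fun i => ‖coef ℓ i f‖ ^ 2) (ℓ ^ 3 * ‖f‖ ^ 2) := by
  have h := hasSum_sum (s := Finset.univ) fun m _ => hasSum_sq_integral_trig hℓ (memLp_coord f m)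
  convert! h using 1
  · funext i
    simp_rw [EuclideanSpace.norm_sq_eq, coef_coord, Real.norm_eq_abs, sq_abs]
  · rw [← Finset.mul_sum, norm_sq_eq_integral,
      ← integral_finsetSum _ fun m _ => (memLp_coord f m).integrable_sq]
    simp_rw [EuclideanSpace.norm_sq_eq, Real.norm_eq_abs, sq_abs]

lemma memℓp_coef {ℓ : ℝ} (hℓ : 0 < ℓ) (f : L2 ℓ) :
    Memℓp (fun i => (√(ℓ ^ 3))⁻¹ • coef ℓ i f) 2 := memℓp_gen (by
  have h := ((hasSum_norm_sq_coef hℓ f).mul_left ((√(ℓ ^ 3))⁻¹ ^ 2)).summable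
  convert! h using 2 with i
  rw [ENNReal.toReal_ofNat, Real.rpow_two, norm_smul, mul_pow, Real.norm_eq_abs, sq_abs])

lemma lp_norm_sq {m : lp (fun _ : Idx => E3) 2} {a : ℝ} (h : HasSum (fun i => ‖m i‖ ^ 2) a) :
    ‖m‖ ^ 2 = a := by
  have h2 : (0 : ℝ) < (2 : ℝ≥0∞).toReal := by norm_num
  have h1 := lp.norm_rpow_eq_tsum h2 m
  simp only [ENNReal.toReal_ofNat, Real.rpow_two] at h1
  rw [h1, h.tsum_eq]

/-- The analysis operator of the trigonometric system, normalised to be an isometry. -/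
def analysis {ℓ : ℝ} (hℓ : 0 < ℓ) : L2 ℓ →ₗᵢ[ℝ] lp (fun _ : Idx => E3) 2 where
  toFun f := ⟨fun i => (√(ℓ ^ 3))⁻¹ • coef ℓ i f, memℓp_coef hℓ f⟩
  map_add' f g := by
    ext1
    funext i
    change (√(ℓ ^ 3))⁻¹ • coef ℓ i (f + g) =
      (√(ℓ ^ 3))⁻¹ • coef ℓ i f + (√(ℓ ^ 3))⁻¹ • coef ℓ i g
    rw [map_add, smul_add]
  map_smul' c f := by
    ext1
    funext i
    change (√(ℓ ^ 3))⁻¹ • coef ℓ i (c • f) = c • (√(ℓ ^ 3))⁻¹ • coef ℓ i f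
    rw [map_smul, smul_comm]
  norm_map' f := by
    refine (sq_eq_sq₀ (norm_nonneg _) (norm_nonneg _)).1 (lp_norm_sq ?_)
    have h := ((hasSum_norm_sq_coef hℓ f).mul_left ((√(ℓ ^ 3))⁻¹ ^ 2))
    convert! h using 1
    · funext i
      change ‖(√(ℓ ^ 3))⁻¹ • coef ℓ i f‖ ^ 2 = _
      rw [norm_smul, mul_pow, Real.norm_eq_abs, sq_abs]
    · rw [inv_pow, Real.sq_sqrt (by positivity), ← mul_assoc, inv_mul_cancel₀ (by positivity),
        one_mul]

lemma analysis_apply {ℓ : ℝ} (hℓ : 0 < ℓ) (f : L2 ℓ) (i : Idx) :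
    analysis hℓ f i = (√(ℓ ^ 3))⁻¹ • coef ℓ i f := rfl

/-- The synthesis operator, adjoint to `analysis`. -/
def synthesis {ℓ : ℝ} (hℓ : 0 < ℓ) : lp (fun _ : Idx => E3) 2 →L[ℝ] L2 ℓ :=
  (analysis hℓ).toContinuousLinearMap.adjoint

/-- The adjoint of an isometry is a left inverse. This reconstruction property replaces
orthonormality for the redundant system. -/
lemma synthesis_analysis {ℓ : ℝ} (hℓ : 0 < ℓ) (f : L2 ℓ) : synthesis hℓ (analysis hℓ f) = f := by
  refine ext_inner_left ℝ fun g => ?_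
  rw [synthesis, ContinuousLinearMap.adjoint_inner_right]
  exact (analysis hℓ).inner_map_map g f

open Classical in
lemma synthesis_single {ℓ : ℝ} (hℓ : 0 < ℓ) (i : Idx) (v : E3) :
    synthesis hℓ (lp.single 2 i v) = (√(ℓ ^ 3))⁻¹ • mode ℓ i v := by
  refine ext_inner_right ℝ fun g => ?_
  rw [synthesis, ContinuousLinearMap.adjoint_inner_left, real_inner_smul_left]
  have := lp.inner_single_left (𝕜 := ℝ) i v (analysis hℓ g)
  refine Eq.trans this ?_
  rw [analysis_apply, real_inner_smul_right, coef, ContinuousLinearMap.adjoint_inner_right]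

lemma hasSum_synthesis {ℓ : ℝ} (hℓ : 0 < ℓ) (m : lp (fun _ : Idx => E3) 2) :
    HasSum (fun i => (√(ℓ ^ 3))⁻¹ • mode ℓ i (m i)) (synthesis hℓ m) := by
  classical
  have := (lp.hasSum_single (by norm_num) m).mapL (synthesis hℓ)
  simpa only [synthesis_single] using this

/-- The Fourier series of a field converges to it in `𝕃²`. -/
lemma hasSum_mode_coef {ℓ : ℝ} (hℓ : 0 < ℓ) (f : L2 ℓ) :
    HasSum (fun i => (ℓ ^ 3)⁻¹ • mode ℓ i (coef ℓ i f)) f := by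
  have := hasSum_synthesis hℓ (analysis hℓ f)
  rw [synthesis_analysis] at this
  convert! this using 2 with i
  rw [analysis_apply, map_smul, smul_smul, ← mul_inv, Real.mul_self_sqrt (by positivity)]

lemma exists_hasSum_mode {ℓ : ℝ} (hℓ : 0 < ℓ) {m : Idx → E3} (hm : Summable fun i => ‖m i‖ ^ 2) :
    ∃ g : L2 ℓ, HasSum (fun i => mode ℓ i (m i)) g ∧ ‖g‖ ^ 2 ≤ ℓ ^ 3 * ∑' i, ‖m i‖ ^ 2 := by
  have h2 : (0 : ℝ) < (2 : ℝ≥0∞).toReal := by norm_num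
  have hm' : Memℓp m 2 := memℓp_gen (by simpa using hm)
  let M : lp (fun _ : Idx => E3) 2 := ⟨m, hm'⟩
  have h := (hasSum_synthesis hℓ M).const_smul (√(ℓ ^ 3))
  refine ⟨√(ℓ ^ 3) • synthesis hℓ M, ?_, ?_⟩
  · convert! h using 2 with i
    rw [smul_smul, mul_inv_cancel₀ (by positivity), one_smul]
  · have hn : ‖synthesis hℓ M‖ ≤ ‖M‖ := by
      refine (ContinuousLinearMap.le_opNorm _ _).trans ?_
      refine mul_le_of_le_one_left (norm_nonneg _) ?_
      rw [synthesis, LinearIsometryEquiv.norm_map]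
      exact (analysis hℓ).norm_toContinuousLinearMap_le
    have hM := lp.norm_rpow_eq_tsum h2 M
    simp only [ENNReal.toReal_ofNat, Real.rpow_two] at hM
    rw [norm_smul, mul_pow, Real.norm_eq_abs, sq_abs, Real.sq_sqrt (by positivity)]
    refine mul_le_mul_of_nonneg_left ?_ (by positivity)
    calc ‖synthesis hℓ M‖ ^ 2 ≤ ‖M‖ ^ 2 := by gcongr
      _ = _ := hM

lemma hasSum_inner_coef {ℓ : ℝ} (hℓ : 0 < ℓ) (f g : L2 ℓ) :
    HasSum (fun i => ⟪coef ℓ i f, coef ℓ i g⟫_ℝ) (ℓ ^ 3 * ⟪f, g⟫_ℝ) := by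
  have h := ((hasSum_mode_coef hℓ f).mapL (innerSL ℝ g)).mul_left (ℓ ^ 3)
  convert! h using 1
  · funext i
    rw [innerSL_apply_apply, real_inner_smul_right, ← mul_assoc, mul_inv_cancel₀ (by positivity),
      one_mul, ← ContinuousLinearMap.adjoint_inner_left, real_inner_comm, coef,
      ContinuousLinearMap.adjoint_adjoint]
  · rw [innerSL_apply_apply, real_inner_comm]

lemma eq_of_coef_eq {ℓ : ℝ} (hℓ : 0 < ℓ) {f g : L2 ℓ} (h : ∀ i, coef ℓ i f = coef ℓ i g) :
    f = g := by
  have h1 := hasSum_mode_coef hℓ f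
  simp_rw [h] at h1
  exact h1.unique (hasSum_mode_coef hℓ g)

lemma norm_coef_le {ℓ : ℝ} (hℓ : 0 < ℓ) (i : Idx) (f : L2 ℓ) :
    ‖coef ℓ i f‖ ≤ √(ℓ ^ 3) * ‖f‖ := by
  have h := le_hasSum (hasSum_norm_sq_coef hℓ f) i fun _ _ => sq_nonneg _
  refine abs_le_of_sq_le_sq' ?_ (by positivity) |>.2
  rwa [mul_pow, Real.sq_sqrt (by positivity)]

/-! ### Weak derivatives and divergence in terms of Fourier coefficients -/

/-- The derivative of a test function as a continuous map. -/
def IsPeriodicTest.derivC {ℓ : ℝ} {ψ : E3 → ℝ} (h : IsPeriodicTest ℓ ψ) (j : Fin 3) : C(E3, ℝ) :=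
  ⟨fun x => fderiv ℝ ψ x (basisVec j), h.continuous_fderiv _⟩

lemma isWeakDeriv_iff {ℓ : ℝ} {j : Fin 3} {f g : L2 ℓ} :
    IsWeakDeriv ℓ j f g ↔ ∀ (ψ : E3 → ℝ) (h : IsPeriodicTest ℓ ψ),
      (tens ℓ (h.derivC j)).adjoint f + (tens ℓ ⟨ψ, h.1.continuous⟩).adjoint g = 0 := by
  refine forall₂_congr fun ψ h => ?_
  rw [adjoint_tens_apply, adjoint_tens_apply, add_eq_zero_iff_eq_neg]
  rfl

lemma isWeakDeriv_of_tendsto {ι : Type*} {F : Filter ι} [F.NeBot] {ℓ : ℝ} {j : Fin 3}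
    {f g : ι → L2 ℓ} {f₀ g₀ : L2 ℓ} (hf : Tendsto f F (𝓝 f₀)) (hg : Tendsto g F (𝓝 g₀))
    (h : ∀ n, IsWeakDeriv ℓ j (f n) (g n)) : IsWeakDeriv ℓ j f₀ g₀ := by
  rw [isWeakDeriv_iff]
  intro ψ hψ
  have h1 := (((tens ℓ (hψ.derivC j)).adjoint.continuous.tendsto f₀).comp hf).add
    (((tens ℓ ⟨ψ, hψ.1.continuous⟩).adjoint.continuous.tendsto g₀).comp hg)
  refine tendsto_nhds_unique h1 ?_
  refine tendsto_const_nhds.congr fun n => ?_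
  exact (isWeakDeriv_iff.1 (h n) ψ hψ).symm

lemma IsWeakDeriv.sum {ι : Type*} {ℓ : ℝ} {j : Fin 3} (s : Finset ι) {f g : ι → L2 ℓ}
    (h : ∀ i ∈ s, IsWeakDeriv ℓ j (f i) (g i)) :
    IsWeakDeriv ℓ j (∑ i ∈ s, f i) (∑ i ∈ s, g i) := by
  classical
  induction s using Finset.induction_on with
  | empty => simpa using isWeakDeriv_zero ℓ j
  | insert a s ha ih =>
    rw [Finset.sum_insert ha, Finset.sum_insert ha]
    exact (h a (Finset.mem_insert_self _ _)).add
      (ih fun i hi => h i (Finset.mem_insert_of_mem hi))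

lemma isWeakDeriv_of_hasSum {ι : Type*} {ℓ : ℝ} {j : Fin 3} {f g : ι → L2 ℓ} {f₀ g₀ : L2 ℓ}
    (hf : HasSum f f₀) (hg : HasSum g g₀) (h : ∀ n, IsWeakDeriv ℓ j (f n) (g n)) :
    IsWeakDeriv ℓ j f₀ g₀ :=
  isWeakDeriv_of_tendsto hf hg fun s => IsWeakDeriv.sum s fun i _ => h i

lemma IsWeakDeriv.coef_eq {ℓ : ℝ} (hℓ : 0 < ℓ) {j : Fin 3} {f g : L2 ℓ}
    (h : IsWeakDeriv ℓ j f g) (i : Idx) : coef ℓ i g = -freq ℓ j i • coef ℓ i.flip f := by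
  have h1 := h (trig ℓ i) (isPeriodicTest_trig hℓ i)
  rw [← coef_apply] at h1
  simp_rw [fderiv_trig, mul_smul] at h1
  rw [integral_smul, ← coef_apply] at h1
  rw [neg_smul, h1, neg_neg]

lemma isWeakDeriv_mode {ℓ : ℝ} (hℓ : 0 < ℓ) (j : Fin 3) (i : Idx) (v : E3) :
    IsWeakDeriv ℓ j (mode ℓ i v) (freq ℓ j i • mode ℓ i.flip v) := by
  intro ψ hψ
  have e1 : ∫ x, fderiv ℝ ψ x (basisVec j) • mode ℓ i v x ∂boxMeasure ℓ =
      (∫ x, fderiv ℝ ψ x (basisVec j) * trig ℓ i x ∂boxMeasure ℓ) • v := by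
    rw [← integral_smul_const]
    refine integral_congr_ae ?_
    filter_upwards [coeFn_mode ℓ i v] with x hx
    rw [hx, smul_smul]
  have e2 : ∫ x, ψ x • (freq ℓ j i • mode ℓ i.flip v) x ∂boxMeasure ℓ =
      (∫ x, ψ x * fderiv ℝ (trig ℓ i) x (basisVec j) ∂boxMeasure ℓ) • v := by
    rw [← integral_smul_const]
    refine integral_congr_ae ?_
    filter_upwards [coeFn_mode ℓ i.flip v, Lp.coeFn_smul (freq ℓ j i) (mode ℓ i.flip v)]
      with x hx hx'
    rw [hx', Pi.smul_apply, hx, fderiv_trig, smul_smul, smul_smul, mul_assoc]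
  have ht := isPeriodicTest_trig hℓ i
  rw [e1, e2, integral_mul_fderiv_eq hℓ (hψ.1.of_le (by simp)) (contDiff_trig ℓ i) hψ.2 ht.2,
    neg_smul]

lemma IsWeakDeriv.unique {ℓ : ℝ} (hℓ : 0 < ℓ) {j : Fin 3} {f g g' : L2 ℓ}
    (h : IsWeakDeriv ℓ j f g) (h' : IsWeakDeriv ℓ j f g') : g = g' :=
  eq_of_coef_eq hℓ fun i => by rw [h.coef_eq hℓ, h'.coef_eq hℓ]

/-- The Fourier series differentiated term by term converges in `𝕃²` by the summability hypothesis,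
and the weak derivative relation is closed under limits of both sides. -/
lemma exists_isWeakDeriv {ℓ : ℝ} (hℓ : 0 < ℓ) {j : Fin 3} {f : L2 ℓ}
    (h : Summable fun i => (freq ℓ j i) ^ 2 * ‖coef ℓ i f‖ ^ 2) :
    ∃ g, IsWeakDeriv ℓ j f g := by
  set m : Idx → E3 := fun i => (ℓ ^ 3)⁻¹ • -freq ℓ j i • coef ℓ i.flip f with hm
  have hs : Summable fun i => ‖m i‖ ^ 2 := by
    have h1 := (h.comp_injective flipEquiv.injective).mul_left ((ℓ ^ 3)⁻¹ ^ 2)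
    convert! h1 using 2 with i
    simp only [hm, norm_smul, mul_pow, Real.norm_eq_abs, sq_abs, Function.comp_apply, flipEquiv,
      Equiv.coe_fn_mk, freq_flip]
  obtain ⟨g, hg, -⟩ := exists_hasSum_mode hℓ hs
  refine ⟨g, ?_⟩
  rw [← flipEquiv.hasSum_iff] at hg
  refine isWeakDeriv_of_hasSum (hasSum_mode_coef hℓ f) hg fun i => ?_
  have h2 := (isWeakDeriv_mode hℓ j i (coef ℓ i f)).smul (ℓ ^ 3)⁻¹
  convert! h2 using 1
  simp only [hm, Function.comp_apply, flipEquiv, Equiv.coe_fn_mk, freq_flip, Idx.flip_flip,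
    neg_neg, map_smul]

lemma inner_gradient (ψ : E3 → ℝ) (x v : E3) :
    ⟪gradient ψ x, v⟫_ℝ = ∑ j, v j * fderiv ℝ ψ x (basisVec j) := by
  rw [gradient, InnerProductSpace.toDual_symm_apply]
  have : v = ∑ j, v j • basisVec j := by
    ext m
    rw [WithLp.ofLp_sum, Finset.sum_apply, Finset.sum_eq_single m]
    · simp [basisVec]
    · intro j _ hj
      simp [basisVec, hj.symm]
    · simp
  conv_lhs => rw [this]
  simp

/-- The number `∑ⱼ freq j i * vⱼ`, proportional to the divergence of `mode i v`. -/
def divSymbol (ℓ : ℝ) (i : Idx) (v : E3) : ℝ := ∑ j, freq ℓ j i * v j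

lemma divSymbol_coef_eq_zero {ℓ : ℝ} (hℓ : 0 < ℓ) {u : L2 ℓ} (hu : u ∈ H ℓ) (i : Idx) :
    divSymbol ℓ i (coef ℓ i u) = 0 := by
  have h := hu (trig ℓ i.flip) (isPeriodicTest_trig hℓ i.flip)
  simp_rw [inner_gradient, fderiv_trig, Idx.flip_flip, freq_flip] at h
  rw [integral_finsetSum] at h
  · rw [← neg_eq_zero, ← h, divSymbol, ← Finset.sum_neg_distrib]
    refine Finset.sum_congr rfl fun j _ => ?_
    rw [coef_coord, ← neg_mul, ← integral_const_mul]
    refine integral_congr_ae (Eventually.of_forall fun x => ?_)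
    simp only; ring
  · intro j _
    have := ((memLp_of_continuous ℓ 2 (trigC ℓ i).continuous).integrable_mul
      (memLp_coord u j)).const_mul (-freq ℓ j i)
    refine this.congr (Eventually.of_forall fun x => ?_)
    simp [trigC]; ring

lemma mode_mem_H {ℓ : ℝ} (hℓ : 0 < ℓ) {i : Idx} {v : E3} (h : divSymbol ℓ i v = 0) :
    mode ℓ i v ∈ H ℓ := by
  intro ψ hψ
  have e : ∫ x, ⟪gradient ψ x, mode ℓ i v x⟫_ℝ ∂boxMeasure ℓ =
      ∫ x, ∑ j, v j * (fderiv ℝ ψ x (basisVec j) * trig ℓ i x) ∂boxMeasure ℓ := by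
    refine integral_congr_ae ?_
    filter_upwards [coeFn_mode ℓ i v] with x hx
    rw [hx, inner_gradient]
    refine Finset.sum_congr rfl fun j _ => ?_
    simp only [PiLp.smul_apply, smul_eq_mul]; ring
  have hi : ∀ {c : E3 → ℝ}, Continuous c → Integrable c (boxMeasure ℓ) := fun hc =>
    memLp_one_iff_integrable.1 (memLp_of_continuous ℓ 1 hc)
  have ht := isPeriodicTest_trig hℓ i
  have hi' : ∀ j, Integrable (fun x => v j * (fderiv ℝ ψ x (basisVec j) * trig ℓ i x))
      (boxMeasure ℓ) := fun j =>
    (hi ((hψ.continuous_fderiv (basisVec j)).mul (trigC ℓ i).continuous)).const_mul (v j)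
  rw [e, integral_finsetSum _ fun j _ => hi' j]
  have : ∀ j, ∫ x, v j * (fderiv ℝ ψ x (basisVec j) * trig ℓ i x) ∂boxMeasure ℓ =
      freq ℓ j i * v j * -∫ x, ψ x * trig ℓ i.flip x ∂boxMeasure ℓ := by
    intro j
    rw [integral_const_mul, integral_mul_fderiv_eq hℓ (hψ.1.of_le (by simp)) (contDiff_trig ℓ i)
      hψ.2 ht.2]
    simp_rw [fderiv_trig]
    have : ∀ x, ψ x * (freq ℓ j i * trig ℓ i.flip x) = freq ℓ j i * (ψ x * trig ℓ i.flip x) :=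
      fun x => by ring
    simp_rw [this]
    rw [integral_const_mul]
    ring
  simp_rw [this]
  rw [← Finset.sum_mul]
  change divSymbol ℓ i v * _ = 0
  rw [h, zero_mul]

lemma isClosed_H (ℓ : ℝ) : IsClosed (H ℓ : Set (L2 ℓ)) :=
  (completeSpace_coe_iff_isComplete.1 (inferInstance : CompleteSpace (H ℓ))).isClosed

/-- The converse holds because each term of the Fourier series is then divergence-free and `H` is
closed. -/
lemma mem_H_iff {ℓ : ℝ} (hℓ : 0 < ℓ) {u : L2 ℓ} :
    u ∈ H ℓ ↔ ∀ i, divSymbol ℓ i (coef ℓ i u) = 0 := by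
  refine ⟨fun hu i => divSymbol_coef_eq_zero hℓ hu i, fun h => ?_⟩
  refine (isClosed_H ℓ).mem_of_tendsto (hasSum_mode_coef hℓ u) (Eventually.of_forall fun s => ?_)
  exact (H ℓ).sum_mem fun i _ => (H ℓ).smul_mem _ (mode_mem_H hℓ (h i))

end BFEuler

end

noncomputable section

namespace BFEuler

open Set Filter Topology

/-! ### The space `V` -/

/-- `vel` as a continuous linear map. -/
def velL (ℓ : ℝ) : V ℓ →L[ℝ] L2 ℓ :=
  (WithLp.fstL 2 ℝ (L2 ℓ) (PiLp 2 fun _ : Fin 3 => L2 ℓ)).comp (V ℓ).subtypeL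

/-- `pd · j` as a continuous linear map. -/
def pdL (ℓ : ℝ) (j : Fin 3) : V ℓ →L[ℝ] L2 ℓ :=
  (PiLp.proj 2 (𝕜 := ℝ) (fun _ : Fin 3 => L2 ℓ) j).comp
    ((WithLp.sndL 2 ℝ (L2 ℓ) (PiLp 2 fun _ : Fin 3 => L2 ℓ)).comp (V ℓ).subtypeL)

@[simp] lemma velL_apply {ℓ : ℝ} (u : V ℓ) : velL ℓ u = vel u := rfl
@[simp] lemma pdL_apply {ℓ : ℝ} (u : V ℓ) (j : Fin 3) : pdL ℓ j u = pd u j := rfl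
@[simp] lemma coe_toH {ℓ : ℝ} (u : V ℓ) : (toH ℓ u : L2 ℓ) = vel u := rfl

lemma vel_mem_H {ℓ : ℝ} (u : V ℓ) : vel u ∈ H ℓ := u.2.1
lemma isWeakDeriv_pd {ℓ : ℝ} (u : V ℓ) (j : Fin 3) : IsWeakDeriv ℓ j (vel u) (pd u j) := u.2.2 j

lemma inner_V {ℓ : ℝ} (u v : V ℓ) :
    ⟪u, v⟫_ℝ = ⟪vel u, vel v⟫_ℝ + ∑ j, ⟪pd u j, pd v j⟫_ℝ := by
  rw [Submodule.coe_inner, WithLp.prod_inner_apply]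
  congr 1

lemma norm_sq_V {ℓ : ℝ} (u : V ℓ) : ‖u‖ ^ 2 = ‖vel u‖ ^ 2 + ∑ j, ‖pd u j‖ ^ 2 := by
  simp_rw [← real_inner_self_eq_norm_sq, inner_V]

lemma inner_toH {ℓ : ℝ} (u v : V ℓ) : ⟪toH ℓ u, toH ℓ v⟫_ℝ = ⟪vel u, vel v⟫_ℝ := rfl

lemma norm_vel_le {ℓ : ℝ} (u : V ℓ) : ‖vel u‖ ≤ ‖u‖ := by
  refine abs_le_of_sq_le_sq' ?_ (norm_nonneg _) |>.2
  rw [norm_sq_V]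
  exact le_add_of_nonneg_right (Finset.sum_nonneg fun _ _ => sq_nonneg _)

lemma tendsto_V {ι : Type*} {F : Filter ι} {ℓ : ℝ} {u : ι → V ℓ} {u₀ : V ℓ}
    (h : Tendsto (fun n => vel (u n)) F (𝓝 (vel u₀)))
    (h' : ∀ j, Tendsto (fun n => pd (u n) j) F (𝓝 (pd u₀ j))) : Tendsto u F (𝓝 u₀) := by
  rw [tendsto_iff_norm_sub_tendsto_zero] at h ⊢
  have h2 : ∀ j, Tendsto (fun n => ‖pd (u n) j - pd u₀ j‖) F (𝓝 0) := fun j =>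
    tendsto_iff_norm_sub_tendsto_zero.1 (h' j)
  have h3 : Tendsto (fun n => ‖u n - u₀‖ ^ 2) F (𝓝 0) := by
    have h4 := (h.pow 2).add (tendsto_finsetSum Finset.univ fun j _ => (h2 j).pow 2)
    simp only [ne_eq, OfNat.ofNat_ne_zero, not_false_eq_true, zero_pow, Finset.sum_const_zero,
      add_zero] at h4
    refine h4.congr fun n => ?_
    rw [norm_sq_V]
    rfl
  have h5 := h3.sqrt
  simpa [Real.sqrt_sq (norm_nonneg _)] using h5

lemma ext_vel {ℓ : ℝ} (hℓ : 0 < ℓ) {u v : V ℓ} (h : vel u = vel v) : u = v := by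
  have hp : ∀ j, pd u j = pd v j := fun j =>
    (isWeakDeriv_pd u j).unique hℓ (h ▸ isWeakDeriv_pd v j)
  rw [← sub_eq_zero, ← norm_eq_zero, ← sq_eq_zero_iff, norm_sq_V]
  have e1 : vel (u - v) = 0 := by
    change velL ℓ (u - v) = 0
    rw [map_sub, velL_apply, velL_apply, h, sub_self]
  have e2 : ∀ j, pd (u - v) j = 0 := by
    intro j
    change pdL ℓ j (u - v) = 0
    rw [map_sub, pdL_apply, pdL_apply, hp, sub_self]
  simp [e1, e2]

/-- The element of `V` with given velocity and weak derivatives. -/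
def mkV {ℓ : ℝ} (f : L2 ℓ) (g : Fin 3 → L2 ℓ) (hf : f ∈ H ℓ) (hg : ∀ j, IsWeakDeriv ℓ j f (g j)) :
    V ℓ := ⟨WithLp.toLp 2 (f, WithLp.toLp 2 g), hf, hg⟩

/-- The pair (velocity, weak gradient) of the `i`-th term of the Fourier series. -/
def partPair (ℓ : ℝ) (i : Idx) : L2 ℓ →L[ℝ] WithLp 2 (L2 ℓ × PiLp 2 fun _ : Fin 3 => L2 ℓ) :=
  ((WithLp.prodContinuousLinearEquiv 2 ℝ (L2 ℓ) (PiLp 2 fun _ : Fin 3 => L2 ℓ)).symm :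
    (L2 ℓ × PiLp 2 fun _ : Fin 3 => L2 ℓ) →L[ℝ] _).comp
  (((ℓ ^ 3)⁻¹ • (mode ℓ i).comp (coef ℓ i)).prod
    (((PiLp.continuousLinearEquiv 2 ℝ fun _ : Fin 3 => L2 ℓ).symm :
      (Fin 3 → L2 ℓ) →L[ℝ] PiLp 2 fun _ : Fin 3 => L2 ℓ).comp
      (ContinuousLinearMap.pi fun j =>
        (ℓ ^ 3)⁻¹ • (freq ℓ j i • (mode ℓ i.flip).comp (coef ℓ i)))))

/-- The `i`-th term of the Fourier series of a field in `H`, as an element of `V`. -/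
def part {ℓ : ℝ} (hℓ : 0 < ℓ) (i : Idx) : H ℓ →L[ℝ] V ℓ :=
  ((partPair ℓ i).comp (H ℓ).subtypeL).codRestrict (V ℓ) fun u =>
    ⟨(H ℓ).smul_mem _ (mode_mem_H hℓ (divSymbol_coef_eq_zero hℓ u.2 i)), fun j =>
      (isWeakDeriv_mode hℓ j i (coef ℓ i u)).smul _⟩

lemma hasSum_pd {ℓ : ℝ} (hℓ : 0 < ℓ) {j : Fin 3} {f g : L2 ℓ} (h : IsWeakDeriv ℓ j f g) :
    HasSum (fun i => (ℓ ^ 3)⁻¹ • freq ℓ j i • mode ℓ i.flip (coef ℓ i f)) g := by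
  have h1 := hasSum_mode_coef hℓ g
  rw [← flipEquiv.hasSum_iff] at h1
  convert! h1 using 2 with i
  simp only [Function.comp_apply, flipEquiv, Equiv.coe_fn_mk, h.coef_eq hℓ, freq_flip,
    Idx.flip_flip, neg_neg, map_smul]

/-- The Fourier series of `u ∈ V` converges to `u` in `V`. -/
lemma hasSum_part {ℓ : ℝ} (hℓ : 0 < ℓ) (u : V ℓ) :
    HasSum (fun i => part hℓ i (toH ℓ u)) u := by
  refine tendsto_V ?_ fun j => ?_
  · have := hasSum_mode_coef hℓ (vel u)
    refine Tendsto.congr (fun s => ?_) this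
    exact (map_sum (velL ℓ) (fun i => part hℓ i (toH ℓ u)) s).symm
  · have := hasSum_pd hℓ (isWeakDeriv_pd u j)
    refine Tendsto.congr (fun s => ?_) this
    exact (map_sum (pdL ℓ j) (fun i => part hℓ i (toH ℓ u)) s).symm

/-- Partial sums of Fourier series, as operators from `H` to `V`. -/
def trunc {ℓ : ℝ} (hℓ : 0 < ℓ) (s : Finset Idx) : H ℓ →L[ℝ] V ℓ := ∑ i ∈ s, part hℓ i

lemma trunc_apply {ℓ : ℝ} (hℓ : 0 < ℓ) (s : Finset Idx) (f : H ℓ) :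
    trunc hℓ s f = ∑ i ∈ s, part hℓ i f := by
  simp [trunc]

lemma tendsto_trunc {ℓ : ℝ} (hℓ : 0 < ℓ) (u : V ℓ) :
    Tendsto (fun s => trunc hℓ s (toH ℓ u)) atTop (𝓝 u) := by
  simp_rw [trunc_apply]
  exact hasSum_part hℓ u

lemma vel_trunc {ℓ : ℝ} (hℓ : 0 < ℓ) (s : Finset Idx) (f : H ℓ) :
    vel (trunc hℓ s f) = ∑ i ∈ s, (ℓ ^ 3)⁻¹ • mode ℓ i (coef ℓ i f) := by
  rw [trunc_apply, ← velL_apply, map_sum]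
  rfl

lemma pd_trunc {ℓ : ℝ} (hℓ : 0 < ℓ) (s : Finset Idx) (f : H ℓ) (j : Fin 3) :
    pd (trunc hℓ s f) j =
      ∑ i ∈ s, (ℓ ^ 3)⁻¹ • freq ℓ j i • mode ℓ i.flip (coef ℓ i f) := by
  rw [trunc_apply, ← pdL_apply, map_sum]
  rfl

lemma tendsto_vel_trunc {ℓ : ℝ} (hℓ : 0 < ℓ) (f : H ℓ) :
    Tendsto (fun s => vel (trunc hℓ s f)) atTop (𝓝 (f : L2 ℓ)) := by
  simp_rw [vel_trunc]
  exact hasSum_mode_coef hℓ (f : L2 ℓ)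

/-! ### The Laplacian -/

/-- The symbol of `-Δ`. -/
def lapSymbol (ℓ : ℝ) (i : Idx) : ℝ := ∑ j, freq ℓ j i ^ 2

lemma lapSymbol_nonneg (ℓ : ℝ) (i : Idx) : 0 ≤ lapSymbol ℓ i :=
  Finset.sum_nonneg fun _ _ => sq_nonneg _

@[simp] lemma lapSymbol_flip (ℓ : ℝ) (i : Idx) : lapSymbol ℓ i.flip = lapSymbol ℓ i := by
  simp [lapSymbol]

/-- `w = -Δ f`, in terms of Fourier coefficients. -/
def HasLap {ℓ : ℝ} (f w : L2 ℓ) : Prop := ∀ i, coef ℓ i w = lapSymbol ℓ i • coef ℓ i f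

lemma hasLap_of_isWeakDeriv {ℓ : ℝ} (hℓ : 0 < ℓ) {f : L2 ℓ} {g g' : Fin 3 → L2 ℓ}
    (hg : ∀ j, IsWeakDeriv ℓ j f (g j)) (hg' : ∀ j, IsWeakDeriv ℓ j (g j) (g' j)) :
    HasLap f (-∑ j, g' j) := by
  intro i
  rw [map_neg, map_sum, lapSymbol, Finset.sum_smul, ← Finset.sum_neg_distrib]
  refine Finset.sum_congr rfl fun j _ => ?_
  rw [(hg' j).coef_eq hℓ, (hg j).coef_eq hℓ, freq_flip, Idx.flip_flip, smul_smul, ← neg_smul]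
  congr 1; ring

lemma weakDeriv_eq {ℓ : ℝ} (hℓ : 0 < ℓ) {j : Fin 3} {f g : L2 ℓ} (h : IsWeakDeriv ℓ j f g) :
    weakDeriv ℓ j f = g := by
  have h' : ∃ g, IsWeakDeriv ℓ j f g := ⟨g, h⟩
  rw [weakDeriv, dif_pos h']
  exact h'.choose_spec.unique hℓ h

lemma HasLap.mem_H {ℓ : ℝ} (hℓ : 0 < ℓ) {f w : L2 ℓ} (h : HasLap f w) (hf : f ∈ H ℓ) :
    w ∈ H ℓ := by
  rw [mem_H_iff hℓ] at hf ⊢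
  intro i
  have := hf i
  rw [h i, divSymbol]
  simp only [divSymbol, PiLp.smul_apply, smul_eq_mul] at this ⊢
  calc ∑ j, freq ℓ j i * (lapSymbol ℓ i * coef ℓ i f j)
      = lapSymbol ℓ i * ∑ j, freq ℓ j i * coef ℓ i f j := by
        rw [Finset.mul_sum]
        exact Finset.sum_congr rfl fun j _ => by ring
    _ = 0 := by rw [this, mul_zero]

/-- With periodic boundary conditions the Laplacian of a divergence-free field is divergence-free,
so the Leray projection acts as the identity and `Au = -Δu`. -/
lemma hasLap_stokes {ℓ : ℝ} (hℓ : 0 < ℓ) {u : V ℓ} (hu : InDomA u) :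
    HasLap (vel u) (stokes u : L2 ℓ) := by
  choose g hg using fun j => hu j j
  have hL := hasLap_of_isWeakDeriv hℓ (isWeakDeriv_pd u) hg
  have hw : stokes u = ⟨-∑ j, g j, hL.mem_H hℓ (vel_mem_H u)⟩ := by
    rw [stokes]
    simp_rw [fun j => weakDeriv_eq hℓ (hg j)]
    rw [← map_neg, leray]
    exact Submodule.orthogonalProjectionOnto_mem_subspace_eq_self
      (⟨-∑ j, g j, hL.mem_H hℓ (vel_mem_H u)⟩ : H ℓ)
  rw [hw]
  exact hL

/-- The symbol of `∂ₘ∂ⱼ` is bounded by that of `Δ`, so control of the Laplacian gives all second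
derivatives. The reindexing by `flip` reflects that one derivative exchanges sines and cosines. -/
lemma inDomA_of_summable {ℓ : ℝ} (hℓ : 0 < ℓ) {u : V ℓ}
    (h : Summable fun i => lapSymbol ℓ i ^ 2 * ‖coef ℓ i (vel u)‖ ^ 2) : InDomA u := by
  intro m j
  refine exists_isWeakDeriv hℓ ?_
  refine Summable.of_nonneg_of_le (fun i => by positivity) (fun i => ?_)
    (h.comp_injective flipEquiv.injective)
  have hle : ∀ j, freq ℓ j i ^ 2 ≤ lapSymbol ℓ i := fun j =>
    Finset.single_le_sum (f := fun j => freq ℓ j i ^ 2) (fun _ _ => sq_nonneg _)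
      (Finset.mem_univ j)
  simp only [Function.comp_apply, flipEquiv, Equiv.coe_fn_mk, norm_smul, mul_pow,
    (isWeakDeriv_pd u j).coef_eq hℓ, lapSymbol_flip, Real.norm_eq_abs, sq_abs, neg_sq]
  rw [← mul_assoc]
  gcongr
  rw [sq (lapSymbol ℓ i)]
  exact mul_le_mul (hle m) (hle j) (sq_nonneg _) (lapSymbol_nonneg _ _)

lemma HasLap.inner_eq {ℓ : ℝ} (hℓ : 0 < ℓ) {u φ : V ℓ} {w : L2 ℓ} (h : HasLap (vel u) w) :
    ⟪vel φ, w⟫_ℝ = ∑ j, ⟪pd φ j, pd u j⟫_ℝ := by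
  have h1 := hasSum_inner_coef hℓ (vel φ) w
  have h2 := hasSum_sum (s := Finset.univ) fun j _ => hasSum_inner_coef hℓ (pd φ j) (pd u j)
  rw [← flipEquiv.hasSum_iff] at h1
  have h3 : (fun i => ∑ j, ⟪coef ℓ i (pd φ j), coef ℓ i (pd u j)⟫_ℝ) =
      (fun i => ⟪coef ℓ i (vel φ), coef ℓ i w⟫_ℝ) ∘ flipEquiv := by
    funext i
    simp only [Function.comp_apply, flipEquiv, Equiv.coe_fn_mk, h i.flip, lapSymbol_flip,
      fun j => (isWeakDeriv_pd u j).coef_eq hℓ, fun j => (isWeakDeriv_pd φ j).coef_eq hℓ,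
      real_inner_smul_left, real_inner_smul_right]
    rw [lapSymbol, Finset.sum_mul]
    exact Finset.sum_congr rfl fun j _ => by ring
  rw [h3] at h2
  have h4 := h1.unique h2
  rw [← Finset.mul_sum] at h4
  exact mul_left_cancel₀ (by positivity) h4

/-! ### Uniform bounds -/

/-- `‖f x‖ ≤ M` for almost every `x`. -/
def EssBdd {ℓ : ℝ} (f : L2 ℓ) (M : ℝ) : Prop := ∀ᵐ x ∂boxMeasure ℓ, ‖f x‖ ≤ M

lemma isClosed_essBdd (ℓ M : ℝ) : IsClosed {f : L2 ℓ | EssBdd f M} := by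
  refine IsSeqClosed.isClosed fun f g hf hfg => ?_
  obtain ⟨ns, -, hns⟩ := (tendstoInMeasure_of_tendsto_Lp hfg).exists_seq_tendsto_ae
  have hall : ∀ᵐ x ∂boxMeasure ℓ, ∀ n, ‖f n x‖ ≤ M := ae_all_iff.2 hf
  change ∀ᵐ x ∂boxMeasure ℓ, ‖g x‖ ≤ M
  filter_upwards [hns, hall] with x hx hx'
  exact le_of_tendsto hx.norm (Eventually.of_forall fun n => hx' _)

lemma coeFn_finsetSum {ℓ : ℝ} {ι : Type*} (s : Finset ι) (f : ι → L2 ℓ) :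
    (∑ i ∈ s, f i : L2 ℓ) =ᵐ[boxMeasure ℓ] fun x => ∑ i ∈ s, f i x := by
  classical
  induction s using Finset.induction_on with
  | empty =>
    simp only [Finset.sum_empty]
    exact Lp.coeFn_zero E3 2 (boxMeasure ℓ)
  | insert a s ha ih =>
    rw [Finset.sum_insert ha]
    filter_upwards [Lp.coeFn_add (f a) (∑ i ∈ s, f i), ih] with x hx hx'
    rw [hx, Pi.add_apply, hx', Finset.sum_insert ha]

lemma coeFn_sum_mode (ℓ : ℝ) (s : Finset Idx) (r : Idx → ℝ) (v : Idx → E3) :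
    (∑ i ∈ s, r i • mode ℓ i (v i) : L2 ℓ) =ᵐ[boxMeasure ℓ]
      fun x => ∑ i ∈ s, trig ℓ i x • r i • v i := by
  have h : ∀ᵐ x ∂boxMeasure ℓ, ∀ i : Idx, (r i • mode ℓ i (v i)) x = trig ℓ i x • r i • v i := by
    refine ae_all_iff.2 fun i => ?_
    filter_upwards [coeFn_mode ℓ i (v i), Lp.coeFn_smul (r i) (mode ℓ i (v i))] with x hx hx'
    rw [hx', Pi.smul_apply, hx, smul_comm]
  filter_upwards [coeFn_finsetSum s fun i => r i • mode ℓ i (v i), h] with x hx hx'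
  rw [hx]
  exact Finset.sum_congr rfl fun i _ => hx' i

lemma essBdd_sum_mode (ℓ : ℝ) (s : Finset Idx) (r : Idx → ℝ) (v : Idx → E3) {M : ℝ}
    (h : ∑ i ∈ s, ‖r i • v i‖ ≤ M) : EssBdd (∑ i ∈ s, r i • mode ℓ i (v i) : L2 ℓ) M := by
  filter_upwards [coeFn_sum_mode ℓ s r v] with x hx
  rw [hx]
  refine (norm_sum_le _ _).trans (le_trans (Finset.sum_le_sum fun i _ => ?_) h)
  rw [norm_smul]
  exact mul_le_of_le_one_left (norm_nonneg _) (abs_trig_le ℓ i x)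

/-- The exponent `4` exceeds the rank `3` of the lattice; this is the dimensional fact behind the
embedding of `ℍ²` into bounded fields. -/
lemma summable_norm_inv_pow_four :
    Summable fun k : Fin 3 → ℤ => ‖(WithLp.toLp 2 fun j => (k j : ℝ) : E3)‖⁻¹ ^ 4 := by
  obtain ⟨b, hb⟩ : ∃ b : Module.Basis (Fin 3) ℝ E3, ∀ j, b j = EuclideanSpace.single j 1 :=
    ⟨(EuclideanSpace.basisFun (Fin 3) ℝ).toBasis, fun j => by simp⟩
  have hrank : Module.finrank ℤ (Submodule.span ℤ (Set.range b)) < 4 := by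
    rw [ZLattice.rank ℝ, finrank_euclideanSpace_fin]
    norm_num
  have hmem : ∀ k : Fin 3 → ℤ, (WithLp.toLp 2 fun j => (k j : ℝ) : E3) ∈
      Submodule.span ℤ (Set.range b) := by
    intro k
    have : (WithLp.toLp 2 fun j => (k j : ℝ) : E3) = ∑ j, k j • b j := by
      ext m
      rw [WithLp.ofLp_sum, Finset.sum_apply, Finset.sum_eq_single m]
      · simp [hb]
      · intro j _ hj
        simp [hb, hj.symm]
      · simp
    rw [this]
    exact Submodule.sum_mem _ fun j _ => Submodule.smul_mem _ _
      (Submodule.subset_span (Set.mem_range_self j))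
  have hd : DiscreteTopology (Submodule.span ℤ (Set.range b)) := inferInstance
  generalize Submodule.span ℤ (Set.range b) = L at hrank hmem hd
  have h := ZLattice.summable_norm_pow_inv L 4 hrank
  let φ : (Fin 3 → ℤ) → L := fun k => ⟨_, hmem k⟩
  have hinj : Function.Injective φ := by
    intro k k' hk
    have h1 : (WithLp.toLp 2 fun j => (k j : ℝ) : E3) = WithLp.toLp 2 fun j => (k' j : ℝ) :=
      congrArg Subtype.val hk
    funext j
    have h2 := congrFun ((WithLp.toLp_injective 2) h1) j
    exact_mod_cast h2
  exact (h.comp_injective hinj).congr fun k => rfl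

lemma lapSymbol_eq (ℓ : ℝ) (i : Idx) : lapSymbol ℓ i =
    (2 * Real.pi / ℓ) ^ 2 * ‖(WithLp.toLp 2 fun j => (i.1 j : ℝ) : E3)‖ ^ 2 := by
  rw [EuclideanSpace.norm_sq_eq, Finset.mul_sum, lapSymbol]
  refine Finset.sum_congr rfl fun j _ => ?_
  simp only [freq, Real.norm_eq_abs, sq_abs]
  split_ifs <;> ring

/-- The zero frequency contributes `0` through the convention `0⁻¹ = 0`; uses of this sum treat that
frequency separately. -/
lemma summable_inv_lapSymbol_sq (ℓ : ℝ) : Summable fun i : Idx => (lapSymbol ℓ i)⁻¹ ^ 2 := by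
  have h1 : ∀ i : Idx, (lapSymbol ℓ i)⁻¹ ^ 2 =
      ((2 * Real.pi / ℓ)⁻¹ ^ 4) * ‖(WithLp.toLp 2 fun j => (i.1 j : ℝ) : E3)‖⁻¹ ^ 4 := by
    intro i
    rw [lapSymbol_eq, mul_inv, mul_pow]
    congr 1 <;> simp only [inv_pow] <;> ring
  simp_rw [h1]
  refine Summable.mul_left _ ?_
  refine (summable_prod_of_nonneg fun i => by positivity).2 ⟨fun k => ?_, ?_⟩
  · exact (hasSum_fintype _).summable
  · simp only [tsum_fintype, Fintype.sum_bool]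
    exact summable_norm_inv_pow_four.add summable_norm_inv_pow_four

lemma eq_zero_of_lapSymbol {ℓ : ℝ} (hℓ : 0 < ℓ) {i : Idx} (h : lapSymbol ℓ i = 0) : i.1 = 0 := by
  rw [lapSymbol_eq, mul_eq_zero] at h
  rcases h with h | h
  · have : 0 < (2 * Real.pi / ℓ) ^ 2 := by positivity
    exact absurd h this.ne'
  · have h1 := norm_eq_zero.1 (pow_eq_zero_iff (two_ne_zero) |>.1 h)
    funext j
    have h2 := congrArg (fun z : E3 => z j) h1
    simpa using h2

/-- The sum of the Fourier coefficients of `f` is controlled by `Δf`, with an arbitrarily small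
constant, and `f`. -/
lemma exists_sum_coef_le {ℓ : ℝ} (hℓ : 0 < ℓ) {δ : ℝ} (hδ : 0 < δ) : ∃ C : ℝ, 0 ≤ C ∧
    ∀ f w : L2 ℓ, HasLap f w → ∀ s : Finset Idx,
      ∑ i ∈ s, ‖(ℓ ^ 3)⁻¹ • coef ℓ i f‖ ≤ δ * ‖w‖ + C * ‖f‖ := by
  classical
  -- Beyond `F` the tail of `∑ |symbol|⁻²` is below `δ²ℓ³`, which is what Cauchy–Schwarz needs to
  -- produce the factor `δ` in front of `‖w‖`.
  obtain ⟨F, hF⟩ := summable_iff_vanishing_norm.1 (summable_inv_lapSymbol_sq ℓ)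
    (δ ^ 2 * ℓ ^ 3) (by positivity)
  -- The zero frequency joins the low modes: its coefficient is invisible to `Δf` and is controlled
  -- by `‖f‖` alone.
  set F' : Finset Idx := F ∪ {(0, false), (0, true)} with hF'
  refine ⟨(ℓ ^ 3)⁻¹ * (F'.card * √(ℓ ^ 3)), by positivity, fun f w hL s => ?_⟩
  have hsplit : ∑ i ∈ s, ‖coef ℓ i f‖ =
      ∑ i ∈ s \ F', ‖coef ℓ i f‖ + ∑ i ∈ s ∩ F', ‖coef ℓ i f‖ :=
    by rw [add_comm, Finset.sum_inter_add_sum_sdiff]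
  have h1 : ∑ i ∈ s ∩ F', ‖coef ℓ i f‖ ≤ F'.card * √(ℓ ^ 3) * ‖f‖ := by
    calc ∑ i ∈ s ∩ F', ‖coef ℓ i f‖ ≤ ∑ i ∈ F', ‖coef ℓ i f‖ :=
          Finset.sum_le_sum_of_subset_of_nonneg Finset.inter_subset_right
            fun _ _ _ => norm_nonneg _
      _ ≤ ∑ i ∈ F', √(ℓ ^ 3) * ‖f‖ := Finset.sum_le_sum fun i _ => norm_coef_le hℓ i f
      _ = _ := by rw [Finset.sum_const, nsmul_eq_mul, mul_assoc]
  have h2 : ∑ i ∈ s \ F', ‖coef ℓ i f‖ ≤ δ * ℓ ^ 3 * ‖w‖ := by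
    have e : ∀ i ∈ s \ F', ‖coef ℓ i f‖ = (lapSymbol ℓ i)⁻¹ * ‖coef ℓ i w‖ := by
      intro i hi
      have hne : lapSymbol ℓ i ≠ 0 := by
        intro h0
        have h3 := eq_zero_of_lapSymbol hℓ h0
        rw [Finset.mem_sdiff] at hi
        apply hi.2
        rcases i with ⟨k, b⟩
        simp only at h3
        subst h3
        cases b <;> simp [hF']
      rw [hL i, norm_smul, Real.norm_of_nonneg (lapSymbol_nonneg _ _), ← mul_assoc,
        inv_mul_cancel₀ hne, one_mul]
    rw [Finset.sum_congr rfl e]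
    refine abs_le_of_sq_le_sq' ?_ (by positivity) |>.2
    refine (Finset.sum_mul_sq_le_sq_mul_sq _ _ _).trans ?_
    have h4 := hF (s \ F') (Finset.disjoint_left.2 fun i hi hi' =>
      (Finset.mem_sdiff.1 hi).2 (Finset.mem_union_left _ hi'))
    have h5 := sum_le_hasSum (s \ F') (fun _ _ => sq_nonneg _) (hasSum_norm_sq_coef hℓ w)
    rw [Real.norm_of_nonneg (Finset.sum_nonneg fun _ _ => sq_nonneg _)] at h4
    calc _ ≤ (δ ^ 2 * ℓ ^ 3) * (ℓ ^ 3 * ‖w‖ ^ 2) :=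
          mul_le_mul h4.le h5 (Finset.sum_nonneg fun _ _ => sq_nonneg _) (by positivity)
      _ = _ := by ring
  simp_rw [norm_smul]
  rw [← Finset.mul_sum, hsplit, Real.norm_of_nonneg (by positivity)]
  calc _ ≤ (ℓ ^ 3)⁻¹ * (δ * ℓ ^ 3 * ‖w‖ + F'.card * √(ℓ ^ 3) * ‖f‖) := by gcongr
    _ = _ := by field_simp

/-- The bound is uniform in `s` because the Fourier series converges absolutely in the sup norm;
sharp truncations of a merely bounded field would not allow this. -/
lemma HasLap.essBdd_trunc {ℓ : ℝ} (hℓ : 0 < ℓ) {δ C : ℝ}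
    (hC : ∀ f w : L2 ℓ, HasLap f w → ∀ s : Finset Idx,
      ∑ i ∈ s, ‖(ℓ ^ 3)⁻¹ • coef ℓ i f‖ ≤ δ * ‖w‖ + C * ‖f‖) {f : H ℓ} {w : L2 ℓ}
    (h : HasLap (f : L2 ℓ) w) (s : Finset Idx) :
    EssBdd (vel (trunc hℓ s f)) (δ * ‖w‖ + C * ‖(f : L2 ℓ)‖) := by
  rw [vel_trunc]
  exact essBdd_sum_mode ℓ s _ _ (hC f w h s)

lemma HasLap.essBdd {ℓ : ℝ} (hℓ : 0 < ℓ) {δ C : ℝ}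
    (hC : ∀ f w : L2 ℓ, HasLap f w → ∀ s : Finset Idx,
      ∑ i ∈ s, ‖(ℓ ^ 3)⁻¹ • coef ℓ i f‖ ≤ δ * ‖w‖ + C * ‖f‖) {f : H ℓ} {w : L2 ℓ}
    (h : HasLap (f : L2 ℓ) w) : EssBdd (f : L2 ℓ) (δ * ‖w‖ + C * ‖(f : L2 ℓ)‖) :=
  (isClosed_essBdd ℓ _).mem_of_tendsto (tendsto_vel_trunc hℓ f)
    (Eventually.of_forall fun s => h.essBdd_trunc hℓ hC s)

end BFEuler

end

noncomputable section

namespace BFEuler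

open Set Filter Topology

/-! ### Multiplication operators and the trilinear form -/

lemma memLp_fieldOp {ℓ M : ℝ} {B : E3 → E3 →L[ℝ] E3} (hB : AEStronglyMeasurable B (boxMeasure ℓ))
    (hM : ∀ᵐ x ∂boxMeasure ℓ, ‖B x‖ ≤ M) (f : L2 ℓ) :
    MemLp (fun x => B x (f x)) 2 (boxMeasure ℓ) := by
  refine MemLp.of_le_mul (c := M) (Lp.memLp f) ?_ ?_
  · exact (ContinuousLinearMap.id ℝ (E3 →L[ℝ] E3)).aestronglyMeasurable_comp₂ hB
      (Lp.aestronglyMeasurable f)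
  · filter_upwards [hM] with x hx
    exact ((B x).le_opNorm _).trans (by gcongr)

/-- The operator `f ↦ (x ↦ B x (f x))` on `𝕃²`, for a bounded field `B` of linear maps. -/
def fieldOp {ℓ M : ℝ} {B : E3 → E3 →L[ℝ] E3} (hB : AEStronglyMeasurable B (boxMeasure ℓ))
    (hM : ∀ᵐ x ∂boxMeasure ℓ, ‖B x‖ ≤ M) : L2 ℓ →L[ℝ] L2 ℓ :=
  LinearMap.mkContinuous
    { toFun := fun f => (memLp_fieldOp hB hM f).toLp _
      map_add' := fun f g => by
        rw [← MemLp.toLp_add, MemLp.toLp_eq_toLp_iff]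
        filter_upwards [Lp.coeFn_add f g] with x hx
        rw [hx, Pi.add_apply, map_add, Pi.add_apply]
      map_smul' := fun c f => by
        rw [RingHom.id_apply, ← MemLp.toLp_const_smul, MemLp.toLp_eq_toLp_iff]
        filter_upwards [Lp.coeFn_smul c f] with x hx
        rw [hx, Pi.smul_apply, map_smul, Pi.smul_apply] } M fun f => by
    refine Lp.norm_le_mul_norm_of_ae_le_mul ?_
    filter_upwards [hM, (memLp_fieldOp hB hM f).coeFn_toLp] with x hx hx'
    simp only [LinearMap.coe_mk, AddHom.coe_mk]
    rw [hx']
    exact ((B x).le_opNorm _).trans (by gcongr)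

lemma coeFn_fieldOp {ℓ M : ℝ} {B : E3 → E3 →L[ℝ] E3} (hB : AEStronglyMeasurable B (boxMeasure ℓ))
    (hM : ∀ᵐ x ∂boxMeasure ℓ, ‖B x‖ ≤ M) (f : L2 ℓ) :
    fieldOp hB hM f =ᵐ[boxMeasure ℓ] fun x => B x (f x) := (memLp_fieldOp hB hM f).coeFn_toLp

lemma abs_coord_le (v : E3) (i : Fin 3) : |v i| ≤ ‖v‖ := PiLp.norm_apply_le v i

/-- Multiplication by the `i`-th coordinate of a bounded field. -/
def mulCoord {ℓ M : ℝ} {f : L2 ℓ} (hf : EssBdd f M) (i : Fin 3) : L2 ℓ →L[ℝ] L2 ℓ :=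
  fieldOp (M := M) (B := fun x => f x i • ContinuousLinearMap.id ℝ E3)
    ((memLp_coord f i).1.smul_const _) (by
      filter_upwards [hf] with x hx
      rw [norm_smul, ContinuousLinearMap.norm_id, mul_one]
      exact (abs_coord_le _ _).trans hx)

lemma coeFn_mulCoord {ℓ M : ℝ} {f : L2 ℓ} (hf : EssBdd f M) (i : Fin 3) (g : L2 ℓ) :
    mulCoord hf i g =ᵐ[boxMeasure ℓ] fun x => f x i • g x := coeFn_fieldOp _ _ g

/-- Multiplication of a bounded field by the `i`-th coordinate of the argument. -/
def coordMul {ℓ M : ℝ} {f : L2 ℓ} (hf : EssBdd f M) (i : Fin 3) : L2 ℓ →L[ℝ] L2 ℓ :=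
  fieldOp (M := M) (B := fun x => ContinuousLinearMap.smulRightL ℝ E3 E3 (EuclideanSpace.proj i) (f x))
    ((ContinuousLinearMap.smulRightL ℝ E3 E3 (EuclideanSpace.proj i)).continuous.comp_aestronglyMeasurable
      (Lp.aestronglyMeasurable f)) (by
      filter_upwards [hf] with x hx
      refine ContinuousLinearMap.opNorm_le_bound _ ((norm_nonneg _).trans hx) fun v => ?_
      change ‖v i • f x‖ ≤ _
      rw [norm_smul, mul_comm]
      exact mul_le_mul hx (abs_coord_le _ _) (norm_nonneg _) ((norm_nonneg _).trans hx))

lemma coeFn_coordMul {ℓ M : ℝ} {f : L2 ℓ} (hf : EssBdd f M) (i : Fin 3) (g : L2 ℓ) :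
    coordMul hf i g =ᵐ[boxMeasure ℓ] fun x => g x i • f x := coeFn_fieldOp _ _ g

/-- The field `[u·∇]v` for bounded `u`. -/
def adv {ℓ M : ℝ} {u : V ℓ} (hu : EssBdd (vel u) M) (v : V ℓ) : L2 ℓ :=
  ∑ i, mulCoord hu i (pd v i)

lemma coeFn_adv {ℓ M : ℝ} {u : V ℓ} (hu : EssBdd (vel u) M) (v : V ℓ) :
    adv hu v =ᵐ[boxMeasure ℓ] fun x => ∑ i, vel u x i • pd v i x := by
  have h : ∀ᵐ x ∂boxMeasure ℓ, ∀ i, mulCoord hu i (pd v i) x = vel u x i • pd v i x :=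
    ae_all_iff.2 fun i => coeFn_mulCoord hu i _
  filter_upwards [h, coeFn_finsetSum Finset.univ fun i => mulCoord hu i (pd v i)] with x hx hx'
  rw [adv, hx']
  exact Finset.sum_congr rfl fun i _ => hx i

lemma trilinear_eq_inner_adv {ℓ M : ℝ} {u : V ℓ} (hu : EssBdd (vel u) M) (v w : V ℓ) :
    trilinear u v w = ⟪adv hu v, vel w⟫_ℝ := by
  rw [trilinear, L2.inner_def]
  refine integral_congr_ae ?_
  filter_upwards [coeFn_adv hu v] with x hx
  rw [hx]

/-- Here the bounded factor is the test field `w`, so the form becomes continuous in `(u, v)` for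
the norm of `V`; this is what limit passages in the convection use. -/
lemma trilinear_eq_sum_inner {ℓ M : ℝ} {w : V ℓ} (hw : EssBdd (vel w) M) (u v : V ℓ) :
    trilinear u v w = ∑ i, ⟪coordMul hw i (vel u), pd v i⟫_ℝ := by
  have h : ∀ᵐ x ∂boxMeasure ℓ, ∀ i, coordMul hw i (vel u) x = vel u x i • vel w x :=
    ae_all_iff.2 fun i => coeFn_coordMul hw i _
  simp_rw [L2.inner_def]
  rw [← integral_finsetSum _ fun i _ => L2.integrable_inner _ _, trilinear]
  refine integral_congr_ae ?_
  filter_upwards [h] with x hx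
  simp only [hx, sum_inner, real_inner_smul_left]
  exact Finset.sum_congr rfl fun i _ => by rw [real_inner_comm]

lemma tendsto_trilinear {ι : Type*} {F : Filter ι} {ℓ M : ℝ} {u : ι → V ℓ} {u₀ w : V ℓ}
    (hu : Tendsto u F (𝓝 u₀)) (hw : EssBdd (vel w) M) :
    Tendsto (fun n => trilinear (u n) (u n) w) F (𝓝 (trilinear u₀ u₀ w)) := by
  simp_rw [trilinear_eq_sum_inner hw]
  refine tendsto_finsetSum _ fun i _ => Tendsto.inner ?_ ?_
  · exact (((coordMul hw i).comp (velL ℓ)).continuous.tendsto u₀).comp hu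
  · exact ((pdL ℓ i).continuous.tendsto u₀).comp hu

/-- `|∇u(x)|²`. -/
def gradSq {ℓ : ℝ} (u : V ℓ) (x : E3) : ℝ := ∑ j, ‖pd u j x‖ ^ 2

lemma gradSq_nonneg {ℓ : ℝ} (u : V ℓ) (x : E3) : 0 ≤ gradSq u x :=
  Finset.sum_nonneg fun _ _ => sq_nonneg _

lemma integrable_gradSq {ℓ : ℝ} (u : V ℓ) : Integrable (gradSq u) (boxMeasure ℓ) :=
  integrable_finsetSum _ fun j _ => (Lp.memLp (pd u j)).integrable_norm_pow two_ne_zero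

lemma integral_gradSq {ℓ : ℝ} (u : V ℓ) :
    ∫ x, gradSq u x ∂boxMeasure ℓ = ∑ j, ‖pd u j‖ ^ 2 := by
  simp only [gradSq]
  rw [integral_finsetSum _ fun j _ => (Lp.memLp (pd u j)).integrable_norm_pow two_ne_zero]
  simp_rw [norm_sq_eq_integral]

lemma norm_sum_smul_le (v : E3) (g : Fin 3 → E3) :
    ‖∑ i, v i • g i‖ ^ 2 ≤ ‖v‖ ^ 2 * ∑ i, ‖g i‖ ^ 2 := by
  have h1 : ‖∑ i, v i • g i‖ ≤ ∑ i, ‖v i‖ * ‖g i‖ :=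
    (norm_sum_le _ _).trans (Finset.sum_le_sum fun i _ => (norm_smul _ _).le)
  calc ‖∑ i, v i • g i‖ ^ 2 ≤ (∑ i, ‖v i‖ * ‖g i‖) ^ 2 := by gcongr
    _ ≤ (∑ i, ‖v i‖ ^ 2) * ∑ i, ‖g i‖ ^ 2 := Finset.sum_mul_sq_le_sq_mul_sq _ _ _
    _ = _ := by rw [EuclideanSpace.norm_sq_eq]

lemma integrable_pow_mul_gradSq {ℓ M : ℝ} {u : V ℓ} (hu : EssBdd (vel u) M) {p : ℝ} (hp : 0 ≤ p) :
    Integrable (fun x => ‖vel u x‖ ^ p * gradSq u x) (boxMeasure ℓ) := by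
  refine (integrable_gradSq u).bdd_mul (c := M ^ p) ?_ ?_
  · exact ((Real.continuous_rpow_const hp).comp_aestronglyMeasurable
      (Lp.aestronglyMeasurable (vel u)).norm)
  · filter_upwards [hu] with x hx
    rw [Real.norm_of_nonneg (by positivity)]
    exact Real.rpow_le_rpow (norm_nonneg _) hx hp

lemma norm_adv_sq_le {ℓ M : ℝ} {u : V ℓ} (hu : EssBdd (vel u) M) :
    ‖adv hu u‖ ^ 2 ≤ ∫ x, ‖vel u x‖ ^ (2 : ℝ) * gradSq u x ∂boxMeasure ℓ := by
  rw [norm_sq_eq_integral]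
  refine integral_mono_ae ((Lp.memLp _).integrable_norm_pow two_ne_zero)
    (integrable_pow_mul_gradSq hu (by norm_num)) ?_
  filter_upwards [coeFn_adv hu u] with x hx
  simp only [hx, Real.rpow_two]
  exact norm_sum_smul_le _ _

lemma norm_adv_le {ℓ M : ℝ} (hM : 0 ≤ M) {u : V ℓ} (hu : EssBdd (vel u) M) :
    ‖adv hu u‖ ≤ M * √(∑ j, ‖pd u j‖ ^ 2) := by
  refine abs_le_of_sq_le_sq' ?_ (by positivity) |>.2
  rw [mul_pow, Real.sq_sqrt (Finset.sum_nonneg fun _ _ => sq_nonneg _), ← integral_gradSq,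
    ← integral_const_mul]
  refine (norm_adv_sq_le hu).trans (integral_mono_ae (integrable_pow_mul_gradSq hu (by norm_num))
    ((integrable_gradSq u).const_mul _) ?_)
  filter_upwards [hu] with x hx
  simp only [Real.rpow_two]
  have := gradSq_nonneg u x
  gcongr

/-! ### The drag term -/

/-- For `p > 1` the map `x ↦ |x|^p x` is `C¹`, hence Lipschitz on balls. With a common sup bound,
`𝕃²` convergence then passes through the drag. -/
lemma exists_lipschitz_norm_rpow_smul {p : ℝ} (hp : 1 < p) (M : ℝ) : ∃ K : ℝ, 0 ≤ K ∧
    ∀ x y : E3, ‖x‖ ≤ M → ‖y‖ ≤ M → ‖‖x‖ ^ p • x - ‖y‖ ^ p • y‖ ≤ K * ‖x - y‖ := by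
  have hc : ContDiff ℝ 1 fun x : E3 => ‖x‖ ^ p • x := (contDiff_norm_rpow hp).smul contDiff_id
  obtain ⟨K, hK⟩ := (isCompact_closedBall (0 : E3) M).exists_bound_of_continuousOn
    (hc.continuous_fderiv one_ne_zero).continuousOn
  refine ⟨max K 0, le_max_right _ _, fun x y hx hy => ?_⟩
  exact (convex_closedBall (0 : E3) M).norm_image_sub_le_of_norm_fderiv_le
    (fun z _ => hc.differentiable one_ne_zero z) (fun z hz => (hK z hz).trans (le_max_left _ _))
    (by simpa using hy) (by simpa using hx)

lemma memLp_drag {ℓ M p : ℝ} (hp : 0 ≤ p) {u : L2 ℓ} (hu : EssBdd u M) :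
    MemLp (fun x => ‖u x‖ ^ p • u x) 2 (boxMeasure ℓ) := by
  refine MemLp.of_le_mul (c := M ^ p) (Lp.memLp u) ?_ ?_
  · exact ((Real.continuous_rpow_const hp).comp_aestronglyMeasurable
      (Lp.aestronglyMeasurable u).norm).smul (Lp.aestronglyMeasurable u)
  · filter_upwards [hu] with x hx
    rw [norm_smul, Real.norm_of_nonneg (by positivity)]
    gcongr

/-- The field `|u|^p u` for bounded `u`. -/
def drag {ℓ M p : ℝ} (hp : 0 ≤ p) {u : L2 ℓ} (hu : EssBdd u M) : L2 ℓ := (memLp_drag hp hu).toLp _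

lemma coeFn_drag {ℓ M p : ℝ} (hp : 0 ≤ p) {u : L2 ℓ} (hu : EssBdd u M) :
    drag hp hu =ᵐ[boxMeasure ℓ] fun x => ‖u x‖ ^ p • u x := (memLp_drag hp hu).coeFn_toLp

lemma forchheimer_eq_inner {ℓ M α : ℝ} (hα : 0 ≤ 2 * α) {u : V ℓ} (hu : EssBdd (vel u) M)
    (w : V ℓ) : forchheimer α u w = ⟪drag hα hu, vel w⟫_ℝ := by
  rw [forchheimer, L2.inner_def]
  refine integral_congr_ae ?_
  filter_upwards [coeFn_drag hα hu] with x hx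
  rw [hx]

lemma tendsto_drag {ι : Type*} {F : Filter ι} {ℓ M p : ℝ} (hp : 1 < p) (hp0 : 0 ≤ p)
    {u : ι → L2 ℓ} {u₀ : L2 ℓ}
    (h : Tendsto u F (𝓝 u₀)) (hu : ∀ n, EssBdd (u n) M) (hu₀ : EssBdd u₀ M) :
    Tendsto (fun n => drag hp0 (hu n)) F (𝓝 (drag hp0 hu₀)) := by
  obtain ⟨K, hK, hL⟩ := exists_lipschitz_norm_rpow_smul hp M
  rw [tendsto_iff_norm_sub_tendsto_zero] at h ⊢
  refine squeeze_zero (fun _ => norm_nonneg _) (fun n => ?_) (by simpa using h.const_mul K)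
  refine Lp.norm_le_mul_norm_of_ae_le_mul ?_
  filter_upwards [coeFn_drag hp0 (hu n), coeFn_drag hp0 hu₀, hu n, hu₀,
    Lp.coeFn_sub (drag hp0 (hu n)) (drag hp0 hu₀), Lp.coeFn_sub (u n) u₀] with x h1 h2 h3 h4 h5 h6
  rw [h5, h6, Pi.sub_apply, Pi.sub_apply, h1, h2]
  exact hL _ _ h3 h4

lemma inner_drag_self {ℓ M p : ℝ} (hp : 0 ≤ p) {u : L2 ℓ} (hu : EssBdd u M) :
    ⟪drag hp hu, u⟫_ℝ = ∫ x, ‖u x‖ ^ (p + 2) ∂boxMeasure ℓ := by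
  rw [L2.inner_def]
  refine integral_congr_ae ?_
  filter_upwards [coeFn_drag hp hu] with x hx
  rw [hx, real_inner_smul_left, real_inner_self_eq_norm_sq, ← Real.rpow_two]
  rcases eq_or_lt_of_le (norm_nonneg (u x)) with h | h
  · rw [← h, Real.zero_rpow (by norm_num : (2 : ℝ) ≠ 0), Real.zero_rpow (by positivity : p + 2 ≠ 0), mul_zero]
  · rw [Real.rpow_add h]

lemma inner_drag_self_nonneg {ℓ M p : ℝ} (hp : 0 ≤ p) {u : L2 ℓ} (hu : EssBdd u M) :
    0 ≤ ⟪drag hp hu, u⟫_ℝ := by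
  rw [inner_drag_self]
  exact integral_nonneg fun x => by positivity

/-! ### Trigonometric polynomials -/

/-- A vector-valued trigonometric polynomial. -/
def tpoly (ℓ : ℝ) (s : Finset Idx) (c : Idx → E3) (x : E3) : E3 := ∑ i ∈ s, trig ℓ i x • c i

/-- The derivative `∂ⱼ` of a trigonometric polynomial. -/
def tpolyDeriv (ℓ : ℝ) (s : Finset Idx) (c : Idx → E3) (j : Fin 3) (x : E3) : E3 :=
  ∑ i ∈ s, trig ℓ i.flip x • freq ℓ j i • c i

lemma contDiff_tpoly (ℓ : ℝ) (s : Finset Idx) (c : Idx → E3) {n : WithTop ℕ∞} :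
    ContDiff ℝ n (tpoly ℓ s c) :=
  ContDiff.sum fun i _ => (contDiff_trig ℓ i).smul contDiff_const

lemma contDiff_tpolyDeriv (ℓ : ℝ) (s : Finset Idx) (c : Idx → E3) (j : Fin 3) {n : WithTop ℕ∞} :
    ContDiff ℝ n (tpolyDeriv ℓ s c j) :=
  ContDiff.sum fun i _ => (contDiff_trig ℓ i.flip).smul contDiff_const

lemma tpoly_periodic {ℓ : ℝ} (hℓ : 0 < ℓ) (s : Finset Idx) (c : Idx → E3) (x : E3) (m : Fin 3) :
    tpoly ℓ s c (x + ℓ • basisVec m) = tpoly ℓ s c x := by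
  simp only [tpoly, fun i => (isPeriodicTest_trig hℓ i).2 x m]

lemma tpolyDeriv_periodic {ℓ : ℝ} (hℓ : 0 < ℓ) (s : Finset Idx) (c : Idx → E3) (j : Fin 3) (x : E3)
    (m : Fin 3) : tpolyDeriv ℓ s c j (x + ℓ • basisVec m) = tpolyDeriv ℓ s c j x := by
  simp only [tpolyDeriv, fun i : Idx => (isPeriodicTest_trig hℓ i.flip).2 x m]

lemma fderiv_tpoly (ℓ : ℝ) (s : Finset Idx) (c : Idx → E3) (j : Fin 3) (x : E3) :
    fderiv ℝ (tpoly ℓ s c) x (basisVec j) = tpolyDeriv ℓ s c j x := by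
  have h : HasFDerivAt (tpoly ℓ s c)
      (∑ i ∈ s, (fderiv ℝ (trig ℓ i) x).smulRight (c i)) x := by
    refine HasFDerivAt.fun_sum fun i _ => ?_
    exact (((contDiff_trig ℓ i (n := 1)).differentiable one_ne_zero x).hasFDerivAt).smul_const _
  rw [h.fderiv, sum_apply, tpolyDeriv]
  refine Finset.sum_congr rfl fun i _ => ?_
  rw [ContinuousLinearMap.smulRight_apply, fderiv_trig, smul_smul, mul_comm]

lemma fderiv_tpolyDeriv (ℓ : ℝ) (s : Finset Idx) (c : Idx → E3) (j : Fin 3) (x : E3) :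
    fderiv ℝ (tpolyDeriv ℓ s c j) x (basisVec j) =
      -∑ i ∈ s, trig ℓ i x • freq ℓ j i ^ 2 • c i := by
  have h : HasFDerivAt (tpolyDeriv ℓ s c j)
      (∑ i ∈ s, (fderiv ℝ (trig ℓ i.flip) x).smulRight (freq ℓ j i • c i)) x := by
    refine HasFDerivAt.fun_sum fun i _ => ?_
    exact (((contDiff_trig ℓ i.flip (n := 1)).differentiable one_ne_zero x).hasFDerivAt).smul_const _
  rw [h.fderiv, sum_apply, ← Finset.sum_neg_distrib]
  refine Finset.sum_congr rfl fun i _ => ?_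
  rw [ContinuousLinearMap.smulRight_apply, fderiv_trig, Idx.flip_flip, freq_flip, smul_smul,
    smul_smul, ← neg_smul]
  congr 1
  ring

lemma coeFn_vel_trunc {ℓ : ℝ} (hℓ : 0 < ℓ) (s : Finset Idx) (f : H ℓ) :
    vel (trunc hℓ s f) =ᵐ[boxMeasure ℓ] tpoly ℓ s fun i => (ℓ ^ 3)⁻¹ • coef ℓ i f := by
  rw [vel_trunc]
  exact coeFn_sum_mode ℓ s _ _

lemma coeFn_pd_trunc {ℓ : ℝ} (hℓ : 0 < ℓ) (s : Finset Idx) (f : H ℓ) (j : Fin 3) :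
    pd (trunc hℓ s f) j =ᵐ[boxMeasure ℓ]
      tpolyDeriv ℓ s (fun i => (ℓ ^ 3)⁻¹ • coef ℓ i f) j := by
  rw [pd_trunc]
  have h : ∀ᵐ x ∂boxMeasure ℓ, ∀ i : Idx,
      ((ℓ ^ 3)⁻¹ • freq ℓ j i • mode ℓ i.flip (coef ℓ i f)) x =
        trig ℓ i.flip x • freq ℓ j i • (ℓ ^ 3)⁻¹ • coef ℓ i f := by
    refine ae_all_iff.2 fun i => ?_
    rw [smul_smul, ← map_smul]
    filter_upwards [coeFn_mode ℓ i.flip (((ℓ ^ 3)⁻¹ * freq ℓ j i) • coef ℓ i f)] with x hx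
    rw [hx, smul_smul (freq ℓ j i), mul_comm]
  filter_upwards [h, coeFn_finsetSum s fun i =>
    (ℓ ^ 3)⁻¹ • freq ℓ j i • mode ℓ i.flip (coef ℓ i f)] with x hx hx'
  rw [hx']
  exact Finset.sum_congr rfl fun i _ => hx i

/-! ### Cancellation of the convection -/

/-- The trilinear form vanishes when its last two arguments agree and are trigonometric
polynomials. -/
lemma trilinear_trunc_self {ℓ : ℝ} (hℓ : 0 < ℓ) (u : V ℓ) (s : Finset Idx) (f : H ℓ) :
    trilinear u (trunc hℓ s f) (trunc hℓ s f) = 0 := by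
  set c : Idx → E3 := fun i => (ℓ ^ 3)⁻¹ • coef ℓ i f with hc
  -- For a trigonometric polynomial `v`, `|v|²` is a legitimate test function for `div u = 0`, and
  -- `∇|v|²·u = 2([u·∇]v)·v`.
  have hψ : IsPeriodicTest ℓ fun x => ‖tpoly ℓ s c x‖ ^ 2 :=
    ⟨(contDiff_tpoly ℓ s c).norm_sq ℝ, fun x i => by simp only [tpoly_periodic hℓ]⟩
  have h := vel_mem_H u _ hψ
  have hd : ∀ x j, fderiv ℝ (fun x => ‖tpoly ℓ s c x‖ ^ 2) x (basisVec j) =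
      2 * ⟪tpolyDeriv ℓ s c j x, tpoly ℓ s c x⟫_ℝ := by
    intro x j
    have h1 := ((contDiff_tpoly ℓ s c (n := 1)).differentiable one_ne_zero x).hasFDerivAt.norm_sq
    rw [h1.fderiv, smul_apply, ContinuousLinearMap.comp_apply, innerSL_apply_apply, fderiv_tpoly,
      real_inner_comm, nsmul_eq_mul]
    norm_num
  have e : ∫ x, ⟪gradient (fun x => ‖tpoly ℓ s c x‖ ^ 2) x, vel u x⟫_ℝ ∂boxMeasure ℓ =
      2 * trilinear u (trunc hℓ s f) (trunc hℓ s f) := by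
    rw [trilinear, ← integral_const_mul]
    have hp : ∀ᵐ x ∂boxMeasure ℓ, ∀ j, pd (trunc hℓ s f) j x = tpolyDeriv ℓ s c j x :=
      ae_all_iff.2 fun j => coeFn_pd_trunc hℓ s f j
    refine integral_congr_ae ?_
    filter_upwards [coeFn_vel_trunc hℓ s f, hp] with x hx hx'
    rw [inner_gradient, hx, sum_inner, Finset.mul_sum]
    refine Finset.sum_congr rfl fun j _ => ?_
    rw [hd, hx', real_inner_smul_left]
    ring
  rw [e] at h
  linarith

/-- The trilinear form vanishes on `(u, u, u)`. -/
lemma trilinear_self {ℓ M : ℝ} (hℓ : 0 < ℓ) {u : V ℓ} (hu : EssBdd (vel u) M) :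
    trilinear u u u = 0 := by
  have h1 := tendsto_trunc hℓ u
  -- Only the last two arguments are truncated. The first stays fixed and bounded, so the form is
  -- continuous in the other two.
  have h2 : Tendsto (fun s => trilinear u (trunc hℓ s (toH ℓ u)) (trunc hℓ s (toH ℓ u))) atTop
      (𝓝 (trilinear u u u)) := by
    simp_rw [trilinear_eq_inner_adv hu, adv]
    refine Tendsto.inner ?_ ?_
    · refine tendsto_finsetSum _ fun i _ => ?_
      exact (((mulCoord hu i).comp (pdL ℓ i)).continuous.tendsto u).comp h1
    · exact ((velL ℓ).continuous.tendsto u).comp h1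
  simp_rw [trilinear_trunc_self] at h2
  exact tendsto_nhds_unique h2 tendsto_const_nhds

/-! ### Coercivity of the drag against the Laplacian -/

/-- Integrating `∂ⱼ(|v|^p ⟨v, ∂ⱼv⟩)` over a period cell gives zero. Expanded, it is `|v|^p|∂ⱼv|² +
|v|^p⟨v, ∂ⱼ²v⟩` plus the nonnegative term `p|v|^{p-2}⟨v, ∂ⱼv⟩²`, which is dropped; the sum on the
right-hand side is `-∂ⱼ²v`. -/
lemma integral_drag_deriv_le {ℓ p : ℝ} (hℓ : 0 < ℓ) (hp : 1 < p) (s : Finset Idx) (c : Idx → E3)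
    (j : Fin 3) :
    ∫ x, ‖tpoly ℓ s c x‖ ^ p * ‖tpolyDeriv ℓ s c j x‖ ^ 2 ∂boxMeasure ℓ ≤
      ∫ x, ‖tpoly ℓ s c x‖ ^ p *
        ⟪tpoly ℓ s c x, ∑ i ∈ s, trig ℓ i x • freq ℓ j i ^ 2 • c i⟫_ℝ ∂boxMeasure ℓ := by
  set v := tpoly ℓ s c with hv
  set d := tpolyDeriv ℓ s c j with hd
  have hvc : ContDiff ℝ 1 v := contDiff_tpoly ℓ s c
  have hdc : ContDiff ℝ 1 d := contDiff_tpolyDeriv ℓ s c j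
  have hnc : ContDiff ℝ 1 fun x => ‖v x‖ ^ p := (contDiff_norm_rpow hp).comp hvc
  have h0 := integral_fderiv_eq_zero hℓ (ψ := fun x => ‖v x‖ ^ p * ⟪v x, d x⟫_ℝ)
    (hnc.mul (hvc.inner ℝ hdc)) (fun x i => by
      simp only [hv, hd, tpoly_periodic hℓ, tpolyDeriv_periodic hℓ]) j
  have hder : ∀ x, fderiv ℝ (fun x => ‖v x‖ ^ p * ⟪v x, d x⟫_ℝ) x (basisVec j) =
      ‖v x‖ ^ p * (‖d x‖ ^ 2 - ⟪v x, ∑ i ∈ s, trig ℓ i x • freq ℓ j i ^ 2 • c i⟫_ℝ) +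
        p * ‖v x‖ ^ (p - 2) * ⟪v x, d x⟫_ℝ ^ 2 := by
    intro x
    have h1 := (hasFDerivAt_norm_rpow (v x) hp).comp x
      (hvc.differentiable one_ne_zero x).hasFDerivAt
    have h2 := ((hvc.differentiable one_ne_zero x).hasFDerivAt).inner ℝ
      ((hdc.differentiable one_ne_zero x).hasFDerivAt)
    have h3 := (h1.mul h2).fderiv
    have h4 : fderiv ℝ (fun x => ‖v x‖ ^ p * ⟪v x, d x⟫_ℝ) x = _ := h3
    rw [h4]
    have e1 : fderiv ℝ v x (basisVec j) = d x := fderiv_tpoly ℓ s c j x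
    have e2 : fderiv ℝ d x (basisVec j) = -∑ i ∈ s, trig ℓ i x • freq ℓ j i ^ 2 • c i :=
      fderiv_tpolyDeriv ℓ s c j x
    simp only [add_apply, smul_apply, ContinuousLinearMap.comp_apply, smul_eq_mul,
      fderivInnerCLM_apply, ContinuousLinearMap.prod_apply, innerSL_apply_apply, e1, e2,
      inner_neg_right, real_inner_self_eq_norm_sq, Function.comp_apply]
    ring
  have hi : ∀ {c : E3 → ℝ}, Continuous c → Integrable c (boxMeasure ℓ) := fun hc =>
    memLp_one_iff_integrable.1 (memLp_of_continuous ℓ 1 hc)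
  have hS : Continuous fun x => ∑ i ∈ s, trig ℓ i x • freq ℓ j i ^ 2 • c i :=
    continuous_finsetSum _ fun i _ => (trigC ℓ i).continuous.smul continuous_const
  have i1 : Integrable (fun x => ‖v x‖ ^ p * ‖d x‖ ^ 2) (boxMeasure ℓ) :=
    hi (hnc.continuous.mul (hdc.continuous.norm.pow 2))
  have i2 : Integrable (fun x => ‖v x‖ ^ p *
      ⟪v x, ∑ i ∈ s, trig ℓ i x • freq ℓ j i ^ 2 • c i⟫_ℝ) (boxMeasure ℓ) :=
    hi (hnc.continuous.mul (hvc.continuous.inner hS))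
  have h5 : ∫ x, (‖v x‖ ^ p * ‖d x‖ ^ 2 - ‖v x‖ ^ p *
      ⟪v x, ∑ i ∈ s, trig ℓ i x • freq ℓ j i ^ 2 • c i⟫_ℝ) ∂boxMeasure ℓ ≤ 0 := by
    rw [← h0]
    refine integral_mono (i1.sub i2) (hi (((hnc.mul (hvc.inner ℝ hdc)).continuous_fderiv
      one_ne_zero).clm_apply continuous_const)) fun x => ?_
    simp only [hder]
    have : 0 ≤ p * ‖v x‖ ^ (p - 2) * ⟪v x, d x⟫_ℝ ^ 2 := by positivity
    linarith
  rw [integral_sub i1 i2] at h5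
  linarith

/-- Truncation commutes with `-Δ`, so the truncation of `w` is minus the Laplacian of the truncation
of `f`, and the directional inequality can be summed over `j`. -/
lemma integral_trunc_le {ℓ p M : ℝ} (hℓ : 0 < ℓ) (hp : 1 < p) (hp0 : 0 ≤ p) (s : Finset Idx)
    {f w : H ℓ} (hL : HasLap (f : L2 ℓ) (w : L2 ℓ)) (hb : EssBdd (vel (trunc hℓ s f)) M) :
    ∫ x, ‖vel (trunc hℓ s f) x‖ ^ p * gradSq (trunc hℓ s f) x ∂boxMeasure ℓ ≤
      ⟪drag hp0 hb, vel (trunc hℓ s w)⟫_ℝ := by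
  set c : Idx → E3 := fun i => (ℓ ^ 3)⁻¹ • coef ℓ i f with hc
  have hi : ∀ {c : E3 → ℝ}, Continuous c → Integrable c (boxMeasure ℓ) := fun hc =>
    memLp_one_iff_integrable.1 (memLp_of_continuous ℓ 1 hc)
  have hnc : Continuous fun x => ‖tpoly ℓ s c x‖ ^ p :=
    ((contDiff_norm_rpow hp).comp (contDiff_tpoly ℓ s c)).continuous
  have hp' : ∀ᵐ x ∂boxMeasure ℓ, ∀ j, pd (trunc hℓ s f) j x = tpolyDeriv ℓ s c j x :=
    ae_all_iff.2 fun j => coeFn_pd_trunc hℓ s f j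
  have i1 : ∀ j, Integrable (fun x => ‖tpoly ℓ s c x‖ ^ p * ‖tpolyDeriv ℓ s c j x‖ ^ 2)
      (boxMeasure ℓ) := fun j =>
    hi (hnc.mul ((contDiff_tpolyDeriv ℓ s c j (n := 0)).continuous.norm.pow 2))
  have i2 : ∀ j, Integrable (fun x => ‖tpoly ℓ s c x‖ ^ p *
      ⟪tpoly ℓ s c x, ∑ i ∈ s, trig ℓ i x • freq ℓ j i ^ 2 • c i⟫_ℝ) (boxMeasure ℓ) := fun j =>
    hi (hnc.mul ((contDiff_tpoly ℓ s c (n := 0)).continuous.inner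
        (continuous_finsetSum _ fun i _ => (trigC ℓ i).continuous.smul continuous_const)))
  have e1 : ∫ x, ‖vel (trunc hℓ s f) x‖ ^ p * gradSq (trunc hℓ s f) x ∂boxMeasure ℓ =
      ∑ j, ∫ x, ‖tpoly ℓ s c x‖ ^ p * ‖tpolyDeriv ℓ s c j x‖ ^ 2 ∂boxMeasure ℓ := by
    rw [← integral_finsetSum _ fun j _ => i1 j]
    refine integral_congr_ae ?_
    filter_upwards [coeFn_vel_trunc hℓ s f, hp'] with x hx hx'
    rw [hx, gradSq, Finset.mul_sum]
    simp only [hx']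
    rfl
  have e2 : ⟪drag hp0 hb, vel (trunc hℓ s w)⟫_ℝ =
      ∑ j, ∫ x, ‖tpoly ℓ s c x‖ ^ p *
        ⟪tpoly ℓ s c x, ∑ i ∈ s, trig ℓ i x • freq ℓ j i ^ 2 • c i⟫_ℝ ∂boxMeasure ℓ := by
    rw [← integral_finsetSum _ fun j _ => i2 j, L2.inner_def]
    refine integral_congr_ae ?_
    filter_upwards [coeFn_vel_trunc hℓ s f, coeFn_vel_trunc hℓ s w, coeFn_drag hp0 hb]
      with x hx hx' hx''
    rw [hx'', hx, hx', real_inner_smul_left, ← Finset.mul_sum, ← inner_sum, Finset.sum_comm]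
    congr 2
    refine Finset.sum_congr rfl fun i _ => ?_
    rw [← Finset.smul_sum, ← Finset.sum_smul]
    beta_reduce
    rw [hL i, hc, smul_comm (ℓ ^ 3)⁻¹]
    rfl
  rw [e1, e2]
  exact Finset.sum_le_sum fun j _ => integral_drag_deriv_le hℓ hp s c j

/-- Coercivity of the drag term against `-Δu`. -/
lemma HasLap.integral_le_inner_drag {ℓ p M : ℝ} (hℓ : 0 < ℓ) (hp : 1 < p) (hp0 : 0 ≤ p) {u : V ℓ}
    {w : H ℓ} (hL : HasLap (vel u) (w : L2 ℓ))
    (hbs : ∀ s, EssBdd (vel (trunc hℓ s (toH ℓ u))) M) (hb : EssBdd (vel u) M) :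
    ∫ x, ‖vel u x‖ ^ p * gradSq u x ∂boxMeasure ℓ ≤ ⟪drag hp0 hb, (w : L2 ℓ)⟫_ℝ := by
  set us : Finset Idx → V ℓ := fun s => trunc hℓ s (toH ℓ u) with hus
  have hlim : Tendsto us atTop (𝓝 u) := tendsto_trunc hℓ u
  -- A sequence of truncations is refined four times, so that the velocity and the three partial
  -- derivatives converge almost everywhere along a single subsequence.
  obtain ⟨s, hs⟩ := exists_seq_tendsto (atTop : Filter (Finset Idx))
  have hv : ∃ ns : ℕ → ℕ, StrictMono ns ∧ ∀ᵐ x ∂boxMeasure ℓ,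
      Tendsto (fun n => vel (us (s (ns n))) x) atTop (𝓝 (vel u x)) :=
    (tendstoInMeasure_of_tendsto_Lp
      (((velL ℓ).continuous.tendsto u).comp (hlim.comp hs))).exists_seq_tendsto_ae
  obtain ⟨n0, hn0, hv⟩ := hv
  have hstep : ∀ (j : Fin 3) (t : ℕ → Finset Idx), Tendsto t atTop atTop →
      ∃ ns : ℕ → ℕ, StrictMono ns ∧ ∀ᵐ x ∂boxMeasure ℓ,
        Tendsto (fun n => pd (us (t (ns n))) j x) atTop (𝓝 (pd u j x)) := fun j t ht =>
    (tendstoInMeasure_of_tendsto_Lp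
      (((pdL ℓ j).continuous.tendsto u).comp (hlim.comp ht))).exists_seq_tendsto_ae
  have ht0 := hs.comp hn0.tendsto_atTop
  obtain ⟨n1, hn1, h1⟩ := hstep 0 _ ht0
  have ht1 := ht0.comp hn1.tendsto_atTop
  obtain ⟨n2, hn2, h2⟩ := hstep 1 _ ht1
  have ht2 := ht1.comp hn2.tendsto_atTop
  obtain ⟨n3, hn3, h3⟩ := hstep 2 _ ht2
  have ht3 := ht2.comp hn3.tendsto_atTop
  set t : ℕ → Finset Idx := ((((s ∘ n0) ∘ n1) ∘ n2) ∘ n3) with ht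
  have hpt : ∀ᵐ x ∂boxMeasure ℓ, Tendsto (fun n => ENNReal.ofReal
      (‖vel (us (t n)) x‖ ^ p * gradSq (us (t n)) x)) atTop
        (𝓝 (ENNReal.ofReal (‖vel u x‖ ^ p * gradSq u x))) := by
    filter_upwards [hv, h1, h2, h3] with x a0 a1 a2 a3
    refine ENNReal.tendsto_ofReal (Tendsto.mul ?_ ?_)
    · refine ((Real.continuous_rpow_const hp0).tendsto _).comp ?_
      exact (a0.comp ((hn1.tendsto_atTop.comp hn2.tendsto_atTop).comp hn3.tendsto_atTop)).norm
    · refine tendsto_finsetSum _ fun j _ => Tendsto.pow (Tendsto.norm ?_) 2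
      fin_cases j
      · exact a1.comp (hn2.tendsto_atTop.comp hn3.tendsto_atTop)
      · exact a2.comp hn3.tendsto_atTop
      · exact a3
  have hdrag := tendsto_drag hp hp0 (((velL ℓ).continuous.tendsto u).comp (hlim.comp ht3))
    (fun n => hbs (t n)) hb
  have hrhs' : Tendsto (fun n => ⟪drag hp0 (hbs (t n)), vel (trunc hℓ (t n) w)⟫_ℝ) atTop
      (𝓝 ⟪drag hp0 hb, (w : L2 ℓ)⟫_ℝ) := hdrag.inner ((tendsto_vel_trunc hℓ w).comp ht3)
  have hrhs := ENNReal.tendsto_ofReal hrhs'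
  have hposn : ∀ n, 0 ≤ᵐ[boxMeasure ℓ] fun x => ‖vel (us (t n)) x‖ ^ p * gradSq (us (t n)) x :=
    fun n => Eventually.of_forall fun x => mul_nonneg (by positivity) (gradSq_nonneg _ _)
  have hle : ∀ n, ∫ x, ‖vel (us (t n)) x‖ ^ p * gradSq (us (t n)) x ∂boxMeasure ℓ ≤
      ⟪drag hp0 (hbs (t n)), vel (trunc hℓ (t n) w)⟫_ℝ := fun n =>
    integral_trunc_le hℓ hp hp0 (t n) (f := toH ℓ u) hL (hbs (t n))
  have hnn : 0 ≤ ⟪drag hp0 hb, (w : L2 ℓ)⟫_ℝ :=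
    ge_of_tendsto' hrhs' fun n => (integral_nonneg_of_ae (hposn n)).trans (hle n)
  have hpos : 0 ≤ᵐ[boxMeasure ℓ] fun x => ‖vel u x‖ ^ p * gradSq u x :=
    Eventually.of_forall fun x => mul_nonneg (by positivity) (gradSq_nonneg _ _)
  -- Fatou's lemma on the left; on the right the drag converges in `𝕃²` because all truncations
  -- share the bound `M`.
  have key : ENNReal.ofReal (∫ x, ‖vel u x‖ ^ p * gradSq u x ∂boxMeasure ℓ) ≤
      ENNReal.ofReal ⟪drag hp0 hb, (w : L2 ℓ)⟫_ℝ := by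
    rw [ofReal_integral_eq_lintegral_ofReal (integrable_pow_mul_gradSq hb hp0) hpos]
    calc ∫⁻ x, ENNReal.ofReal (‖vel u x‖ ^ p * gradSq u x) ∂boxMeasure ℓ
        = ∫⁻ x, liminf (fun n => ENNReal.ofReal
            (‖vel (us (t n)) x‖ ^ p * gradSq (us (t n)) x)) atTop ∂boxMeasure ℓ := by
          refine lintegral_congr_ae ?_
          filter_upwards [hpt] with x hx
          exact hx.liminf_eq.symm
      _ ≤ liminf (fun n => ∫⁻ x, ENNReal.ofReal
            (‖vel (us (t n)) x‖ ^ p * gradSq (us (t n)) x) ∂boxMeasure ℓ) atTop := by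
          refine lintegral_liminf_le' fun n => ?_
          exact (integrable_pow_mul_gradSq (hbs (t n)) hp0).1.aemeasurable.ennreal_ofReal
      _ ≤ liminf (fun n => ENNReal.ofReal
            ⟪drag hp0 (hbs (t n)), vel (trunc hℓ (t n) w)⟫_ℝ) atTop :=
          liminf_le_liminf (Eventually.of_forall fun n => by
            rw [← ofReal_integral_eq_lintegral_ofReal (integrable_pow_mul_gradSq (hbs (t n)) hp0)
              (hposn n)]
            exact ENNReal.ofReal_le_ofReal (hle n))
      _ = _ := hrhs.liminf_eq
  exact (ENNReal.ofReal_le_ofReal_iff hnn).1 key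

end BFEuler

end

noncomputable section
namespace BFEuler
open Set Filter Topology

/-! ### Compactness of bounded sets of `ℍ²` in `V` -/

lemma HasLap.sub {ℓ : ℝ} {f w f' w' : L2 ℓ} (h : HasLap f w) (h' : HasLap f' w') :
    HasLap (f - f') (w - w') := fun i => by rw [map_sub, map_sub, h i, h' i, smul_sub]

lemma HasLap.sum {ι : Type*} {ℓ : ℝ} (s : Finset ι) {f w : ι → L2 ℓ}
    (h : ∀ i, HasLap (f i) (w i)) : HasLap (∑ i ∈ s, f i) (∑ i ∈ s, w i) := fun i => by
  rw [map_sum, map_sum, Finset.smul_sum]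
  exact Finset.sum_congr rfl fun j _ => h j i

lemma hasLap_mode {ℓ : ℝ} (hℓ : 0 < ℓ) (i : Idx) (v : E3) :
    HasLap (mode ℓ i v) (mode ℓ i (lapSymbol ℓ i • v)) := by
  have h := hasLap_of_isWeakDeriv hℓ (fun j => isWeakDeriv_mode hℓ j i v)
    (fun j => (isWeakDeriv_mode hℓ j i.flip v).smul (freq ℓ j i))
  convert! h using 1
  rw [map_smul, lapSymbol, Finset.sum_smul, ← Finset.sum_neg_distrib]
  refine Finset.sum_congr rfl fun j _ => ?_
  rw [freq_flip, Idx.flip_flip, neg_smul, smul_neg, neg_neg, smul_smul, sq]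

/-- A Rellich argument: the squared coefficients are dominated by a multiple of the summable
`|symbol|⁻²`, plus a constant at the zero frequency, so convergence of each coefficient passes
through Parseval's sum. -/
lemma HasLap.tendsto_zero {ι : Type*} {F : Filter ι} {ℓ C : ℝ} (hℓ : 0 < ℓ) {f w : ι → L2 ℓ}
    (h : ∀ᶠ n in F, HasLap (f n) (w n) ∧ ‖f n‖ ≤ C ∧ ‖w n‖ ≤ C)
    (h0 : ∀ i, Tendsto (fun n => coef ℓ i (f n)) F (𝓝 0)) : Tendsto f F (𝓝 0) := by
  classical
  set K : ℝ := (√(ℓ ^ 3) * C) ^ 2 with hK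
  have hb : ∀ᶠ n in F, ∀ i, ‖coef ℓ i (f n)‖ ^ 2 ≤
      (lapSymbol ℓ i)⁻¹ ^ 2 * K + if i.1 = 0 then K else 0 := by
    filter_upwards [h] with n ⟨h, hf, hw⟩ i
    have h1 : ∀ g : L2 ℓ, ‖g‖ ≤ C → ‖coef ℓ i g‖ ^ 2 ≤ K := fun g hg => by
      refine pow_le_pow_left₀ (norm_nonneg _) ((norm_coef_le hℓ i g).trans ?_) 2
      gcongr
    by_cases hl : lapSymbol ℓ i = 0
    · rw [if_pos (eq_zero_of_lapSymbol hℓ hl), hl]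
      simpa using h1 _ hf
    · have h2 := h1 _ hw
      rw [h i, norm_smul, mul_pow, Real.norm_eq_abs, sq_abs] at h2
      have h3 : ‖coef ℓ i (f n)‖ ^ 2 ≤ (lapSymbol ℓ i)⁻¹ ^ 2 * K := by
        rw [inv_pow, inv_mul_eq_div, le_div_iff₀ (by positivity)]
        linarith
      have h4 : 0 ≤ if i.1 = 0 then K else 0 := by split_ifs <;> positivity
      linarith
  have hs : Summable fun i : Idx => (lapSymbol ℓ i)⁻¹ ^ 2 * K + if i.1 = 0 then K else 0 := by
    refine ((summable_inv_lapSymbol_sq ℓ).mul_right K).add ?_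
    refine summable_of_hasFiniteSupport (Set.Finite.subset
      ((Set.finite_singleton (0 : Fin 3 → ℤ)).prod (Set.finite_univ (α := Bool))) ?_)
    intro i hi
    simp only [Function.mem_support, ne_eq, ite_eq_right_iff, Classical.not_imp] at hi
    exact ⟨hi.1, trivial⟩
  have ht := tendsto_tsum_of_dominated_convergence (𝓕 := F) (f := fun n i => ‖coef ℓ i (f n)‖ ^ 2)
    (g := fun _ => (0 : ℝ)) hs (fun i => by simpa using ((h0 i).norm.pow 2))
    (hb.mono fun n hn i => by
      rw [Real.norm_of_nonneg (sq_nonneg _)]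
      exact hn i)
  simp_rw [fun n => (hasSum_norm_sq_coef hℓ (f n)).tsum_eq, tsum_zero] at ht
  have h2 := (ht.const_mul (ℓ ^ 3)⁻¹).sqrt
  rw [tendsto_zero_iff_norm_tendsto_zero]
  simp only [mul_zero, Real.sqrt_zero] at h2
  refine h2.congr fun n => ?_
  rw [← mul_assoc, inv_mul_cancel₀ (by positivity), one_mul, Real.sqrt_sq (norm_nonneg _)]

/-- The ball of radius `C` in `V ∩ ℍ²`. -/
def regBall (ℓ C : ℝ) : Set (V ℓ) :=
  {u | ‖u‖ ≤ C ∧ ∀ s : Finset Idx,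
    ∑ i ∈ s, lapSymbol ℓ i ^ 2 * ‖coef ℓ i (vel u)‖ ^ 2 ≤ ℓ ^ 3 * C ^ 2}

lemma mem_regBall {ℓ C : ℝ} (hℓ : 0 < ℓ) {u : V ℓ} {w : L2 ℓ} (hu : ‖u‖ ≤ C) (hw : ‖w‖ ≤ C)
    (h : HasLap (vel u) w) : u ∈ regBall ℓ C := by
  refine ⟨hu, fun s => ?_⟩
  have h1 := sum_le_hasSum s (fun _ _ => sq_nonneg _) (hasSum_norm_sq_coef hℓ w)
  simp only [h _, norm_smul, mul_pow, Real.norm_eq_abs, sq_abs] at h1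
  refine h1.trans ?_
  gcongr

lemma inDomA_of_mem_regBall {ℓ C : ℝ} (hℓ : 0 < ℓ) {u : V ℓ} (hu : u ∈ regBall ℓ C) : InDomA u :=
  inDomA_of_summable hℓ (summable_of_sum_le (fun i => by positivity) hu.2)

lemma norm_stokes_le {ℓ C : ℝ} (hℓ : 0 < ℓ) (hC : 0 ≤ C) {u : V ℓ} (hu : u ∈ regBall ℓ C) :
    ‖(stokes u : L2 ℓ)‖ ≤ C := by
  have hL := hasLap_stokes hℓ (inDomA_of_mem_regBall hℓ hu)
  have h1 := hasSum_norm_sq_coef hℓ (stokes u : L2 ℓ)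
  simp only [hL _, norm_smul, mul_pow, Real.norm_eq_abs, sq_abs] at h1
  have h2 := hasSum_le_of_sum_le h1 hu.2
  exact abs_le_of_sq_le_sq' (le_of_mul_le_mul_left h2 (by positivity)) hC |>.2

/-- Each constraint involves finitely many Fourier coefficients, hence is continuous on `V`. -/
lemma isClosed_regBall (ℓ C : ℝ) : IsClosed (regBall ℓ C) := by
  have : regBall ℓ C = {u | ‖u‖ ≤ C} ∩ ⋂ s : Finset Idx,
      {u | ∑ i ∈ s, lapSymbol ℓ i ^ 2 * ‖coef ℓ i (velL ℓ u)‖ ^ 2 ≤ ℓ ^ 3 * C ^ 2} := by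
    ext u; simp [regBall]
  rw [this]
  refine (isClosed_le continuous_norm continuous_const).inter (isClosed_iInter fun s => ?_)
  refine isClosed_le (continuous_finsetSum _ fun i _ => continuous_const.mul ?_) continuous_const
  exact (((coef ℓ i).comp (velL ℓ)).continuous.norm).pow 2

lemma isClosed_V (ℓ : ℝ) : IsClosed (V ℓ : Set (WithLp 2 (L2 ℓ × PiLp 2 fun _ : Fin 3 => L2 ℓ))) := by
  refine IsSeqClosed.isClosed fun u v hu huv => ?_
  have h1 : Tendsto (fun n => (u n).fst) atTop (𝓝 v.fst) :=
    ((WithLp.fstL 2 ℝ (L2 ℓ) (PiLp 2 fun _ : Fin 3 => L2 ℓ)).continuous.tendsto v).comp huv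
  have h2 : ∀ j, Tendsto (fun n => (u n).snd j) atTop (𝓝 (v.snd j)) := fun j =>
    (((PiLp.proj 2 (𝕜 := ℝ) (fun _ : Fin 3 => L2 ℓ) j).comp
      (WithLp.sndL 2 ℝ (L2 ℓ) (PiLp 2 fun _ : Fin 3 => L2 ℓ))).continuous.tendsto v).comp huv
  exact ⟨(isClosed_H ℓ).mem_of_tendsto h1 (Eventually.of_forall fun n => (hu n).1),
    fun j => isWeakDeriv_of_tendsto h1 (h2 j) fun n => (hu n).2 j⟩

instance (ℓ : ℝ) : CompleteSpace (V ℓ) := (isClosed_V ℓ).completeSpace_coe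

/-- Interpolation of `V` between `H` and `ℍ²`; it upgrades `𝕃²` convergence to convergence in `V`
when the Laplacians are bounded. -/
lemma norm_sq_le_of_hasLap {ℓ : ℝ} (hℓ : 0 < ℓ) {u : V ℓ} {w : L2 ℓ} (h : HasLap (vel u) w) :
    ‖u‖ ^ 2 ≤ ‖vel u‖ * (‖vel u‖ + ‖w‖) := by
  have h1 := h.inner_eq hℓ (φ := u)
  simp only [real_inner_self_eq_norm_sq] at h1
  rw [norm_sq_V, ← h1]
  nlinarith [real_inner_le_norm (vel u) w]

/-- Along an ultrafilter every Fourier coefficient converges by compactness in `ℝ³`. Differences of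
two elements then tend to zero in `𝕃²` by `HasLap.tendsto_zero`, and in `V` by interpolation, so the
ultrafilter is Cauchy. -/
lemma isCompact_regBall {ℓ C : ℝ} (hℓ : 0 < ℓ) (hC : 0 ≤ C) : IsCompact (regBall ℓ C) := by
  refine isCompact_iff_totallyBounded_isComplete.2 ⟨?_, (isClosed_regBall ℓ C).isComplete⟩
  rw [totallyBounded_iff_ultrafilter]
  intro 𝒰 h𝒰
  have hX : ∀ᶠ u in (𝒰 : Filter (V ℓ)), u ∈ regBall ℓ C := h𝒰 (mem_principal_self _)
  rw [Metric.cauchy_iff]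
  refine ⟨𝒰.neBot, fun ε hε => ?_⟩
  have hlim : ∀ i, ∃ c, Tendsto (fun u => coef ℓ i (vel u)) 𝒰 (𝓝 c) := by
    intro i
    obtain ⟨c, -, hc⟩ := (isCompact_closedBall (0 : E3) (√(ℓ ^ 3) * C)).ultrafilter_le_nhds
      (𝒰.map fun u => coef ℓ i (vel u)) (by
        rw [le_principal_iff]
        change ∀ᶠ u in (𝒰 : Filter (V ℓ)), coef ℓ i (vel u) ∈ _
        filter_upwards [hX] with u hu
        rw [mem_closedBall_zero_iff]
        refine (norm_coef_le hℓ i _).trans ?_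
        gcongr
        exact (norm_vel_le u).trans hu.1)
    exact ⟨c, hc⟩
  choose c hc using hlim
  have ht : Tendsto (fun p : V ℓ × V ℓ => vel p.1 - vel p.2) ((𝒰 : Filter (V ℓ)) ×ˢ 𝒰) (𝓝 0) := by
    refine HasLap.tendsto_zero (C := 2 * C) hℓ
      (w := fun p => (stokes p.1 : L2 ℓ) - stokes p.2) ?_ (fun i => ?_)
    · filter_upwards [hX.prod_mk hX] with p hp
      refine ⟨(hasLap_stokes hℓ (inDomA_of_mem_regBall hℓ hp.1)).sub
        (hasLap_stokes hℓ (inDomA_of_mem_regBall hℓ hp.2)), ?_, ?_⟩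
      · have h1 := (norm_vel_le p.1).trans hp.1.1
        have h2 := (norm_vel_le p.2).trans hp.2.1
        linarith [norm_sub_le (vel p.1) (vel p.2)]
      · have h1 := norm_stokes_le hℓ hC hp.1
        have h2 := norm_stokes_le hℓ hC hp.2
        linarith [norm_sub_le (stokes p.1 : L2 ℓ) (stokes p.2)]
    · simp_rw [map_sub]
      simpa using ((hc i).comp tendsto_fst).sub ((hc i).comp tendsto_snd)
  have ht2 := (tendsto_zero_iff_norm_tendsto_zero.1 ht).mul_const (4 * C)
  rw [zero_mul] at ht2
  have hev := ht2.eventually (gt_mem_nhds (by positivity : 0 < ε ^ 2))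
  have hev2 : ∀ᶠ p in (𝒰 : Filter (V ℓ)) ×ˢ 𝒰, dist p.1 p.2 < ε := by
    filter_upwards [hev, hX.prod_mk hX] with p h2 hp'
    have hL := (hasLap_stokes hℓ (inDomA_of_mem_regBall hℓ hp'.1)).sub
        (hasLap_stokes hℓ (inDomA_of_mem_regBall hℓ hp'.2))
    have h3 := norm_sq_le_of_hasLap hℓ (u := p.1 - p.2) hL
    have h4 := (norm_vel_le p.1).trans hp'.1.1
    have h5 := (norm_vel_le p.2).trans hp'.2.1
    have h6 := norm_stokes_le hℓ hC hp'.1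
    have h7 := norm_stokes_le hℓ hC hp'.2
    have h8 := norm_sub_le (vel p.1) (vel p.2)
    have h9 := norm_sub_le (stokes p.1 : L2 ℓ) (stokes p.2)
    have h10 : vel (p.1 - p.2) = vel p.1 - vel p.2 := rfl
    rw [h10] at h3
    rw [dist_eq_norm]
    refine abs_lt_of_sq_lt_sq' (h3.trans_lt (lt_of_le_of_lt ?_ h2)) hε.le |>.2
    gcongr
    linarith
  obtain ⟨t, ht, ht'⟩ := eventually_prod_self_iff (r := fun x y => dist x y < ε) |>.1 hev2
  exact ⟨t, ht, fun x hx y hy => ht' x hx y hy⟩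

end BFEuler

end

noncomputable section
namespace BFEuler
open Set Filter Topology

/-! ### The weak form of one step of the scheme -/

lemma EssBdd.mono {ℓ M M' : ℝ} {f : L2 ℓ} (h : EssBdd f M) (hM : M ≤ M') : EssBdd f M' := by
  filter_upwards [h] with x hx
  exact hx.trans hM

/-- The residual of one implicit Euler step with data `f`, tested with `φ`. -/
def weakForm {ℓ : ℝ} (h ν a α : ℝ) (f : H ℓ) (u φ : V ℓ) : ℝ :=
  ⟪vel u - f, vel φ⟫_ℝ +
    h * (ν * ∑ j, ⟪pd φ j, pd u j⟫_ℝ + trilinear u u φ + a * forchheimer α u φ)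

lemma weakForm_eq {ℓ M h ν a α : ℝ} (hα : 0 ≤ 2 * α) (f : H ℓ) {u : V ℓ}
    (hu : EssBdd (vel u) M) (φ : V ℓ) : weakForm h ν a α f u φ =
      ⟪vel u - f, vel φ⟫_ℝ + h * (ν * ∑ j, ⟪pd φ j, pd u j⟫_ℝ + ⟪adv hu u, vel φ⟫_ℝ +
        a * ⟪drag hα hu, vel φ⟫_ℝ) := by
  rw [weakForm, trilinear_eq_inner_adv hu, forchheimer_eq_inner hα hu]

/-- For bounded `u` the convection and drag are fields in `𝕃²`, which makes the residual a
continuous functional on all of `V`; testing can then be restricted to a dense set. -/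
lemma exists_weakForm_eq {ℓ M h ν a α : ℝ} (hα : 0 ≤ 2 * α) (f : H ℓ) {u : V ℓ}
    (hu : EssBdd (vel u) M) : ∃ L : V ℓ →L[ℝ] ℝ, ∀ φ, weakForm h ν a α f u φ = L φ := by
  refine ⟨(innerSL ℝ (vel u - f + h • adv hu u + (h * a) • drag hα hu)).comp (velL ℓ) +
    (h * ν) • ∑ j, (innerSL ℝ (pd u j)).comp (pdL ℓ j), fun φ => ?_⟩
  rw [weakForm_eq hα f hu]
  simp only [add_apply, smul_apply, sum_apply, ContinuousLinearMap.comp_apply,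
    innerSL_apply_apply, velL_apply, pdL_apply, inner_add_left, real_inner_smul_left, smul_eq_mul,
    fun j => real_inner_comm (pd φ j) (pd u j)]
  ring

lemma tendsto_forchheimer {ι : Type*} {F : Filter ι} {ℓ M α : ℝ} (hα : 1 < 2 * α)
    {u : ι → V ℓ} {u₀ : V ℓ} (hu : Tendsto u F (𝓝 u₀)) (hb : ∀ n, EssBdd (vel (u n)) M)
    (hb₀ : EssBdd (vel u₀) M) (φ : V ℓ) :
    Tendsto (fun n => forchheimer α (u n) φ) F (𝓝 (forchheimer α u₀ φ)) := by
  have hα0 : 0 ≤ 2 * α := by linarith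
  simp_rw [fun n => forchheimer_eq_inner hα0 (hb n) φ, forchheimer_eq_inner hα0 hb₀ φ]
  exact (tendsto_drag hα hα0 (((velL ℓ).continuous.tendsto u₀).comp hu) hb hb₀).inner
    tendsto_const_nhds

lemma tendsto_weakForm {ι : Type*} {F : Filter ι} {ℓ M M' h ν a α : ℝ} (hα : 1 < 2 * α)
    {f : ι → H ℓ} {f₀ : H ℓ} (hf : Tendsto f F (𝓝 f₀))
    {u : ι → V ℓ} {u₀ : V ℓ} (hu : Tendsto u F (𝓝 u₀)) (hb : ∀ n, EssBdd (vel (u n)) M)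
    (hb₀ : EssBdd (vel u₀) M) {φ : V ℓ} (hφ : EssBdd (vel φ) M') :
    Tendsto (fun n => weakForm h ν a α (f n) (u n) φ) F (𝓝 (weakForm h ν a α f₀ u₀ φ)) := by
  have h1 : Tendsto (fun n => vel (u n)) F (𝓝 (vel u₀)) :=
    ((velL ℓ).continuous.tendsto u₀).comp hu
  have h2 : Tendsto (fun n => (f n : L2 ℓ)) F (𝓝 f₀) :=
    (continuous_subtype_val.tendsto f₀).comp hf
  have h3 : ∀ j, Tendsto (fun n => pd (u n) j) F (𝓝 (pd u₀ j)) := fun j =>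
    ((pdL ℓ j).continuous.tendsto u₀).comp hu
  refine ((h1.sub h2).inner tendsto_const_nhds).add (Tendsto.const_mul h (((Tendsto.const_mul ν
    (tendsto_finsetSum _ fun j _ => tendsto_const_nhds.inner (h3 j))).add
    (tendsto_trilinear hu hφ)).add (Tendsto.const_mul a (tendsto_forchheimer hα hu hb hb₀ φ))))

/-! ### Galerkin spaces -/

/-- The space of divergence-free trigonometric polynomials with modes in `s`. -/
def galerkin (ℓ : ℝ) (s : Finset Idx) : Submodule ℝ (V ℓ) :=
  (s.sup fun i => LinearMap.range (mode ℓ i : E3 →ₗ[ℝ] L2 ℓ)).comap (velL ℓ : V ℓ →ₗ[ℝ] L2 ℓ)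

lemma finiteDimensional_galerkin {ℓ : ℝ} (hℓ : 0 < ℓ) (s : Finset Idx) :
    FiniteDimensional ℝ (galerkin ℓ s) := by
  let f : galerkin ℓ s →ₗ[ℝ] (s.sup fun i => LinearMap.range (mode ℓ i : E3 →ₗ[ℝ] L2 ℓ) :) :=
    ((velL ℓ : V ℓ →ₗ[ℝ] L2 ℓ).comp (galerkin ℓ s).subtype).codRestrict _ fun u => u.2
  refine Module.Finite.of_injective f fun u v huv => ?_
  exact Subtype.ext (ext_vel hℓ (congrArg Subtype.val huv))

lemma mem_galerkin {ℓ : ℝ} {s : Finset Idx} {u : V ℓ} :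
    u ∈ galerkin ℓ s ↔ ∃ c : Idx → E3, vel u = ∑ i ∈ s, mode ℓ i (c i) := by
  rw [galerkin, Submodule.mem_comap, Finset.sup_eq_iSup,
    Submodule.mem_iSup_finset_iff_exists_sum]
  constructor
  · rintro ⟨μ, hμ⟩
    choose c hc using fun i => (μ i).2
    refine ⟨c, hμ.symm.trans (Finset.sum_congr rfl fun i _ => (hc i).symm)⟩
  · rintro ⟨c, hc⟩
    exact ⟨fun i => ⟨mode ℓ i (c i), c i, rfl⟩, hc.symm⟩

lemma trunc_mem_galerkin {ℓ : ℝ} (hℓ : 0 < ℓ) {s t : Finset Idx} (hst : s ⊆ t) (f : H ℓ) :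
    trunc hℓ s f ∈ galerkin ℓ t := by
  have h : galerkin ℓ s ≤ galerkin ℓ t := Submodule.comap_mono (Finset.sup_mono hst)
  refine h (mem_galerkin.2 ⟨fun i => (ℓ ^ 3)⁻¹ • coef ℓ i f, ?_⟩)
  simp_rw [vel_trunc, map_smul]

/-- Each mode is an eigenvector of `-Δ`, so the Galerkin space is invariant and `-Δu` is itself an
admissible test field. -/
lemma exists_hasLap_galerkin {ℓ : ℝ} (hℓ : 0 < ℓ) {s : Finset Idx} {u : V ℓ}
    (hu : u ∈ galerkin ℓ s) : ∃ w ∈ galerkin ℓ s, HasLap (vel u) (vel w) ∧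
      ‖vel w‖ ≤ (∑ j ∈ s, lapSymbol ℓ j) * ‖vel u‖ := by
  obtain ⟨c, hc⟩ := mem_galerkin.1 hu
  have hL : HasLap (vel u) (∑ i ∈ s, mode ℓ i (lapSymbol ℓ i • c i)) := by
    rw [hc]
    exact HasLap.sum s fun i => hasLap_mode hℓ i (c i)
  have hd : ∀ j, IsWeakDeriv ℓ j (∑ i ∈ s, mode ℓ i (lapSymbol ℓ i • c i))
      (∑ i ∈ s, freq ℓ j i • mode ℓ i.flip (lapSymbol ℓ i • c i)) := fun j =>
    IsWeakDeriv.sum s fun i _ => isWeakDeriv_mode hℓ j i _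
  have hΛ : 0 ≤ ∑ j ∈ s, lapSymbol ℓ j := Finset.sum_nonneg fun i _ => lapSymbol_nonneg ℓ i
  refine ⟨mkV _ _ (hL.mem_H hℓ (vel_mem_H u)) hd, mem_galerkin.2 ⟨_, rfl⟩, hL, ?_⟩
  change ‖∑ i ∈ s, mode ℓ i (lapSymbol ℓ i • c i)‖ ≤ _
  have h1 := hasSum_norm_sq_coef hℓ (∑ i ∈ s, mode ℓ i (lapSymbol ℓ i • c i))
  have h2 := (hasSum_norm_sq_coef hℓ (vel u)).mul_left ((∑ j ∈ s, lapSymbol ℓ j) ^ 2)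
  have h3 := hasSum_le (fun i => ?_) h1 h2
  · refine abs_le_of_sq_le_sq' ?_ (by positivity) |>.2
    rw [mul_pow]
    exact le_of_mul_le_mul_left (h3.trans (by linarith)) (by positivity : 0 < ℓ ^ 3)
  · rw [hL i, norm_smul, mul_pow, Real.norm_eq_abs, sq_abs]
    by_cases h0 : coef ℓ i (vel u) = 0
    · simp [h0]
    · rw [hc, map_sum] at h0
      -- By redundancy of the system, `u` may have nonzero coefficients at indices outside `s`; but
      -- such an index must share its symbol with some mode of `s`.
      obtain ⟨j, hj, hj0⟩ := Finset.exists_ne_zero_of_sum_ne_zero h0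
      have h4 := hasLap_mode hℓ j (c j) i
      rw [map_smul, map_smul] at h4
      have h5 : lapSymbol ℓ j = lapSymbol ℓ i := smul_left_injective ℝ hj0 h4
      gcongr
      · exact lapSymbol_nonneg ℓ i
      · rw [← h5]
        exact Finset.single_le_sum (fun i _ => lapSymbol_nonneg ℓ i) hj

lemma exists_essBdd_galerkin {ℓ : ℝ} (hℓ : 0 < ℓ) (s : Finset Idx) : ∃ K : ℝ, 0 ≤ K ∧
    ∀ u ∈ galerkin ℓ s, EssBdd (vel u) (K * ‖u‖) := by
  obtain ⟨C, hC0, hC⟩ := exists_sum_coef_le hℓ one_pos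
  have hΛ : 0 ≤ ∑ j ∈ s, lapSymbol ℓ j := Finset.sum_nonneg fun i _ => lapSymbol_nonneg ℓ i
  refine ⟨∑ j ∈ s, lapSymbol ℓ j + C, by positivity, fun u hu => ?_⟩
  obtain ⟨w, -, hL, hw⟩ := exists_hasLap_galerkin hℓ hu
  refine (HasLap.essBdd hℓ hC (f := toH ℓ u) hL).mono ?_
  rw [coe_toH, one_mul, add_mul]
  have := norm_vel_le u
  exact add_le_add (hw.trans (by gcongr)) (by gcongr)

/-- The convection cancels and the drag is nonnegative, so only the viscous and mass terms remain
against the data. -/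
lemma weakForm_self_ge {ℓ M h ν a α : ℝ} (hℓ : 0 < ℓ) (hα : 0 ≤ 2 * α) (hh : 0 ≤ h)
    (ha : 0 ≤ a) (f : H ℓ) {u : V ℓ} (hu : EssBdd (vel u) M) :
    min 1 (h * ν) * ‖u‖ ^ 2 - ‖f‖ * ‖u‖ ≤ weakForm h ν a α f u u := by
  rw [weakForm, trilinear_self hℓ hu, forchheimer_eq_inner hα hu, norm_sq_V, inner_sub_left,
    real_inner_self_eq_norm_sq]
  simp only [real_inner_self_eq_norm_sq]
  have h1 := inner_drag_self_nonneg hα hu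
  have h2 : ⟪(f : L2 ℓ), vel u⟫_ℝ ≤ ‖f‖ * ‖u‖ :=
    (real_inner_le_norm _ _).trans (mul_le_mul_of_nonneg_left (norm_vel_le u) (norm_nonneg _))
  have h3 : 0 ≤ ∑ j, ‖pd u j‖ ^ 2 := Finset.sum_nonneg fun _ _ => sq_nonneg _
  have h4 := mul_le_mul_of_nonneg_right (min_le_left 1 (h * ν)) (sq_nonneg ‖vel u‖)
  have h5 := mul_le_mul_of_nonneg_right (min_le_right 1 (h * ν)) h3
  have h6 : 0 ≤ h * (a * ⟪drag hα hu, vel u⟫_ℝ) := by positivity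
  nlinarith

/-- On `S` the functional `A u` is represented by a vector through an orthonormal basis, and a zero
of this vector field is sought. It lies in the ball of radius `R`, since `A u u > 0` beyond it. -/
lemma exists_zero_of_coercive_on {E : Type*} [NormedAddCommGroup E] [InnerProductSpace ℝ E]
    (S : Submodule ℝ E) [FiniteDimensional ℝ S] {A : E → E → ℝ} {R : ℝ} (hR : 0 < R)
    (hlin : ∀ u ∈ S, ∃ L : E →L[ℝ] ℝ, ∀ φ, A u φ = L φ)
    (hcont : ∀ φ ∈ S, ∀ (x : ℕ → E) (x₀ : E), (∀ n, x n ∈ S) → x₀ ∈ S → Tendsto x atTop (𝓝 x₀) →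
      Tendsto (fun n => A (x n) φ) atTop (𝓝 (A x₀ φ)))
    (hpos : ∀ u ∈ S, R ≤ ‖u‖ → 0 < A u u) :
    ∃ u ∈ S, ‖u‖ ≤ R ∧ ∀ φ ∈ S, A u φ = 0 := by
  let b := stdOrthonormalBasis ℝ S
  let Φ : S → S := fun u => ∑ i, A u (b i) • b i
  have hΦ : ∀ u φ : S, A u φ = ⟪Φ u, φ⟫_ℝ := by
    intro u φ
    obtain ⟨L, hL⟩ := hlin u u.2
    have h1 : (φ : E) = ∑ i, ⟪b i, φ⟫_ℝ • (b i : E) := by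
      have := congrArg Subtype.val (b.sum_repr' φ)
      simpa using this.symm
    rw [sum_inner, hL, h1, map_sum]
    refine Finset.sum_congr rfl fun i _ => ?_
    rw [map_smul, real_inner_smul_left, hL, smul_eq_mul, mul_comm]
  have hc : Continuous Φ := by
    refine continuous_finsetSum _ fun i _ => Continuous.fun_smul ?_ continuous_const
    exact continuous_iff_seqContinuous.2 fun x x₀ hx => hcont _ (b i).2 _ _ (fun n => (x n).2) x₀.2
      ((continuous_subtype_val.tendsto x₀).comp hx)
  obtain ⟨x, hx⟩ := exists_zero_of_coercive hc hR fun x hx => by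
    rw [← hΦ]
    exact hpos x x.2 hx
  refine ⟨x, x.2, ?_, fun φ hφ => ?_⟩
  · by_contra hlt
    have := hpos x x.2 (not_le.1 hlt).le
    rw [hΦ, hx, inner_zero_left] at this
    exact this.false
  · have := hΦ x ⟨φ, hφ⟩
    rwa [hx, inner_zero_left] at this

lemma exists_galerkin_solution {ℓ h ν a α : ℝ} (hℓ : 0 < ℓ) (hα : 1 < 2 * α) (hh : 0 < h)
    (hν : 0 < ν) (ha : 0 < a) (f : H ℓ) (s : Finset Idx) :
    ∃ u ∈ galerkin ℓ s, ‖u‖ ≤ ‖f‖ / min 1 (h * ν) + 1 ∧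
      ∀ φ ∈ galerkin ℓ s, weakForm h ν a α f u φ = 0 := by
  have hα0 : 0 ≤ 2 * α := by linarith
  have := finiteDimensional_galerkin hℓ s
  obtain ⟨K, hK, hb⟩ := exists_essBdd_galerkin hℓ s
  have hm : 0 < min 1 (h * ν) := lt_min one_pos (by positivity)
  refine exists_zero_of_coercive_on (galerkin ℓ s) (A := weakForm h ν a α f)
    (R := ‖f‖ / min 1 (h * ν) + 1) (by positivity)
    (fun u hu => exists_weakForm_eq hα0 f (hb u hu)) (fun φ hφ x x₀ hxs hx₀s hx => ?_)
    (fun x hxs hx => ?_)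
  · obtain ⟨R, hR⟩ := hx.norm.bddAbove_range
    have hR' : ∀ n, ‖x n‖ ≤ R := fun n => hR ⟨n, rfl⟩
    have hx0 : ‖x₀‖ ≤ R := le_of_tendsto' hx.norm hR'
    exact tendsto_weakForm hα tendsto_const_nhds hx
      (fun n => (hb _ (hxs n)).mono (mul_le_mul_of_nonneg_left (hR' n) hK))
      ((hb _ hx₀s).mono (mul_le_mul_of_nonneg_left hx0 hK)) (hb _ hφ)
  · refine lt_of_lt_of_le ?_ (weakForm_self_ge hℓ hα0 hh.le ha.le f (hb x hxs))
    have h1 : ‖f‖ < min 1 (h * ν) * ‖x‖ := by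
      rw [← div_lt_iff₀' hm]
      linarith
    have h2 : 0 < ‖x‖ := lt_of_lt_of_le (by positivity) hx
    nlinarith

end BFEuler

end

noncomputable section
namespace BFEuler
open Set Filter Topology

/-! ### Solvability of one step of the scheme -/

/-- The equation is tested with `w = -Δu`. The pairing with `u` and the drag term are nonnegative;
the convection is at most `(δ‖w‖ + CR)R‖w‖`, and `δR ≤ ν/2` lets half the viscosity absorb it. A
bound on `‖u‖` in `V` is already known, so no relation between `ν` and `a` is required. -/
lemma norm_lap_le {ℓ h ν a α δ C R : ℝ} (hℓ : 0 < ℓ) (hα : 1 < 2 * α) (hh : 0 < h) (hν : 0 < ν)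
    (ha : 0 < a) (hδ : 0 ≤ δ) (hC0 : 0 ≤ C) (hδR : δ * R ≤ ν / 2)
    (hC : ∀ f w : L2 ℓ, HasLap f w → ∀ s : Finset Idx,
      ∑ i ∈ s, ‖(ℓ ^ 3)⁻¹ • coef ℓ i f‖ ≤ δ * ‖w‖ + C * ‖f‖)
    {f : H ℓ} {u w : V ℓ} (hR : ‖u‖ ≤ R) (hL : HasLap (vel u) (vel w))
    (h0 : weakForm h ν a α f u w = 0) :
    ‖vel w‖ ≤ 2 * (‖f‖ + h * C * R ^ 2) / (h * ν) := by
  have hα0 : 0 ≤ 2 * α := by linarith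
  have hu : EssBdd (vel u) (δ * ‖vel w‖ + C * ‖vel u‖) := HasLap.essBdd hℓ hC (f := toH ℓ u) hL
  have hR0 : 0 ≤ R := (norm_nonneg _).trans hR
  have h1 := hL.inner_eq hℓ (φ := w)
  have h2 := hL.inner_eq hℓ (φ := u)
  have h3 := HasLap.integral_le_inner_drag hℓ hα hα0 (w := toH ℓ w) hL
    (fun s => HasLap.essBdd_trunc hℓ hC (f := toH ℓ u) hL s) hu
  have h4 : 0 ≤ ⟪drag hα0 hu, vel w⟫_ℝ :=
    (integral_nonneg fun x => mul_nonneg (by positivity) (gradSq_nonneg _ _)).trans h3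
  have h5 : √(∑ j, ‖pd u j‖ ^ 2) ≤ R := by
    refine Real.sqrt_le_iff.2 ⟨hR0, ?_⟩
    have := pow_le_pow_left₀ (norm_nonneg _) hR 2
    rw [norm_sq_V] at this
    nlinarith [sq_nonneg ‖vel u‖]
  have h6 : ‖adv hu u‖ ≤ (δ * ‖vel w‖ + C * R) * R := by
    refine (norm_adv_le (by positivity) hu).trans ?_
    have := (norm_vel_le u).trans hR
    gcongr
  have h7 : -⟪adv hu u, vel w⟫_ℝ ≤ (δ * ‖vel w‖ + C * R) * R * ‖vel w‖ :=
    (neg_le_abs _).trans ((abs_real_inner_le_norm _ _).trans (by gcongr))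
  have h8 : ⟪(f : L2 ℓ), vel w⟫_ℝ ≤ ‖f‖ * ‖vel w‖ := real_inner_le_norm _ _
  have h9 : 0 ≤ ⟪vel u, vel w⟫_ℝ := by
    rw [h2]
    exact Finset.sum_nonneg fun j _ => by
      rw [real_inner_self_eq_norm_sq]; positivity
  rw [weakForm_eq hα0 f hu, ← h1, real_inner_self_eq_norm_sq, inner_sub_left] at h0
  have h10 : h * (δ * R) * ‖vel w‖ ^ 2 ≤ h * (ν / 2) * ‖vel w‖ ^ 2 := by gcongr
  have h11 : 0 ≤ h * (a * ⟪drag hα0 hu, vel w⟫_ℝ) := by positivity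
  have h12 := mul_le_mul_of_nonneg_left h7 hh.le
  have h13 : h * ν * ‖vel w‖ ^ 2 ≤ 2 * (‖f‖ + h * C * R ^ 2) * ‖vel w‖ := by nlinarith
  rw [le_div_iff₀ (by positivity)]
  rcases (norm_nonneg (vel w)).eq_or_lt with hw | hw
  · rw [← hw, zero_mul]; positivity
  · exact le_of_mul_le_mul_right (by nlinarith) hw

lemma exists_essBdd_regBall {ℓ : ℝ} (hℓ : 0 < ℓ) {C : ℝ} (hC : 0 ≤ C) :
    ∃ M : ℝ, ∀ u ∈ regBall ℓ C, EssBdd (vel u) M := by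
  obtain ⟨K, hK0, hK⟩ := exists_sum_coef_le hℓ one_pos
  refine ⟨1 * C + K * C, fun u hu => ?_⟩
  refine (HasLap.essBdd hℓ hK (f := toH ℓ u)
    (hasLap_stokes hℓ (inDomA_of_mem_regBall hℓ hu))).mono ?_
  have h1 := norm_stokes_le hℓ hC hu
  have h2 := (norm_vel_le u).trans hu.1
  rw [coe_toH]
  gcongr

lemma essBdd_vel_trunc {ℓ : ℝ} (hℓ : 0 < ℓ) (s : Finset Idx) (f : H ℓ) :
    ∃ M : ℝ, EssBdd (vel (trunc hℓ s f)) M := by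
  rw [vel_trunc]
  exact ⟨_, essBdd_sum_mode ℓ s _ _ le_rfl⟩

lemma weakForm_eq_zero_of_trunc {ℓ M h ν a α : ℝ} (hℓ : 0 < ℓ) (hα : 1 < 2 * α) {f : H ℓ}
    {u : V ℓ} (hu : EssBdd (vel u) M)
    (h0 : ∀ (s : Finset Idx) (g : H ℓ), weakForm h ν a α f u (trunc hℓ s g) = 0) (φ : V ℓ) :
    weakForm h ν a α f u φ = 0 := by
  obtain ⟨L, hL⟩ := exists_weakForm_eq (h := h) (ν := ν) (a := a) (by linarith : 0 ≤ 2 * α) f hu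
  rw [hL]
  refine tendsto_nhds_unique ((L.continuous.tendsto φ).comp (tendsto_trunc hℓ φ)) ?_
  refine tendsto_const_nhds.congr fun s => ?_
  rw [Function.comp_apply, ← hL, h0]

/-- One step of the scheme is solvable, with bounds in `V ∩ ℍ²` depending on the data only through
its norm. -/
lemma exists_weak_solution {ℓ h ν a α : ℝ} (hℓ : 0 < ℓ) (hα : 1 < 2 * α) (hh : 0 < h)
    (hν : 0 < ν) (ha : 0 < a) {m : ℝ} (hm : 0 ≤ m) : ∃ C : ℝ, 0 ≤ C ∧ ∀ f : H ℓ, ‖f‖ ≤ m →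
      ∃ u ∈ regBall ℓ C, ∀ φ, weakForm h ν a α f u φ = 0 := by
  set R : ℝ := m / min 1 (h * ν) + 1 with hR
  have hmin : 0 < min 1 (h * ν) := lt_min one_pos (by positivity)
  have hR0 : 0 < R := by positivity
  -- With `δ = ν/(2R)`, the quadratic convection term is absorbed by half the viscosity for every
  -- field of norm at most `R`.
  obtain ⟨K, hK0, hK⟩ := exists_sum_coef_le hℓ (by positivity : 0 < ν / (2 * R))
  set C : ℝ := max R (2 * (m + h * K * R ^ 2) / (h * ν)) with hC
  have hC0 : 0 ≤ C := hR0.le.trans (le_max_left _ _)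
  refine ⟨C, hC0, fun f hf => ?_⟩
  have hgal : ∀ s : Finset Idx, ∃ u ∈ regBall ℓ C, ∀ φ ∈ galerkin ℓ s,
      weakForm h ν a α f u φ = 0 := by
    intro s
    obtain ⟨u, hus, huR, hu⟩ := exists_galerkin_solution hℓ hα hh hν ha f s
    obtain ⟨w, hws, hL, -⟩ := exists_hasLap_galerkin hℓ hus
    have huR' : ‖u‖ ≤ R := huR.trans (by rw [hR]; gcongr)
    have hw := norm_lap_le hℓ hα hh hν ha (by positivity) hK0
      (by field_simp; exact le_rfl) hK huR' hL (hu w hws)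
    refine ⟨u, mem_regBall hℓ (huR'.trans (le_max_left _ _)) (hw.trans ?_) hL, hu⟩
    refine le_trans ?_ (le_max_right _ _)
    gcongr
  choose u huX hu using hgal
  -- The Galerkin solutions converge in `V` along an ultrafilter finer than inclusion of finite mode
  -- sets; each fixed trigonometric test field is eventually admissible.
  obtain ⟨u₀, hu₀, hlim⟩ := (isCompact_regBall hℓ hC0).ultrafilter_le_nhds
    ((Ultrafilter.of (atTop : Filter (Finset Idx))).map u) (by
      rw [le_principal_iff, Ultrafilter.mem_coe, Ultrafilter.mem_map]
      exact mem_of_superset univ_mem fun s _ => huX s)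
  have hlim' : Tendsto u (Ultrafilter.of (atTop : Filter (Finset Idx))) (𝓝 u₀) := hlim
  obtain ⟨M, hM⟩ := exists_essBdd_regBall hℓ hC0
  refine ⟨u₀, hu₀, weakForm_eq_zero_of_trunc hℓ hα (hM u₀ hu₀) fun s g => ?_⟩
  obtain ⟨M', hM'⟩ := essBdd_vel_trunc hℓ s g
  have ht := tendsto_weakForm (h := h) (ν := ν) (a := a) hα (tendsto_const_nhds (x := f)) hlim'
    (fun s => hM _ (huX s)) (hM u₀ hu₀) hM'
  refine tendsto_nhds_unique ht (tendsto_const_nhds.congr' ?_)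
  refine (Ultrafilter.of_le (atTop : Filter (Finset Idx))) ?_
  filter_upwards [eventually_ge_atTop s] with t hst
  exact (hu t _ (trunc_mem_galerkin hℓ hst g)).symm

/-! ### Measurable selection -/

/-- Code the compact space by the Cantor set and take the smallest code of a solution. The minimum
exists because the fibres are compact, and its sublevel sets are, up to the default case,
projections of closed sets along a compact factor, hence closed. -/
lemma exists_measurable_selection {Y X : Type*} [TopologicalSpace Y] [MeasurableSpace Y]
    [OpensMeasurableSpace Y] [MetricSpace X] [CompactSpace X] [Nonempty X] [MeasurableSpace X]
    [BorelSpace X] {R : Set (Y × X)} (hR : IsClosed R) :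
    ∃ g : Y → X, Measurable g ∧ ∀ y, (∃ x, (y, x) ∈ R) → (y, g y) ∈ R := by
  classical
  obtain ⟨π, hπ, hπs⟩ := exists_nat_bool_continuous_surjective_of_compact X
  let q : cantorSet → X := π ∘ cantorSetHomeomorphNatToBool
  have hq : Continuous q := hπ.comp cantorSetHomeomorphNatToBool.continuous
  have hqs : Function.Surjective q := hπs.comp cantorSetHomeomorphNatToBool.surjective
  have : CompactSpace cantorSet := isCompact_iff_compactSpace.1 isCompact_cantorSet
  let D : ℝ → Set Y := fun t => Prod.fst '' {p : Y × cantorSet | (p.1, q p.2) ∈ R ∧ (p.2 : ℝ) ≤ t}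
  have hD : ∀ t, IsClosed (D t) := fun t => by
    refine isClosedMap_fst_of_compactSpace _ (IsClosed.inter ?_ ?_)
    · exact hR.preimage (continuous_fst.prodMk (hq.comp continuous_snd))
    · exact isClosed_le (continuous_subtype_val.comp continuous_snd) continuous_const
  let S : Y → Set ℝ := fun y => Subtype.val '' {c : cantorSet | (y, q c) ∈ R}
  have hSc : ∀ y, IsCompact (S y) := fun y => by
    refine IsCompact.image (IsClosed.isCompact ?_) continuous_subtype_val
    exact hR.preimage (continuous_const.prodMk hq)
  have hS01 : ∀ y, S y ⊆ cantorSet := by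
    rintro y _ ⟨c, -, rfl⟩
    exact c.2
  let σ : Y → ℝ := fun y => if (S y).Nonempty then sInf (S y) else 0
  have hσS : ∀ y, (S y).Nonempty → σ y ∈ S y := fun y hy => by
    simp only [σ, if_pos hy]
    exact (hSc y).sInf_mem hy
  have hσm : ∀ y, σ y ∈ cantorSet := fun y => by
    by_cases hy : (S y).Nonempty
    · exact hS01 y (hσS y hy)
    · simp only [σ, if_neg hy]
      exact zero_mem_cantorSet
  have hne : ∀ y, (S y).Nonempty ↔ y ∈ D 1 := by
    intro y
    constructor
    · rintro ⟨_, c, hc, rfl⟩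
      exact ⟨(y, c), ⟨hc, (cantorSet_subset_unitInterval c.2).2⟩, rfl⟩
    · rintro ⟨⟨y', c⟩, ⟨hc, -⟩, rfl⟩
      exact ⟨c, c, hc, rfl⟩
  have hmeas : Measurable σ := by
    refine measurable_of_Iic fun t => ?_
    -- Where there is no solution, `σ` is `0`, a point of the Cantor set; this accounts for the
    -- second set in the union.
    have : σ ⁻¹' Iic t = D t ∪ ((D 1)ᶜ ∩ {_y : Y | 0 ≤ t}) := by
      ext y
      simp only [mem_preimage, mem_Iic, mem_union, mem_inter_iff, mem_compl_iff, ← hne,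
        mem_ofPred_eq]
      by_cases hy : (S y).Nonempty
      · simp only [hy, not_true_eq_false, false_and, or_false]
        constructor
        · intro h
          obtain ⟨c, hc, hc'⟩ := hσS y hy
          exact ⟨(y, c), ⟨hc, hc'.trans_le h⟩, rfl⟩
        · rintro ⟨⟨y', c⟩, ⟨hc, hct⟩, rfl⟩
          simp only [σ, if_pos hy]
          exact (csInf_le (hSc _).bddBelow ⟨c, hc, rfl⟩).trans hct
      · have h2 : y ∉ D t := by
          rintro ⟨⟨y', c⟩, ⟨hc, hct⟩, rfl⟩
          exact hy ⟨c, c, hc, rfl⟩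
        simp [σ, hy, h2]
    rw [this]
    exact (hD t).measurableSet.union ((hD 1).measurableSet.compl.inter (MeasurableSet.const _))
  refine ⟨fun y => q ⟨σ y, hσm y⟩, hq.measurable.comp (hmeas.subtype_mk), fun y ⟨x, hx⟩ => ?_⟩
  obtain ⟨c, rfl⟩ := hqs x
  obtain ⟨c', hc', he⟩ := hσS y ⟨c, c, hx, rfl⟩
  have : c' = ⟨σ y, hσm y⟩ := Subtype.ext he
  change (y, q ⟨σ y, hσm y⟩) ∈ R
  rw [← this]
  exact hc'

end BFEuler

end

noncomputable section
namespace BFEuler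
open Set Filter Topology

/-! ### Existence of solutions of the scheme -/

instance (ℓ : ℝ) : SecondCountableTopology (V ℓ) := by
  have h2 : Fact ((2 : ℝ≥0∞) ≠ ⊤) := ⟨by simp⟩
  have h1 : SecondCountableTopology (PiLp 2 fun _ : Fin 3 => L2 ℓ) :=
    (PiLp.continuousLinearEquiv 2 ℝ fun _ : Fin 3 => L2 ℓ).toHomeomorph.secondCountableTopology
  have h : SecondCountableTopology (WithLp 2 (L2 ℓ × PiLp 2 fun _ : Fin 3 => L2 ℓ)) :=
    (WithLp.prodContinuousLinearEquiv 2 ℝ (L2 ℓ)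
      (PiLp 2 fun _ : Fin 3 => L2 ℓ)).toHomeomorph.secondCountableTopology
  exact TopologicalSpace.Subtype.secondCountableTopology _

lemma isClosed_weakForm_eq_zero {ℓ h ν a α C : ℝ} (hℓ : 0 < ℓ) (hα : 1 < 2 * α) (hC : 0 ≤ C) :
    IsClosed {p : H ℓ × regBall ℓ C | ∀ φ, weakForm h ν a α p.1 p.2 φ = 0} := by
  obtain ⟨M, hM⟩ := exists_essBdd_regBall hℓ hC
  refine IsSeqClosed.isClosed fun p p₀ hp hlim => ?_
  refine weakForm_eq_zero_of_trunc hℓ hα (hM _ p₀.2.2) fun s g => ?_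
  obtain ⟨M', hM'⟩ := essBdd_vel_trunc hℓ s g
  have ht := tendsto_weakForm (h := h) (ν := ν) (a := a) hα
    ((continuous_fst.tendsto p₀).comp hlim)
    (((continuous_subtype_val.comp continuous_snd).tendsto p₀).comp hlim)
    (fun n => hM _ (p n).2.2) (hM _ p₀.2.2) hM'
  refine tendsto_nhds_unique ht (tendsto_const_nhds.congr fun n => ?_)
  exact (hp n _).symm

/-- A solution operator for one step of the scheme that preserves measurability. -/
lemma exists_solution_operator {ℓ h ν a α : ℝ} (hℓ : 0 < ℓ) (hα : 1 < 2 * α) (hh : 0 < h)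
    (hν : 0 < ν) (ha : 0 < a) : ∃ Sol : H ℓ → V ℓ,
      (∀ f, InDomA (Sol f) ∧ ∀ φ, weakForm h ν a α f (Sol f) φ = 0) ∧
      ∀ {Ω : Type*} (m : MeasurableSpace Ω) {f : Ω → H ℓ}, StronglyMeasurable[m] f →
        StronglyMeasurable[m] fun ω => Sol (f ω) := by
  let _ : MeasurableSpace (H ℓ) := borel _
  have : BorelSpace (H ℓ) := ⟨rfl⟩
  let _ : MeasurableSpace (V ℓ) := borel _
  have : BorelSpace (V ℓ) := ⟨rfl⟩
  have hsel : ∀ n : ℕ, ∃ g : H ℓ → V ℓ, Measurable g ∧ ∀ f, ‖f‖ ≤ n →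
      InDomA (g f) ∧ ∀ φ, weakForm h ν a α f (g f) φ = 0 := by
    intro n
    obtain ⟨C, hC0, hC⟩ := exists_weak_solution hℓ hα hh hν ha (Nat.cast_nonneg n)
    have : CompactSpace (regBall ℓ C) := isCompact_iff_compactSpace.1 (isCompact_regBall hℓ hC0)
    obtain ⟨u, hu, -⟩ := hC 0 (by simp)
    have : Nonempty (regBall ℓ C) := ⟨⟨u, hu⟩⟩
    obtain ⟨g, hg, hg'⟩ := exists_measurable_selection
      (isClosed_weakForm_eq_zero (h := h) (ν := ν) (a := a) hℓ hα hC0)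
    refine ⟨fun f => g f, measurable_subtype_coe.comp hg, fun f hf => ?_⟩
    obtain ⟨u, hu, hu'⟩ := hC f hf
    exact ⟨inDomA_of_mem_regBall hℓ (g f).2, hg' f ⟨⟨u, hu⟩, hu'⟩⟩
  choose g hg hg' using hsel
  -- The compact set containing the solutions depends on the size of the data, so countably many
  -- selections, one per integer radius, are glued along `⌈‖f‖⌉₊`.
  have hmeas : Measurable fun f : H ℓ => g ⌈‖f‖⌉₊ f := by
    have h1 : Measurable fun p : H ℓ × ℕ => g p.2 p.1 := measurable_from_prod_countable_left hg
    exact h1.comp (measurable_id.prodMk (Nat.measurable_ceil.comp measurable_norm))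
  refine ⟨fun f => g ⌈‖f‖⌉₊ f, fun f => hg' _ f (Nat.le_ceil _), fun m f hf => ?_⟩
  exact (hmeas.comp hf.measurable).stronglyMeasurable

/-- The Lipschitz condition gives continuity only for operators into `H`; measurability in `V` is
recovered separately through Fourier truncation. -/
lemma ConditionG.continuous {K : Type*} [NormedAddCommGroup K] [InnerProductSpace ℝ K] {ℓ : ℝ}
    {G : V ℓ → K →L[ℝ] V ℓ} (hG : ConditionG G) : Continuous fun u => (toH ℓ).comp (G u) := by
  obtain ⟨Λ, hΛ, hL⟩ := hG.lipschitz
  suffices h : LipschitzWith (Real.toNNReal (√Λ * ‖toH ℓ‖)) fun u => (toH ℓ).comp (G u) from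
    h.continuous
  refine LipschitzWith.of_dist_le_mul fun u v => ?_
  rw [dist_eq_norm, dist_eq_norm, Real.coe_toNNReal _ (by positivity), mul_assoc]
  have h1 : ‖toH ℓ u - toH ℓ v‖ ≤ ‖toH ℓ‖ * ‖u - v‖ := by
    rw [← map_sub]
    exact (toH ℓ).le_opNorm _
  refine le_trans (abs_le_of_sq_le_sq' ?_ (by positivity) |>.2)
    (mul_le_mul_of_nonneg_left h1 (Real.sqrt_nonneg _))
  rw [mul_pow, Real.sq_sqrt hΛ.le]
  exact hL u v

lemma ConditionG.stronglyMeasurable {Ω K : Type*} {m : MeasurableSpace Ω} [NormedAddCommGroup K]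
    [InnerProductSpace ℝ K] {ℓ : ℝ} {G : V ℓ → K →L[ℝ] V ℓ} (hG : ConditionG G)
    {u : Ω → V ℓ} (hu : StronglyMeasurable[m] u) {x : Ω → K} (hx : StronglyMeasurable[m] x) :
    StronglyMeasurable[m] fun ω => toH ℓ (G (u ω) (x ω)) :=
  (isBoundedBilinearMap_apply (𝕜 := ℝ) (E := K) (F := H ℓ)).continuous.comp_stronglyMeasurable
    ((hG.continuous.comp_stronglyMeasurable hu).prodMk hx)

lemma grid_mono (T : ℝ≥0) (N : ℕ) : Monotone (grid T N) := fun j k hjk => by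
  unfold grid
  gcongr

lemma grid_le {T : ℝ≥0} {N k : ℕ} (hN : 1 ≤ N) (hk : k ≤ N) : grid T N k ≤ T := by
  refine (grid_mono T N hk).trans (le_of_eq ?_)
  have : (N : ℝ≥0) ≠ 0 := by
    exact_mod_cast (by omega : N ≠ 0)
  unfold grid
  field_simp

/-- The solution operator is iterated on the data `u^{k-1} + G(u^{k-1})ΔW`, and the scheme then
holds for every `ω`. Adaptedness follows by induction up to `k = N`, as far as the Wiener process is
adapted. -/
lemma exists_isEulerSolution {Ω K : Type*} [mΩ : MeasurableSpace Ω] (P : Measure Ω)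
    (ℱ : Filtration ℝ≥0 mΩ) [NormedAddCommGroup K] [InnerProductSpace ℝ K] [MeasurableSpace K]
    {ℓ : ℝ} (hℓ : 0 < ℓ) {T : ℝ≥0} (hT : 0 < T) {ν a α : ℝ} (hν : 0 < ν) (ha : 0 < a)
    (hα : 1 < 2 * α) {Q : K →L[ℝ] K} {W : ℝ≥0 → Ω → K} (hW : IsWiener P ℱ T Q W)
    {G : V ℓ → K →L[ℝ] V ℓ} (hG : ConditionG G) {u₀ : Ω → V ℓ}
    (hu₀ : StronglyMeasurable[ℱ 0] u₀) {N : ℕ} (hN : 1 ≤ N) :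
    ∃ u : ℕ → Ω → V ℓ, IsEulerSolution P ℱ T ν a α G W u₀ N u := by
  have hN0 : (0 : ℝ) < N := by exact_mod_cast hN
  have hh : (0 : ℝ) < T / N := div_pos (by exact_mod_cast hT) hN0
  obtain ⟨Sol, hSol, hmeas⟩ := exists_solution_operator hℓ hα hh hν ha
  let data : ℕ → V ℓ → Ω → H ℓ := fun k v ω =>
    toH ℓ v + toH ℓ (G v (W (grid T N (k + 1)) ω - W (grid T N k) ω))
  let u : ℕ → Ω → V ℓ := fun k => Nat.rec u₀ (fun k v ω => Sol (data k (v ω) ω)) k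
  have hu : ∀ k ω, u (k + 1) ω = Sol (data k (u k ω) ω) := fun k ω => rfl
  refine ⟨u, ?_, ?_, ?_, ?_⟩
  · intro k hk
    induction k with
    | zero => exact hu₀.mono (ℱ.mono zero_le)
    | succ k ih =>
      have hle := ℱ.mono (grid_mono T N k.le_succ)
      have h1 : StronglyMeasurable[ℱ (grid T N (k + 1))] (u k) := (ih (by omega)).mono hle
      have h2 : StronglyMeasurable[ℱ (grid T N (k + 1))] fun ω =>
          W (grid T N (k + 1)) ω - W (grid T N k) ω :=
        (hW.adapted _ (grid_le hN hk)).sub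
          ((hW.adapted _ (grid_le hN (by omega))).mono hle)
      exact hmeas _ (((toH ℓ).continuous.comp_stronglyMeasurable h1).add
        (hG.stronglyMeasurable h1 h2))
  · exact Eventually.of_forall fun ω => rfl
  · intro k hk
    obtain ⟨k, rfl⟩ : ∃ j, k = j + 1 := ⟨k - 1, by have := (Finset.mem_Icc.1 hk).1; omega⟩
    exact Eventually.of_forall fun ω => hu k ω ▸ (hSol _).1
  · intro k hk
    obtain ⟨k, rfl⟩ : ∃ j, k = j + 1 := ⟨k - 1, by have := (Finset.mem_Icc.1 hk).1; omega⟩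
    refine Eventually.of_forall fun ω φ => ?_
    obtain ⟨h1, h2⟩ := hSol (data k (u k ω) ω)
    have h3 := h2 φ
    have h4 := (hasLap_stokes hℓ h1).inner_eq hℓ (φ := φ)
    rw [← hu] at h1 h3 h4
    rw [weakForm, ← h4] at h3
    simp only [Nat.add_sub_cancel]
    have e1 : ⟪stokes (u (k + 1) ω), toH ℓ φ⟫_ℝ = ⟪vel φ, (stokes (u (k + 1) ω) : L2 ℓ)⟫_ℝ :=
      real_inner_comm _ _
    have e2 : ⟪vel (u (k + 1) ω) - (data k (u k ω) ω : L2 ℓ), vel φ⟫_ℝ =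
        ⟪toH ℓ (u (k + 1) ω) - toH ℓ (u k ω), toH ℓ φ⟫_ℝ -
        ⟪toH ℓ (G (u k ω) (W (grid T N (k + 1)) ω - W (grid T N k) ω)), toH ℓ φ⟫_ℝ := by
      rw [← inner_sub_left, sub_sub]
      rfl
    rw [e1]
    rw [e2] at h3
    linarith

end BFEuler

end

noncomputable section
namespace BFEuler
open Set Filter Topology

/-! ### The energy inequality for one step of the scheme -/

/-- The threshold `t₀` solves `ε t₀^{2α-2} = 1`: above it the higher power wins, below it `t²` is at
most `t₀²`. -/
lemma exists_sq_le_rpow {α ε : ℝ} (hα : 1 < α) (hε : 0 < ε) :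
    ∃ R : ℝ, 0 ≤ R ∧ ∀ t : ℝ, 0 ≤ t → t ^ (2 : ℝ) ≤ ε * t ^ (2 * α) + R := by
  set t₀ : ℝ := (ε⁻¹) ^ (2 * α - 2)⁻¹ with ht₀
  have ht₀0 : 0 ≤ t₀ := by positivity
  refine ⟨t₀ ^ (2 : ℝ), by positivity, fun t ht => ?_⟩
  have hp : 0 ≤ ε * t ^ (2 * α) := by positivity
  rcases le_total t t₀ with h | h
  · have := Real.rpow_le_rpow ht h (by norm_num : (0 : ℝ) ≤ 2)
    linarith
  · have h1 : ε⁻¹ ≤ t ^ (2 * α - 2) := by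
      have := Real.rpow_le_rpow ht₀0 h (by linarith : (0 : ℝ) ≤ 2 * α - 2)
      rwa [ht₀, ← Real.rpow_mul (by positivity), inv_mul_cancel₀ (by linarith), Real.rpow_one]
        at this
    have h2 : t ^ (2 * α) = t ^ (2 : ℝ) * t ^ (2 * α - 2) := by
      rw [← Real.rpow_add_of_nonneg ht (by norm_num) (by linarith)]
      congr 1; ring
    have h3 : 1 ≤ ε * t ^ (2 * α - 2) := by
      rwa [inv_le_iff_one_le_mul₀' hε] at h1
    have h4 : (0 : ℝ) ≤ t ^ (2 : ℝ) := by positivity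
    have h5 : (0 : ℝ) ≤ t₀ ^ (2 : ℝ) := by positivity
    rw [h2]
    linarith [mul_le_mul_of_nonneg_left h3 h4]

/-- The drag term and the viscosity control the convection term. -/
lemma exists_viscous_drag_ge {ν a α : ℝ} (ℓ : ℝ) (hν : 0 < ν) (ha : 0 < a) (hα : 1 ≤ α)
    (hα' : α = 1 → 1 < 4 * ν * a) : ∃ c : ℝ, 0 < c ∧ ∃ μ : ℝ, 0 ≤ μ ∧
    ∀ (u : V ℓ) (M : ℝ) (hu : EssBdd (vel u) M) (w : L2 ℓ),
      c * (‖w‖ ^ 2 + ∫ x, ‖vel u x‖ ^ (2 * α) * gradSq u x ∂boxMeasure ℓ) ≤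
        ν * ‖w‖ ^ 2 + ⟪adv hu u, w⟫_ℝ +
          a * ∫ x, ‖vel u x‖ ^ (2 * α) * gradSq u x ∂boxMeasure ℓ + μ * ∑ j, ‖pd u j‖ ^ 2 := by
  -- Young's inequality with a free parameter `η`, chosen differently in the two cases.
  have key : ∀ (u : V ℓ) (M : ℝ) (hu : EssBdd (vel u) M) (w : L2 ℓ) (η : ℝ), 0 < η →
      -(η * ‖w‖ ^ 2 + (4 * η)⁻¹ * ‖adv hu u‖ ^ 2) ≤ ⟪adv hu u, w⟫_ℝ := by
    intro u M hu w η hη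
    have h1 := neg_le_of_abs_le (abs_real_inner_le_norm (adv hu u) w)
    refine le_trans ?_ h1
    have h2 : (4 * η)⁻¹ * (‖adv hu u‖ - 2 * η * ‖w‖) ^ 2 =
        η * ‖w‖ ^ 2 + (4 * η)⁻¹ * ‖adv hu u‖ ^ 2 - ‖adv hu u‖ * ‖w‖ := by
      field_simp; ring
    have h3 : 0 ≤ (4 * η)⁻¹ * (‖adv hu u‖ - 2 * η * ‖w‖) ^ 2 := by positivity
    linarith
  rcases hα.eq_or_lt with h1 | h1
  · subst h1
    have h4 : 1 < 4 * ν * a := hα' rfl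
    -- The midpoint of `((4a)⁻¹, ν)`, an interval that is nonempty precisely because `4νa > 1`; then
    -- `η < ν` and `(4η)⁻¹ < a`.
    set η : ℝ := (ν + (4 * a)⁻¹) / 2 with hη
    have hη1 : (4 * a)⁻¹ < ν := by
      rw [inv_lt_iff_one_lt_mul₀ (by positivity)]; linarith
    have ha4 : 0 < (4 * a)⁻¹ := by positivity
    have hη0 : 0 < η := by positivity
    have hη2 : (4 * η)⁻¹ < a := by
      rw [inv_lt_iff_one_lt_mul₀ (by positivity)]
      have : 1 < 4 * a * η := by
        rw [← inv_lt_iff_one_lt_mul₀' (by positivity)]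
        rw [hη]; linarith
      linarith
    refine ⟨min (ν - η) (a - (4 * η)⁻¹), lt_min (by rw [hη]; linarith) (by linarith), 0, le_rfl,
      fun u M hu w => ?_⟩
    have h5 := key u M hu w η hη0
    have h6 := norm_adv_sq_le hu
    rw [mul_one]
    set D := ∫ x, ‖vel u x‖ ^ (2 : ℝ) * gradSq u x ∂boxMeasure ℓ with hD
    have hD0 : 0 ≤ D := (sq_nonneg _).trans h6
    have h7 : (4 * η)⁻¹ * ‖adv hu u‖ ^ 2 ≤ (4 * η)⁻¹ * D := by gcongr
    have h8 := mul_le_mul_of_nonneg_right (min_le_left (ν - η) (a - (4 * η)⁻¹)) (sq_nonneg ‖w‖)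
    have h9 := mul_le_mul_of_nonneg_right (min_le_right (ν - η) (a - (4 * η)⁻¹)) hD0
    linarith
  -- With `η = ν/2` the convection costs `(2ν)⁻¹∫|u|²|∇u|²`; taking `ε = νa` makes this at most half
  -- the drag plus the remainder `μ‖∇u‖²` with `μ = R/(2ν)`.
  · obtain ⟨R, hR0, hR⟩ := exists_sq_le_rpow h1 (by positivity : 0 < ν * a)
    refine ⟨min (ν / 2) (a / 2), lt_min (by positivity) (by positivity), (2 * ν)⁻¹ * R,
      by positivity, fun u M hu w => ?_⟩
    have h5 := key u M hu w (ν / 2) (by positivity)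
    have hi := integrable_pow_mul_gradSq hu (by linarith : 0 ≤ 2 * α)
    have h6 : ‖adv hu u‖ ^ 2 ≤ ν * a * ∫ x, ‖vel u x‖ ^ (2 * α) * gradSq u x ∂boxMeasure ℓ +
        R * ∑ j, ‖pd u j‖ ^ 2 := by
      refine (norm_adv_sq_le hu).trans ?_
      rw [← integral_gradSq, ← integral_const_mul, ← integral_const_mul,
        ← integral_add (hi.const_mul _) ((integrable_gradSq u).const_mul _)]
      refine integral_mono (integrable_pow_mul_gradSq hu (by norm_num))
        ((hi.const_mul _).add ((integrable_gradSq u).const_mul _)) fun x => ?_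
      have := mul_le_mul_of_nonneg_right (hR _ (norm_nonneg (vel u x))) (gradSq_nonneg u x)
      beta_reduce
      linarith
    set D := ∫ x, ‖vel u x‖ ^ (2 * α) * gradSq u x ∂boxMeasure ℓ with hD
    have hD0 : 0 ≤ D := integral_nonneg fun x => mul_nonneg (by positivity) (gradSq_nonneg _ _)
    have h7 : (2 * ν)⁻¹ * ‖adv hu u‖ ^ 2 ≤ (2 * ν)⁻¹ * (ν * a * D + R * ∑ j, ‖pd u j‖ ^ 2) := by
      gcongr
    have h7' : (2 * ν)⁻¹ * (ν * a * D + R * ∑ j, ‖pd u j‖ ^ 2) =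
        a / 2 * D + (2 * ν)⁻¹ * R * ∑ j, ‖pd u j‖ ^ 2 := by
      field_simp
    have h7'' : (4 * (ν / 2))⁻¹ = (2 * ν)⁻¹ := by congr 1; ring
    rw [h7''] at h5
    have h8 := mul_le_mul_of_nonneg_right (min_le_left (ν / 2) (a / 2)) (sq_nonneg ‖w‖)
    have h9 := mul_le_mul_of_nonneg_right (min_le_right (ν / 2) (a / 2)) hD0
    linarith

lemma dissipation_eq {ℓ M α : ℝ} (hα : 0 ≤ α) {u : V ℓ} (hu : EssBdd (vel u) M) :
    dissipation α u = ENNReal.ofReal (‖(stokes u : L2 ℓ)‖ ^ 2 +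
      ∫ x, ‖vel u x‖ ^ (2 * α + 2) ∂boxMeasure ℓ +
      ∫ x, ‖vel u x‖ ^ (2 * α) * gradSq u x ∂boxMeasure ℓ) := by
  have hα0 : 0 ≤ 2 * α := by linarith
  have hpow : ∀ (v : E3) (p : ℝ), 0 ≤ p → ‖v‖ₑ ^ p = ENNReal.ofReal (‖v‖ ^ p) := fun v p hp => by
    rw [← ofReal_norm, ENNReal.ofReal_rpow_of_nonneg (norm_nonneg _) hp]
  have i1 : Integrable (fun x => ‖vel u x‖ ^ (2 * α + 2)) (boxMeasure ℓ) := by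
    refine Integrable.of_bound (C := M ^ (2 * α + 2)) ?_ ?_
    · exact (Real.continuous_rpow_const (by linarith)).comp_aestronglyMeasurable
        (Lp.aestronglyMeasurable _).norm
    · filter_upwards [hu] with x hx
      rw [Real.norm_of_nonneg (by positivity)]
      gcongr
  have i2 := integrable_pow_mul_gradSq hu hα0
  rw [ENNReal.ofReal_add (by positivity) (integral_nonneg fun x =>
      mul_nonneg (by positivity) (gradSq_nonneg _ _)),
    ENNReal.ofReal_add (by positivity) (integral_nonneg fun x => by positivity),
    ofReal_integral_eq_lintegral_ofReal i1 (Eventually.of_forall fun x => by positivity),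
    ofReal_integral_eq_lintegral_ofReal i2 (Eventually.of_forall fun x =>
      mul_nonneg (by positivity) (gradSq_nonneg _ _)), dissipation]
  congr 1
  · congr 1
    · rw [ENNReal.ofReal_pow (norm_nonneg _), ofReal_norm]
      rfl
    · simp_rw [fun x => hpow (vel u x) (2 * α + 2) (by linarith)]
  · refine lintegral_congr fun x => ?_
    rw [hpow _ _ hα0, gradSq, ENNReal.ofReal_mul (by positivity),
      ENNReal.ofReal_sum_of_nonneg fun _ _ => by positivity]
    simp_rw [ENNReal.ofReal_pow (norm_nonneg _), ofReal_norm]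

/-- The squared norm `λ ‖u‖² + ‖∇u‖²` on `V`. -/
def energy {ℓ : ℝ} (lam : ℝ) (u : V ℓ) : ℝ := lam * ‖vel u‖ ^ 2 + ∑ j, ‖pd u j‖ ^ 2

-- Test with `λu + Au`. The choice `λ = max(1, μ/ν)` lets `λν‖∇u‖²` absorb the remainder `μ‖∇u‖²`,
-- and `λ` times the drag tested with `u` supplies the `𝕃^{2α+2}` term. The factor `2` in the
-- constant comes from `2⟨u - z, u⟩ ≥ ‖u‖² - ‖z‖²` with `z = v + g`.
set_option maxHeartbeats 800000 in
lemma exists_energy_le {ℓ ν a α : ℝ} (hℓ : 0 < ℓ) (hν : 0 < ν) (ha : 0 < a) (hα : 1 ≤ α)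
    (hα' : α = 1 → 1 < 4 * ν * a) : ∃ lam : ℝ, 1 ≤ lam ∧ ∃ c : ℝ, 0 < c ∧
    ∀ (h : ℝ) (u v g : V ℓ), 0 ≤ h → InDomA u →
      (∀ φ : V ℓ, ⟪toH ℓ u - toH ℓ v, toH ℓ φ⟫_ℝ + h * (ν * ⟪stokes u, toH ℓ φ⟫_ℝ +
        trilinear u u φ + a * forchheimer α u φ) = ⟪toH ℓ g, toH ℓ φ⟫_ℝ) →
      ∃ d : ℝ, 0 ≤ d ∧ dissipation α u = ENNReal.ofReal d ∧
        energy lam u + h * c * d ≤ energy lam (v + g) := by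
  obtain ⟨c, hc, μ, hμ, key⟩ := exists_viscous_drag_ge ℓ hν ha hα hα'
  refine ⟨max 1 (μ / ν), le_max_left _ _, 2 * min c (a * max 1 (μ / ν)),
    mul_pos two_pos (lt_min hc (by positivity)), fun h u v g hh hA heq => ?_⟩
  set lam := max 1 (μ / ν) with hlam
  have hlam1 : 1 ≤ lam := le_max_left _ _
  have hlamν : μ ≤ lam * ν := by
    rw [← div_le_iff₀ hν]
    exact le_max_right _ _
  have hα0 : 0 ≤ 2 * α := by linarith
  obtain ⟨K, -, hK⟩ := exists_sum_coef_le hℓ one_pos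
  have hL := hasLap_stokes hℓ hA
  set w : L2 ℓ := (stokes u : L2 ℓ) with hw
  have hu := HasLap.essBdd hℓ hK (f := toH ℓ u) hL
  have hu' : EssBdd (vel u) (1 * ‖w‖ + K * ‖vel u‖) := hu
  have hbs := fun s => HasLap.essBdd_trunc hℓ hK (f := toH ℓ u) hL s
  set D := ∫ x, ‖vel u x‖ ^ (2 * α) * gradSq u x ∂boxMeasure ℓ with hD
  set I := ∫ x, ‖vel u x‖ ^ (2 * α + 2) ∂boxMeasure ℓ with hI
  have hD0 : 0 ≤ D := integral_nonneg fun x => mul_nonneg (by positivity) (gradSq_nonneg _ _)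
  have hI0 : 0 ≤ I := integral_nonneg fun x => by positivity
  have hdrag : D ≤ ⟪drag hα0 hu', w⟫_ℝ :=
    HasLap.integral_le_inner_drag hℓ (by linarith) hα0 hL hbs hu'
  have hres : ∀ φ : V ℓ, ⟪vel u - vel v - vel g + h • (ν • w + adv hu' u + a • drag hα0 hu'),
      vel φ⟫_ℝ = 0 := by
    intro φ
    have h1 := heq φ
    rw [trilinear_eq_inner_adv hu', forchheimer_eq_inner hα0 hu'] at h1
    have e1 : ⟪toH ℓ u - toH ℓ v, toH ℓ φ⟫_ℝ = ⟪vel u - vel v, vel φ⟫_ℝ := rfl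
    have e2 : ⟪stokes u, toH ℓ φ⟫_ℝ = ⟪w, vel φ⟫_ℝ := rfl
    rw [e1, e2, inner_toH] at h1
    rw [inner_add_left, inner_sub_left, real_inner_smul_left, inner_add_left, inner_add_left,
      real_inner_smul_left, real_inner_smul_left]
    linarith
  have htest_u := hres u
  -- `Au` belongs to `H` but need not be in `V`, so it is tested through its Fourier truncations;
  -- the residual is an `𝕃²` field because `u` is bounded.
  have htest_w : ⟪vel u - vel v - vel g + h • (ν • w + adv hu' u + a • drag hα0 hu'), w⟫_ℝ = 0 := by
    refine tendsto_nhds_unique (tendsto_const_nhds.inner (tendsto_vel_trunc hℓ (stokes u))) ?_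
    refine tendsto_const_nhds.congr fun s => ?_
    exact (hres _).symm
  have hb0 := trilinear_self hℓ hu'
  rw [trilinear_eq_inner_adv hu'] at hb0
  have hself := inner_drag_self hα0 hu'
  have hwu := hL.inner_eq hℓ (φ := u)
  have hwv := hL.inner_eq hℓ (φ := v)
  have hwg := hL.inner_eq hℓ (φ := g)
  have hkey := key u _ hu' w
  simp only [inner_add_left, inner_sub_left, real_inner_smul_left] at htest_u htest_w
  rw [hb0, hself, real_inner_comm (vel u) w, hwu] at htest_u
  rw [hwu, hwv, hwg] at htest_w
  simp only [real_inner_self_eq_norm_sq] at htest_u htest_w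
  refine ⟨‖w‖ ^ 2 + I + D, by positivity, dissipation_eq (by linarith) hu', ?_⟩
  have hvel : ‖vel (v + g)‖ ^ 2 ≥ 2 * (⟪vel v, vel u⟫_ℝ + ⟪vel g, vel u⟫_ℝ) - ‖vel u‖ ^ 2 := by
    have h1 := sq_nonneg ‖vel (v + g) - vel u‖
    rw [norm_sub_sq_real] at h1
    have h2 : ⟪vel (v + g), vel u⟫_ℝ = ⟪vel v, vel u⟫_ℝ + ⟪vel g, vel u⟫_ℝ :=
      inner_add_left (vel v) (vel g) (vel u)
    linarith
  have hpd : ∑ j, ‖pd (v + g) j‖ ^ 2 ≥ 2 * (∑ j, ⟪pd v j, pd u j⟫_ℝ + ∑ j, ⟪pd g j, pd u j⟫_ℝ) -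
      ∑ j, ‖pd u j‖ ^ 2 := by
    rw [← Finset.sum_add_distrib, Finset.mul_sum, ← Finset.sum_sub_distrib]
    refine Finset.sum_le_sum fun j _ => ?_
    have h1 := sq_nonneg ‖pd (v + g) j - pd u j‖
    rw [norm_sub_sq_real] at h1
    have h2 : ⟪pd (v + g) j, pd u j⟫_ℝ = ⟪pd v j, pd u j⟫_ℝ + ⟪pd g j, pd u j⟫_ℝ :=
      inner_add_left (pd v j) (pd g j) (pd u j)
    linarith
  have hS : 0 ≤ ∑ j, ‖pd u j‖ ^ 2 := Finset.sum_nonneg fun _ _ => sq_nonneg _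
  set S := ∑ j, ‖pd u j‖ ^ 2 with hSdef
  have hm1 := mul_le_mul_of_nonneg_right (min_le_left c (a * lam))
    (by positivity : 0 ≤ ‖w‖ ^ 2 + D)
  have hm2 := mul_le_mul_of_nonneg_right (min_le_right c (a * lam)) hI0
  have hμS := mul_le_mul_of_nonneg_right hlamν hS
  have haD := mul_le_mul_of_nonneg_left hdrag ha.le
  have hin : min c (a * lam) * (‖w‖ ^ 2 + I + D) ≤
      ν * ‖w‖ ^ 2 + ⟪adv hu' u, w⟫_ℝ + a * ⟪drag hα0 hu', w⟫_ℝ + lam * (ν * S + a * I) := by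
    linarith
  have hin' := mul_le_mul_of_nonneg_left hin hh
  have hvel' := mul_le_mul_of_nonneg_left hvel (by linarith : 0 ≤ lam)
  have htu := congrArg (lam * ·) htest_u
  simp only [mul_zero] at htu
  rw [energy, energy]
  linarith

end BFEuler

end

noncomputable section
namespace BFEuler
open Set Filter Topology

/-! ### Maximal second moments of chains with additive martingale noise -/

section Bracket

variable {Z : Type*} [NormedAddCommGroup Z]

/-- The smoothed norm `√(1 + ‖x‖²)`. -/
def bracket (x : Z) : ℝ := √(1 + ‖x‖ ^ 2)

lemma bracket_sq (x : Z) : bracket x ^ 2 = 1 + ‖x‖ ^ 2 := Real.sq_sqrt (by positivity)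

lemma one_le_bracket (x : Z) : 1 ≤ bracket x := Real.one_le_sqrt.2 (by nlinarith [sq_nonneg ‖x‖])

lemma bracket_pos (x : Z) : 0 < bracket x := one_pos.trans_le (one_le_bracket x)

lemma norm_le_bracket (x : Z) : ‖x‖ ≤ bracket x := Real.le_sqrt_of_sq_le (by linarith)

lemma continuous_bracket : Continuous (bracket : Z → ℝ) := by
  unfold bracket; fun_prop

lemma bracket_mono {x y : Z} (h : ‖x‖ ≤ ‖y‖) : bracket x ≤ bracket y := by
  unfold bracket; gcongr

variable [InnerProductSpace ℝ Z]

/-- The tangent inequality of the convex function `√(1+‖·‖²)`, whose gradient is `x / bracket x`; it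
is Cauchy–Schwarz for the vectors `(1, x)` and `(1, x + g)`. -/
lemma inner_div_bracket_le (x g : Z) : ⟪x, g⟫_ℝ / bracket x ≤ bracket (x + g) - bracket x := by
  rw [div_le_iff₀ (bracket_pos x)]
  have h1 : 1 + ⟪x, x + g⟫_ℝ ≤ bracket (x + g) * bracket x := by
    refine abs_le_of_sq_le_sq' ?_ (mul_pos (bracket_pos _) (bracket_pos _)).le |>.2
    rw [mul_pow, bracket_sq, bracket_sq]
    have h2 := real_inner_mul_inner_self_le x (x + g)
    have h3 := sq_nonneg ‖x - (x + g)‖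
    rw [norm_sub_sq_real] at h3
    simp only [real_inner_self_eq_norm_sq] at h2
    nlinarith
  rw [inner_add_right, real_inner_self_eq_norm_sq] at h1
  have h4 := bracket_sq x
  nlinarith

/-- The matching upper bound follows from `2z(z' - z) ≤ z'² - z²`. Its second-order term is of size
`bracket x` for noise of relative size one, with no singularity at `x = 0`. -/
lemma bracket_sub_le (x g : Z) :
    bracket (x + g) - bracket x ≤ ⟪x, g⟫_ℝ / bracket x + ‖g‖ ^ 2 / (2 * bracket x) := by
  have h0 := bracket_pos x
  have h1 := bracket_sq x
  have h2 := bracket_sq (x + g)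
  have h3 := norm_add_sq_real x g
  have h4 : ⟪x, g⟫_ℝ / bracket x + ‖g‖ ^ 2 / (2 * bracket x) =
      (2 * ⟪x, g⟫_ℝ + ‖g‖ ^ 2) / (2 * bracket x) := by field_simp
  rw [h4, le_div_iff₀ (by positivity)]
  nlinarith [sq_nonneg (bracket (x + g) - bracket x)]

lemma abs_inner_div_bracket_le (x g : Z) : |⟪x, g⟫_ℝ / bracket x| ≤ ‖g‖ := by
  rw [abs_div, abs_of_pos (bracket_pos x), div_le_iff₀ (bracket_pos x), mul_comm]
  exact (abs_real_inner_le_norm x g).trans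
    (mul_le_mul_of_nonneg_right (norm_le_bracket x) (norm_nonneg _))

lemma abs_bracket_sub_le (x g : Z) : |bracket (x + g) - bracket x| ≤ ‖g‖ := by
  rw [abs_le]
  constructor
  · have h1 := inner_div_bracket_le x g
    have h2 := abs_le.1 (abs_inner_div_bracket_le x g)
    linarith
  · have h1 := inner_div_bracket_le (x + g) (-g)
    have h2 := abs_le.1 (abs_inner_div_bracket_le (x + g) (-g))
    rw [add_neg_cancel_right] at h1
    rw [norm_neg] at h2
    linarith

end Bracket

/-- The running maximum of a sequence. -/
def runMax (y : ℕ → ℝ) : ℕ → ℝ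
  | 0 => y 0
  | k + 1 => max (runMax y k) (y (k + 1))

lemma le_runMax (y : ℕ → ℝ) {j k : ℕ} (h : j ≤ k) : y j ≤ runMax y k := by
  induction k with
  | zero => rw [Nat.le_zero.1 h]; rfl
  | succ k ih =>
    rcases Nat.le_succ_iff.1 h with h | h
    · exact (ih h).trans (le_max_left _ _)
    · rw [h]; exact le_max_right _ _

/-- The pathwise form of Doob's `L²` inequality. -/
lemma runMax_sq_le (y : ℕ → ℝ) (n : ℕ) :
    runMax y n ^ 2 ≤ 4 * y n ^ 2 - 4 * ∑ k ∈ Finset.range n, runMax y k * (y (k + 1) - y k) := by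
  -- The running maximum changes only when it equals the current value, so summation by parts has a
  -- sign. The result then follows from `(2yₙ - maxₙ)² ≥ 0`.
  have key : 4 * ∑ k ∈ Finset.range n, runMax y k * (y (k + 1) - y k) ≤
      4 * runMax y n * y n - 2 * runMax y n ^ 2 := by
    induction n with
    | zero => simp only [Finset.range_zero, Finset.sum_empty, runMax]; nlinarith [sq_nonneg (y 0)]
    | succ n ih =>
      rw [Finset.sum_range_succ, runMax]
      rcases max_cases (runMax y n) (y (n + 1)) with ⟨h, -⟩ | ⟨h, -⟩ <;> rw [h]
      · linarith
      · nlinarith [sq_nonneg (y (n + 1) - runMax y n)]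
  nlinarith [sq_nonneg (2 * y n - runMax y n)]

/-- A chain `x` in a Hilbert space such that `‖x (k + 1)‖ ≤ ‖x k + g k‖`, where `g k` is a centred
noise whose size is at most `√(C₀ (1 + ‖x k‖²)) η k`, and `η k` is independent of the past with
second moment at most `θ`. -/
structure EnergyChain {Ω Z : Type*} [mΩ : MeasurableSpace Ω] [NormedAddCommGroup Z]
    [InnerProductSpace ℝ Z] (P : Measure Ω) (m : ℕ → MeasurableSpace Ω) (N : ℕ)
    (x g : ℕ → Ω → Z) (η : ℕ → Ω → ℝ) (C₀ θ : ℝ) : Prop where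
  le : ∀ k, m k ≤ mΩ
  mono : Monotone m
  x_meas : ∀ k ≤ N, StronglyMeasurable[m k] (x k)
  g_meas : ∀ k < N, StronglyMeasurable[m (k + 1)] (g k)
  step : ∀ k < N, ∀ᵐ ω ∂P, ‖x (k + 1) ω‖ ≤ ‖x k ω + g k ω‖
  growth : ∀ k < N, ∀ ω, ‖g k ω‖ ^ 2 ≤ C₀ * (1 + ‖x k ω‖ ^ 2) * η k ω ^ 2
  variance : ∀ k < N, ∀ f : Ω → ℝ, StronglyMeasurable[m k] f → MemLp f 2 P →
    Integrable (fun ω => f ω ^ 2 * η k ω ^ 2) P ∧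
      ∫ ω, f ω ^ 2 * η k ω ^ 2 ∂P ≤ θ * ∫ ω, f ω ^ 2 ∂P
  mean : ∀ k < N, MemLp (fun ω => bracket (x k ω)) 2 P → ∀ f : Ω → ℝ, StronglyMeasurable[m k] f → MemLp f 2 P →
    ∫ ω, f ω * (⟪x k ω, g k ω⟫_ℝ / bracket (x k ω)) ∂P = 0
  init : MemLp (x 0) 2 P
  C₀_nonneg : 0 ≤ C₀
  θ_nonneg : 0 ≤ θ

/-- The dominating submartingale of an energy chain. -/
def domin {Ω Z : Type*} [NormedAddCommGroup Z] (x g : ℕ → Ω → Z) (k : ℕ) (ω : Ω) : ℝ :=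
  bracket (x 0 ω) + ∑ j ∈ Finset.range k, (bracket (x j ω + g j ω) - bracket (x j ω))

lemma domin_succ {Ω Z : Type*} [NormedAddCommGroup Z] (x g : ℕ → Ω → Z) (k : ℕ) (ω : Ω) :
    domin x g (k + 1) ω = domin x g k ω + (bracket (x k ω + g k ω) - bracket (x k ω)) := by
  rw [domin, Finset.sum_range_succ, ← add_assoc, domin]

lemma runMax_domin_nonneg {Ω Z : Type*} [NormedAddCommGroup Z] (x g : ℕ → Ω → Z) (k : ℕ) (ω : Ω) :
    0 ≤ runMax (fun j => domin x g j ω) k := by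
  refine le_trans ?_ (le_runMax (fun j => domin x g j ω) (zero_le : 0 ≤ k))
  simpa [domin] using (bracket_pos (x 0 ω)).le

namespace EnergyChain

variable {Ω Z : Type*} [mΩ : MeasurableSpace Ω] [NormedAddCommGroup Z]
    [InnerProductSpace ℝ Z] {P : Measure Ω} {m : ℕ → MeasurableSpace Ω}
    {N : ℕ} {x g : ℕ → Ω → Z} {η : ℕ → Ω → ℝ} {C₀ θ : ℝ}

/-- The dissipative part of each step only lowers the norm; dropping it and summing the increments
due to noise alone can only increase the process. -/
lemma bracket_le_domin (hx : EnergyChain P m N x g η C₀ θ) :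
    ∀ᵐ ω ∂P, ∀ k ≤ N, bracket (x k ω) ≤ domin x g k ω := by
  have hs : ∀ᵐ ω ∂P, ∀ k, k < N → ‖x (k + 1) ω‖ ≤ ‖x k ω + g k ω‖ :=
    ae_all_iff.2 fun k => by
      by_cases hk : k < N
      · filter_upwards [hx.step k hk] with ω hω _ using hω
      · exact Eventually.of_forall fun ω h => absurd h hk
  filter_upwards [hs] with ω hω k hk
  induction k with
  | zero => simp [domin]
  | succ k ih =>
    have h1 := ih (by omega)
    have h2 := bracket_mono (hω k (by omega))
    rw [domin_succ]
    linarith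

lemma domin_meas (hx : EnergyChain P m N x g η C₀ θ) {k : ℕ} (hk : k ≤ N) :
    StronglyMeasurable[m k] (domin x g k) := by
  refine StronglyMeasurable.add ?_ (Finset.stronglyMeasurable_fun_sum _ fun j hj => ?_)
  · exact continuous_bracket.comp_stronglyMeasurable
      ((hx.x_meas 0 (zero_le)).mono (hx.mono (zero_le)))
  · have hj' := Finset.mem_range.1 hj
    have h1 := (hx.x_meas j (by omega)).mono (hx.mono hj'.le)
    have h2 := (hx.g_meas j (by omega)).mono (hx.mono (Nat.succ_le_of_lt hj'))
    exact (continuous_bracket.comp_stronglyMeasurable (h1.add h2)).sub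
      (continuous_bracket.comp_stronglyMeasurable h1)

/-- Integrability at time `k` is deduced from that of `domin` at the same time only, so that it can
be used inside the induction that proves `domin` square integrable. -/
lemma memLp_bracket_of_domin (hx : EnergyChain P m N x g η C₀ θ) {k : ℕ} (hk : k ≤ N)
    (h : MemLp (domin x g k) 2 P) : MemLp (fun ω => bracket (x k ω)) 2 P := by
  refine h.mono ?_ ?_
  · exact (continuous_bracket.comp_stronglyMeasurable
      ((hx.x_meas k hk).mono (hx.le k))).aestronglyMeasurable
  · filter_upwards [hx.bracket_le_domin] with ω hω
    have h1 := hω k hk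
    have h0 := bracket_pos (x k ω)
    rw [Real.norm_of_nonneg h0.le, Real.norm_of_nonneg (h0.le.trans h1)]
    exact h1

lemma memLp_noise_of_domin (hx : EnergyChain P m N x g η C₀ θ) {k : ℕ} (hk : k < N)
    (h : MemLp (domin x g k) 2 P) : MemLp (g k) 2 P := by
  have hm : AEStronglyMeasurable (g k) P :=
    ((hx.g_meas k hk).mono (hx.le _)).aestronglyMeasurable
  rw [memLp_two_iff_integrable_sq_norm hm]
  have h1 := (hx.variance k hk (fun ω => bracket (x k ω))
    (continuous_bracket.comp_stronglyMeasurable (hx.x_meas k hk.le))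
    (hx.memLp_bracket_of_domin hk.le h)).1
  refine (h1.const_mul C₀).mono' (hm.norm.pow 2) (Eventually.of_forall fun ω => ?_)
  rw [Real.norm_of_nonneg (sq_nonneg _), bracket_sq, ← mul_assoc]
  exact hx.growth k hk ω

lemma runMax_meas (hx : EnergyChain P m N x g η C₀ θ) {k : ℕ} (hk : k ≤ N) :
    StronglyMeasurable[m k] fun ω => runMax (fun j => domin x g j ω) k := by
  induction k with
  | zero => exact hx.domin_meas hk
  | succ k ih =>
    exact (continuous_fst.max continuous_snd).comp_stronglyMeasurable
      (((ih (by omega)).mono (hx.mono k.le_succ)).prodMk (hx.domin_meas hk))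

variable [IsProbabilityMeasure P]

lemma memLp_domin (hx : EnergyChain P m N x g η C₀ θ) {k : ℕ} (hk : k ≤ N) :
    MemLp (domin x g k) 2 P := by
  induction k with
  | zero =>
    refine ((memLp_const (1 : ℝ)).add hx.init.norm).mono
      ((hx.domin_meas hk).mono (hx.le 0)).aestronglyMeasurable (Eventually.of_forall fun ω => ?_)
    simp only [domin, Finset.range_zero, Finset.sum_empty, add_zero, Pi.add_apply]
    rw [Real.norm_of_nonneg (bracket_pos _).le, Real.norm_of_nonneg (by positivity)]
    refine Real.sqrt_le_iff.2 ⟨by positivity, ?_⟩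
    nlinarith [norm_nonneg (x 0 ω)]
  | succ k ih =>
    have h1 := ih (by omega)
    refine (h1.norm.add (hx.memLp_noise_of_domin (by omega) h1).norm).mono
      ((hx.domin_meas hk).mono (hx.le _)).aestronglyMeasurable (Eventually.of_forall fun ω => ?_)
    rw [Pi.add_apply, Real.norm_of_nonneg (r := ‖domin x g k ω‖ + _) (by positivity), domin_succ]
    exact (norm_add_le _ _).trans (add_le_add le_rfl (abs_bracket_sub_le _ _))

lemma memLp_noise (hx : EnergyChain P m N x g η C₀ θ) {k : ℕ} (hk : k < N) : MemLp (g k) 2 P :=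
  hx.memLp_noise_of_domin hk (hx.memLp_domin hk.le)

lemma memLp_bracket (hx : EnergyChain P m N x g η C₀ θ) {k : ℕ} (hk : k ≤ N) :
    MemLp (fun ω => bracket (x k ω)) 2 P :=
  hx.memLp_bracket_of_domin hk (hx.memLp_domin hk)

lemma integrable_mul_mean (hx : EnergyChain P m N x g η C₀ θ) {k : ℕ} (hk : k < N) {f : Ω → ℝ}
    (hf : MemLp f 2 P) :
    Integrable (fun ω => f ω * (⟪x k ω, g k ω⟫_ℝ / bracket (x k ω))) P := by
  have h1 : MemLp (fun ω => ⟪x k ω, g k ω⟫_ℝ / bracket (x k ω)) 2 P := by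
    have m1 := (hx.x_meas k hk.le).mono (hx.le k)
    have m2 := (hx.g_meas k hk).mono (hx.le _)
    refine (hx.memLp_noise hk).mono ?_ (Eventually.of_forall fun ω => ?_)
    · refine (StronglyMeasurable.aestronglyMeasurable ?_)
      exact ((m1.inner m2).measurable.div
        (continuous_bracket.comp_stronglyMeasurable m1).measurable).stronglyMeasurable
    · exact abs_inner_div_bracket_le _ _
  exact hf.integrable_mul h1

/-- With `z = bracket x ≤ Y` and increment `Δ`, the first-order part of `2YΔ` has mean zero. Its
second-order part and `Δ²` are each at most `C₀Y²η²`, whence the factor `1 + 2C₀θ`. -/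
lemma integral_sq_domin_succ_le (hx : EnergyChain P m N x g η C₀ θ) {k : ℕ} (hk : k < N) :
    ∫ ω, domin x g (k + 1) ω ^ 2 ∂P ≤ (1 + 2 * C₀ * θ) * ∫ ω, domin x g k ω ^ 2 ∂P := by
  have hY := hx.memLp_domin hk.le
  have hmeas := hx.domin_meas hk.le
  obtain ⟨hv1, hv2⟩ := hx.variance k hk _ hmeas hY
  have hm1 := hx.integrable_mul_mean hk hY
  have hm2 := hx.mean k hk (hx.memLp_bracket hk.le) _ hmeas hY
  have hle : ∫ ω, domin x g (k + 1) ω ^ 2 ∂P ≤ ∫ ω, (domin x g k ω ^ 2 +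
      (2 * (domin x g k ω * (⟪x k ω, g k ω⟫_ℝ / bracket (x k ω))) +
        2 * C₀ * (domin x g k ω ^ 2 * η k ω ^ 2))) ∂P := by
    refine integral_mono_ae (hx.memLp_domin hk).integrable_sq
      (hY.integrable_sq.add ((hm1.const_mul 2).add (hv1.const_mul (2 * C₀)))) ?_
    filter_upwards [hx.bracket_le_domin] with ω hω
    have h1 := hω k hk.le
    have h2 := bracket_sub_le (x k ω) (g k ω)
    have h3 := abs_bracket_sub_le (x k ω) (g k ω)
    have h4 := hx.growth k hk ω
    have h5 := bracket_pos (x k ω)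
    rw [← bracket_sq] at h4
    set z := bracket (x k ω) with hz
    set y := domin x g k ω with hy
    set Δ := bracket (x k ω + g k ω) - z with hΔ
    have hy' : domin x g (k + 1) ω = y + Δ := domin_succ x g k ω
    have h6 : Δ ^ 2 ≤ ‖g k ω‖ ^ 2 := sq_le_sq.2 (h3.trans (le_abs_self _))
    have h7 : ‖g k ω‖ ^ 2 ≤ C₀ * (y ^ 2 * η k ω ^ 2) := by
      refine h4.trans ?_
      rw [mul_assoc]
      have := hx.C₀_nonneg
      gcongr
    have h8 : ‖g k ω‖ ^ 2 / (2 * z) ≤ C₀ * z * η k ω ^ 2 / 2 := by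
      rw [div_le_iff₀ (by positivity)]
      nlinarith
    have h9 : y * (C₀ * z * η k ω ^ 2 / 2) ≤ C₀ * (y ^ 2 * η k ω ^ 2) / 2 := by
      have h10 : 0 ≤ C₀ * η k ω ^ 2 * y := by
        have := hx.C₀_nonneg
        have : 0 ≤ y := h5.le.trans h1
        positivity
      nlinarith
    have h11 : y * Δ ≤ y * (⟪x k ω, g k ω⟫_ℝ / z + C₀ * z * η k ω ^ 2 / 2) :=
      mul_le_mul_of_nonneg_left (by linarith) (h5.le.trans h1)
    simp only [hy']
    nlinarith
  have i2 : Integrable (fun ω => 2 * (domin x g k ω * (⟪x k ω, g k ω⟫_ℝ / bracket (x k ω))) +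
      2 * C₀ * (domin x g k ω ^ 2 * η k ω ^ 2)) P :=
    (hm1.const_mul 2).add (hv1.const_mul (2 * C₀))
  rw [integral_add hY.integrable_sq i2, integral_add (hm1.const_mul 2) (hv1.const_mul (2 * C₀)),
    integral_const_mul, integral_const_mul, hm2] at hle
  have := mul_le_mul_of_nonneg_left hv2 (mul_nonneg zero_le_two hx.C₀_nonneg)
  linarith

lemma integral_sq_domin_le (hx : EnergyChain P m N x g η C₀ θ) {k : ℕ} (hk : k ≤ N) :
    ∫ ω, domin x g k ω ^ 2 ∂P ≤
      Real.exp (2 * C₀ * θ * N) * ∫ ω, (1 + ‖x 0 ω‖ ^ 2) ∂P := by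
  have h0 : 0 ≤ 2 * C₀ * θ := by
    have := hx.C₀_nonneg; have := hx.θ_nonneg; positivity
  have hB : 0 ≤ ∫ ω, (1 + ‖x 0 ω‖ ^ 2) ∂P := integral_nonneg fun ω => by positivity
  have h1 : ∫ ω, domin x g k ω ^ 2 ∂P ≤ (1 + 2 * C₀ * θ) ^ k * ∫ ω, (1 + ‖x 0 ω‖ ^ 2) ∂P := by
    induction k with
    | zero => simp [domin, bracket_sq]
    | succ k ih =>
      refine (hx.integral_sq_domin_succ_le (by omega)).trans ?_
      rw [pow_succ', mul_assoc (1 + 2 * C₀ * θ)]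
      exact mul_le_mul_of_nonneg_left (ih (by omega)) (by positivity)
  refine h1.trans (mul_le_mul_of_nonneg_right ?_ hB)
  calc (1 + 2 * C₀ * θ) ^ k ≤ Real.exp (2 * C₀ * θ) ^ k := by
        gcongr; rw [add_comm]; exact Real.add_one_le_exp _
    _ = Real.exp (k * (2 * C₀ * θ)) := (Real.exp_nat_mul _ _).symm
    _ ≤ Real.exp (2 * C₀ * θ * N) := by
        rw [Real.exp_le_exp, mul_comm]
        gcongr

lemma memLp_runMax (hx : EnergyChain P m N x g η C₀ θ) {k : ℕ} (hk : k ≤ N) :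
    MemLp (fun ω => runMax (fun j => domin x g j ω) k) 2 P := by
  induction k with
  | zero => exact hx.memLp_domin hk
  | succ k ih => exact (ih (by omega)).sup (hx.memLp_domin hk)

/-- The maximal moment bound for an energy chain, together with the bound of its dissipation. -/
lemma exists_bound (hx : EnergyChain P m N x g η C₀ θ) {e : ℕ → Ω → ℝ}
    (he : ∀ k < N, ∀ᵐ ω ∂P, ‖x (k + 1) ω‖ ^ 2 + e k ω ≤ ‖x k ω + g k ω‖ ^ 2) :
    ∃ R : Ω → ℝ, Integrable R P ∧
      ∫ ω, R ω ∂P ≤ (5 + C₀ * θ * N) *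
        (Real.exp (2 * C₀ * θ * N) * ∫ ω, (1 + ‖x 0 ω‖ ^ 2) ∂P) ∧
      ∀ᵐ ω ∂P, ∀ k ≤ N, ‖x k ω‖ ^ 2 + ∑ j ∈ Finset.range N, e j ω ≤ R ω := by
  set Y : ℕ → Ω → ℝ := domin x g with hY
  set Ym : ℕ → Ω → ℝ := fun k ω => runMax (fun j => domin x g j ω) k with hYm
  set ξ : ℕ → Ω → ℝ := fun k ω => ⟪x k ω, g k ω⟫_ℝ / bracket (x k ω) with hξ
  set B := Real.exp (2 * C₀ * θ * N) * ∫ ω, (1 + ‖x 0 ω‖ ^ 2) ∂P with hB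
  -- All noise contributions together: `2 bracket·ξ` from the energy balance, `-4 Ym·ξ` from Doob's
  -- inequality, and the quadratic term. Only the last has nonzero expectation.
  set r : ℕ → Ω → ℝ := fun k ω => (2 * (bracket (x k ω) * ξ k ω) - 4 * (Ym k ω * ξ k ω)) +
    C₀ * (Y k ω ^ 2 * η k ω ^ 2) with hr
  have hbm : ∀ k ≤ N, StronglyMeasurable[m k] fun ω => bracket (x k ω) := fun k hk =>
    continuous_bracket.comp_stronglyMeasurable (hx.x_meas k hk)
  have i1 : ∀ k < N, Integrable (fun ω => bracket (x k ω) * ξ k ω) P := fun k hk =>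
    hx.integrable_mul_mean hk (hx.memLp_bracket hk.le)
  have i2 : ∀ k < N, Integrable (fun ω => Ym k ω * ξ k ω) P := fun k hk =>
    hx.integrable_mul_mean hk (hx.memLp_runMax hk.le)
  have i3 : ∀ k < N, Integrable (fun ω => Y k ω ^ 2 * η k ω ^ 2) P := fun k hk =>
    (hx.variance k hk _ (hx.domin_meas hk.le) (hx.memLp_domin hk.le)).1
  have i12 : ∀ k < N, Integrable
      (fun ω => 2 * (bracket (x k ω) * ξ k ω) - 4 * (Ym k ω * ξ k ω)) P := fun k hk =>
    ((i1 k hk).const_mul 2).sub ((i2 k hk).const_mul 4)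
  have ir : ∀ k < N, Integrable (r k) P := fun k hk => (i12 k hk).add ((i3 k hk).const_mul C₀)
  have hr_le : ∀ k < N, ∫ ω, r k ω ∂P ≤ C₀ * θ * B := by
    intro k hk
    have h1 : ∫ ω, r k ω ∂P = C₀ * ∫ ω, Y k ω ^ 2 * η k ω ^ 2 ∂P := by
      simp only [hr]
      rw [integral_add (i12 k hk) ((i3 k hk).const_mul C₀),
        integral_sub ((i1 k hk).const_mul 2) ((i2 k hk).const_mul 4), integral_const_mul,
        integral_const_mul, integral_const_mul,
        hx.mean k hk (hx.memLp_bracket hk.le) _ (hbm k hk.le) (hx.memLp_bracket hk.le),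
        hx.mean k hk (hx.memLp_bracket hk.le) _ (hx.runMax_meas hk.le) (hx.memLp_runMax hk.le)]
      ring
    have h2 := (hx.variance k hk _ (hx.domin_meas hk.le) (hx.memLp_domin hk.le)).2
    have h3 := hx.integral_sq_domin_le hk.le
    rw [h1, mul_assoc]
    have := hx.C₀_nonneg
    have := hx.θ_nonneg
    exact mul_le_mul_of_nonneg_left (h2.trans (by gcongr)) hx.C₀_nonneg
  have iY : ∀ k ≤ N, Integrable (fun ω => Y k ω ^ 2) P := fun k hk =>
    (hx.memLp_domin hk).integrable_sq
  have iYY : Integrable (fun ω => 4 * Y N ω ^ 2 + Y 0 ω ^ 2) P :=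
    ((iY N le_rfl).const_mul 4).add (iY 0 zero_le)
  have iS : Integrable (fun ω => ∑ k ∈ Finset.range N, r k ω) P :=
    integrable_finsetSum _ fun k hk => ir k (Finset.mem_range.1 hk)
  -- The constant `5` is `4 + 1`: the terminal value in Doob's inequality and the initial value in
  -- the energy balance.
  refine ⟨fun ω => (4 * Y N ω ^ 2 + Y 0 ω ^ 2) + ∑ k ∈ Finset.range N, r k ω, iYY.add iS, ?_, ?_⟩
  · rw [integral_add iYY iS, integral_add ((iY N le_rfl).const_mul 4) (iY 0 zero_le),
      integral_const_mul, integral_finsetSum _ fun k hk => ir k (Finset.mem_range.1 hk)]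
    have h1 := hx.integral_sq_domin_le le_rfl
    have h2 := hx.integral_sq_domin_le (zero_le : 0 ≤ N)
    have h3 : ∑ k ∈ Finset.range N, ∫ ω, r k ω ∂P ≤ N * (C₀ * θ * B) := by
      refine (Finset.sum_le_sum fun k hk => hr_le k (Finset.mem_range.1 hk)).trans ?_
      simp
    linarith
  · have he' : ∀ᵐ ω ∂P, ∀ k, k < N → ‖x (k + 1) ω‖ ^ 2 + e k ω ≤ ‖x k ω + g k ω‖ ^ 2 :=
      ae_all_iff.2 fun k => by
        by_cases hk : k < N
        · filter_upwards [he k hk] with ω hω _ using hω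
        · exact Eventually.of_forall fun ω h => absurd h hk
    filter_upwards [he', hx.bracket_le_domin] with ω hω hb k hk
    -- In the pathwise Doob inequality the increments of `Y` carry nonpositive weights `-4 Ym`, so
    -- the tangent inequality may replace them by the mean-zero terms `ξ`.
    have h1 : ‖x k ω‖ ^ 2 ≤ 4 * Y N ω ^ 2 - 4 * ∑ j ∈ Finset.range N, Ym j ω * ξ j ω := by
      have h2 := runMax_sq_le (fun j => domin x g j ω) N
      have h3 : ∑ j ∈ Finset.range N, Ym j ω * ξ j ω ≤ ∑ j ∈ Finset.range N,
          runMax (fun j => domin x g j ω) j * (domin x g (j + 1) ω - domin x g j ω) := by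
        refine Finset.sum_le_sum fun j _ => ?_
        refine mul_le_mul_of_nonneg_left ?_ (runMax_domin_nonneg x g j ω)
        rw [domin_succ, add_sub_cancel_left]
        exact inner_div_bracket_le _ _
      have h4 : ‖x k ω‖ ≤ runMax (fun j => domin x g j ω) N :=
        (norm_le_bracket _).trans ((hb k hk).trans (le_runMax (fun j => domin x g j ω) hk))
      have h5 := pow_le_pow_left₀ (norm_nonneg _) h4 2
      linarith
    -- The squared energy inequality is telescoped to keep the dissipation; its cross term `2⟨x, g⟩`
    -- equals `2 bracket·ξ`.
    have h6 : ∀ n ≤ N, ‖x n ω‖ ^ 2 + ∑ j ∈ Finset.range n, e j ω ≤ Y 0 ω ^ 2 +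
        ∑ j ∈ Finset.range n, (2 * (bracket (x j ω) * ξ j ω) + C₀ * (Y j ω ^ 2 * η j ω ^ 2)) := by
      intro n hn
      induction n with
      | zero =>
        have h7 : Y 0 ω ^ 2 = 1 + ‖x 0 ω‖ ^ 2 := by simp [hY, domin, bracket_sq]
        simp only [Finset.range_zero, Finset.sum_empty, h7]
        linarith
      | succ n ih =>
        rw [Finset.sum_range_succ, Finset.sum_range_succ]
        have h8 := hω n (by omega)
        have h9 := ih (by omega)
        have h10 := hx.growth n (by omega) ω
        have h11 : bracket (x n ω) * ξ n ω = ⟪x n ω, g n ω⟫_ℝ :=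
          mul_div_cancel₀ _ (bracket_pos _).ne'
        have h12 : C₀ * (1 + ‖x n ω‖ ^ 2) * η n ω ^ 2 ≤ C₀ * (Y n ω ^ 2 * η n ω ^ 2) := by
          rw [mul_assoc, ← bracket_sq]
          have := hx.C₀_nonneg
          have := bracket_pos (x n ω)
          have := hb n (by omega)
          gcongr
        rw [norm_add_sq_real] at h8
        rw [h11]
        linarith
    have h7 := h6 N le_rfl
    have h8 : ∑ j ∈ Finset.range N, r j ω = ∑ j ∈ Finset.range N,
        (2 * (bracket (x j ω) * ξ j ω) + C₀ * (Y j ω ^ 2 * η j ω ^ 2)) -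
          4 * ∑ j ∈ Finset.range N, Ym j ω * ξ j ω := by
      rw [Finset.mul_sum, ← Finset.sum_sub_distrib]
      exact Finset.sum_congr rfl fun j _ => by simp only [hr]; ring
    have h9 := sq_nonneg ‖x N ω‖
    simp only [h8]
    linarith

end EnergyChain

end BFEuler

end

noncomputable section
namespace BFEuler
open Set Filter Topology

/-! ### Gaussian increments independent of the past -/

/-- Distinct basis vectors lie at distance `√2`, so balls of radius `1/2` around them are disjoint
open sets in a separable space. -/
lemma countable_of_hilbertBasis {ι K : Type*} [NormedAddCommGroup K] [InnerProductSpace ℝ K]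
    [TopologicalSpace.SeparableSpace K] (ζ : HilbertBasis ι ℝ K) : Countable ι := by
  have h : (univ : Set ι).PairwiseDisjoint fun i => Metric.ball (ζ i) (1 / 2) := by
    intro i _ j _ hij
    refine Metric.ball_disjoint_ball ?_
    rw [dist_eq_norm]
    have h1 : ‖ζ i - ζ j‖ ^ 2 = 2 := by
      rw [norm_sub_sq_real, ζ.orthonormal.1, ζ.orthonormal.1, ζ.orthonormal.2 hij]
      norm_num
    nlinarith [norm_nonneg (ζ i - ζ j)]
  exact countable_univ_iff.1 (h.countable_of_isOpen (fun _ _ => Metric.isOpen_ball)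
    fun i _ => ⟨ζ i, Metric.mem_ball_self (by norm_num)⟩)

section Increment

variable {Ω K : Type*} {m mΩ : MeasurableSpace Ω} {P : Measure Ω} [NormedAddCommGroup K]
  {D : Ω → K}

/-- The product formula for independent factors is used for nonnegative extended integrals, so that
finiteness is a conclusion and not a prerequisite. -/
lemma integrable_mul_norm_increment_sq [MeasurableSpace K] [BorelSpace K] {q : ℝ} (hq : 0 ≤ q) (hm : m ≤ mΩ)
    (hD : StronglyMeasurable D)
    (hind : Indep (MeasurableSpace.comap D ‹MeasurableSpace K›) m P)
    (hq' : ∫⁻ ω, ENNReal.ofReal (‖D ω‖ ^ 2) ∂P ≤ ENNReal.ofReal q) {b : Ω → ℝ}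
    (hb : StronglyMeasurable[m] b) (hb0 : ∀ ω, 0 ≤ b ω) (hbi : Integrable b P) :
    Integrable (fun ω => b ω * ‖D ω‖ ^ 2) P ∧
      ∫ ω, b ω * ‖D ω‖ ^ 2 ∂P ≤ q * ∫ ω, b ω ∂P := by
  have hDm : MeasurableSpace.comap D ‹MeasurableSpace K› ≤ mΩ :=
    measurable_iff_comap_le.1 hD.measurable
  have h1 : Measurable[MeasurableSpace.comap D ‹MeasurableSpace K›] fun ω =>
      ENNReal.ofReal (‖D ω‖ ^ 2) :=
    ((measurable_norm.pow_const 2).ennreal_ofReal).comp (comap_measurable D)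
  have h2 := lintegral_mul_eq_lintegral_mul_lintegral_of_independent_measurableSpace hDm hm hind
    h1 hb.measurable.ennreal_ofReal
  have hmeas : AEStronglyMeasurable (fun ω => b ω * ‖D ω‖ ^ 2) P :=
    ((hb.mono hm).mul (hD.norm.pow 2)).aestronglyMeasurable
  have h3 : ∫⁻ ω, ENNReal.ofReal (b ω * ‖D ω‖ ^ 2) ∂P ≤ ENNReal.ofReal (q * ∫ ω, b ω ∂P) := by
    simp_rw [fun ω => ENNReal.ofReal_mul (q := ‖D ω‖ ^ 2) (hb0 ω), mul_comm (ENNReal.ofReal (b _))]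
    rw [h2, ENNReal.ofReal_mul hq,
      ofReal_integral_eq_lintegral_ofReal hbi (Eventually.of_forall hb0)]
    gcongr
  have hnn : ∀ ω, 0 ≤ b ω * ‖D ω‖ ^ 2 := fun ω => mul_nonneg (hb0 ω) (by positivity)
  have hi : Integrable (fun ω => b ω * ‖D ω‖ ^ 2) P := by
    refine ⟨hmeas, ?_⟩
    rw [hasFiniteIntegral_iff_ofReal (Eventually.of_forall hnn)]
    exact h3.trans_lt ENNReal.ofReal_lt_top
  refine ⟨hi, ?_⟩
  rw [← ofReal_integral_eq_lintegral_ofReal hi (Eventually.of_forall hnn)] at h3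
  exact (ENNReal.ofReal_le_ofReal_iff (mul_nonneg hq (integral_nonneg hb0))).1 h3

variable [InnerProductSpace ℝ K] {Q : K →L[ℝ] K} {τ : ℝ}

lemma norm_sum_inner_smul_le {ι : Type*} {v : ι → K} (hv : Orthonormal ℝ v) (s : Finset ι)
    (x : K) : ‖∑ i ∈ s, ⟪x, v i⟫_ℝ • v i‖ ≤ ‖x‖ := by
  refine abs_le_of_sq_le_sq' ?_ (norm_nonneg _) |>.2
  rw [← real_inner_self_eq_norm_sq, hv.inner_sum]
  refine le_trans (le_of_eq ?_) (hv.sum_inner_products_le x (s := s))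
  refine Finset.sum_congr rfl fun i _ => ?_
  rw [real_inner_comm x (v i)]
  simp [sq]

lemma memLp_inner_increment (hD : StronglyMeasurable D) (hg : ∀ y : K,
      P.map (fun ω => ⟪D ω, y⟫_ℝ) = gaussianReal 0 (Real.toNNReal (τ * ⟪Q y, y⟫_ℝ))) (y : K) :
    MemLp (fun ω => ⟪D ω, y⟫_ℝ) 2 P := by
  have hm : Measurable fun ω => ⟪D ω, y⟫_ℝ := (hD.inner stronglyMeasurable_const).measurable
  have h := memLp_id_gaussianReal' (μ := 0) (v := Real.toNNReal (τ * ⟪Q y, y⟫_ℝ)) 2 (by simp)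
  rw [← hg y] at h
  exact (memLp_map_measure_iff aestronglyMeasurable_id hm.aemeasurable).1 h

lemma integral_inner_increment (hD : StronglyMeasurable D) (hg : ∀ y : K,
      P.map (fun ω => ⟪D ω, y⟫_ℝ) = gaussianReal 0 (Real.toNNReal (τ * ⟪Q y, y⟫_ℝ))) (y : K) :
    ∫ ω, ⟪D ω, y⟫_ℝ ∂P = 0 := by
  have hm : Measurable fun ω => ⟪D ω, y⟫_ℝ := (hD.inner stronglyMeasurable_const).measurable
  have h := integral_id_gaussianReal (μ := 0) (v := Real.toNNReal (τ * ⟪Q y, y⟫_ℝ))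
  rw [← hg y] at h
  rwa [← integral_map (f := fun x => x) hm.aemeasurable aestronglyMeasurable_id]

lemma integral_inner_increment_sq (hD : StronglyMeasurable D) (hg : ∀ y : K,
      P.map (fun ω => ⟪D ω, y⟫_ℝ) = gaussianReal 0 (Real.toNNReal (τ * ⟪Q y, y⟫_ℝ)))
    (y : K) (hy : 0 ≤ τ * ⟪Q y, y⟫_ℝ) :
    ∫ ω, ⟪D ω, y⟫_ℝ ^ 2 ∂P = τ * ⟪Q y, y⟫_ℝ := by
  have hm : Measurable fun ω => ⟪D ω, y⟫_ℝ := (hD.inner stronglyMeasurable_const).measurable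
  have h := variance_id_gaussianReal (μ := 0) (v := Real.toNNReal (τ * ⟪Q y, y⟫_ℝ))
  rw [← hg y, variance_map aemeasurable_id hm.aemeasurable, Function.id_comp,
    variance_of_integral_eq_zero
    (hm.aemeasurable) (by simpa using integral_inner_increment hD hg y),
    Real.coe_toNNReal _ hy] at h
  exact h

/-- Parseval in `K` and monotone summation reduce the second moment to the variances of the
coordinates, which add up to `τ tr Q`. -/
lemma lintegral_norm_increment_sq [TopologicalSpace.SeparableSpace K] {ι : Type*}
    (ζ : HilbertBasis ι ℝ K) (hs : Summable fun j => ⟪Q (ζ j), ζ j⟫_ℝ)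
    (hQ : ∀ y, 0 ≤ ⟪Q y, y⟫_ℝ) (hτ : 0 ≤ τ) (hD : StronglyMeasurable D) (hg : ∀ y : K,
      P.map (fun ω => ⟪D ω, y⟫_ℝ) = gaussianReal 0 (Real.toNNReal (τ * ⟪Q y, y⟫_ℝ))) :
    ∫⁻ ω, ENNReal.ofReal (‖D ω‖ ^ 2) ∂P = ENNReal.ofReal (τ * ∑' j, ⟪Q (ζ j), ζ j⟫_ℝ) := by
  have := countable_of_hilbertBasis ζ
  have hm : ∀ y, Measurable fun ω => ⟪D ω, y⟫_ℝ := fun y =>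
    (hD.inner stronglyMeasurable_const).measurable
  have h1 : ∀ ω, ENNReal.ofReal (‖D ω‖ ^ 2) = ∑' j, ENNReal.ofReal (⟪D ω, ζ j⟫_ℝ ^ 2) := by
    intro ω
    have h2 := ζ.hasSum_inner_mul_inner (D ω) (D ω)
    have h3 : (fun j => ⟪D ω, ζ j⟫_ℝ * ⟪ζ j, D ω⟫_ℝ) = fun j => ⟪D ω, ζ j⟫_ℝ ^ 2 := by
      funext j
      rw [real_inner_comm (D ω), sq]
    rw [h3, real_inner_self_eq_norm_sq] at h2
    rw [← h2.tsum_eq, ENNReal.ofReal_tsum_of_nonneg (fun _ => sq_nonneg _) h2.summable]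
  simp_rw [h1]
  rw [lintegral_tsum fun j => ((hm (ζ j)).pow_const 2).ennreal_ofReal.aemeasurable,
    ← tsum_mul_left, ENNReal.ofReal_tsum_of_nonneg (fun j => mul_nonneg hτ (hQ _))
      (hs.mul_left τ)]
  congr 1
  funext j
  rw [← integral_inner_increment_sq hD hg (ζ j) (mul_nonneg hτ (hQ _)),
    ofReal_integral_eq_lintegral_ofReal (memLp_inner_increment hD hg (ζ j)).integrable_sq
      (Eventually.of_forall fun ω => sq_nonneg _)]

/-- A random functional that depends only on the past is uncorrelated with the increment. -/
lemma integral_apply_increment [MeasurableSpace K] [BorelSpace K]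
    [TopologicalSpace.SeparableSpace K] {ι : Type*}
    (ζ : HilbertBasis ι ℝ K) (hm : m ≤ mΩ) (hD : StronglyMeasurable D)
    (hind : Indep (MeasurableSpace.comap D ‹MeasurableSpace K›) m P) (hg : ∀ y : K,
      P.map (fun ω => ⟪D ω, y⟫_ℝ) = gaussianReal 0 (Real.toNNReal (τ * ⟪Q y, y⟫_ℝ)))
    {β : Ω → K →L[ℝ] ℝ} {b : Ω → ℝ} (hβ : ∀ y, StronglyMeasurable[m] fun ω => β ω y)
    (hβb : ∀ ω, ‖β ω‖ ≤ b ω) (hbi : Integrable (fun ω => b ω * ‖D ω‖) P) :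
    ∫ ω, β ω (D ω) ∂P = 0 := by
  have := countable_of_hilbertBasis ζ
  have hmD : ∀ y, StronglyMeasurable fun ω => ⟪D ω, y⟫_ℝ := fun y =>
    hD.inner stronglyMeasurable_const
  have hterm : ∀ j, ∫ ω, ⟪D ω, ζ j⟫_ℝ * β ω (ζ j) ∂P = 0 := by
    intro j
    have hi : IndepFun (fun ω => ⟪D ω, ζ j⟫_ℝ) (fun ω => β ω (ζ j)) P := by
      refine indep_of_indep_of_le_left (indep_of_indep_of_le_right hind ?_) ?_
      · exact measurable_iff_comap_le.1 (hβ (ζ j)).measurable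
      · refine measurable_iff_comap_le.1 ?_
        exact (continuous_id.inner continuous_const).measurable.comp (comap_measurable D)
    have h := hi.integral_mul_eq_mul_integral (hmD _).aestronglyMeasurable
      ((hβ (ζ j)).mono hm).aestronglyMeasurable
    rw [integral_inner_increment hD hg, zero_mul] at h
    exact h
  have hbound : ∀ (s : Finset ι) ω, ‖∑ j ∈ s, ⟪D ω, ζ j⟫_ℝ * β ω (ζ j)‖ ≤ b ω * ‖D ω‖ := by
    intro s ω
    have h1 : ∑ j ∈ s, ⟪D ω, ζ j⟫_ℝ * β ω (ζ j) = β ω (∑ j ∈ s, ⟪D ω, ζ j⟫_ℝ • ζ j) := by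
      simp [map_sum]
    rw [h1]
    refine ((β ω).le_opNorm _).trans (mul_le_mul (hβb ω) (norm_sum_inner_smul_le ζ.orthonormal s _)
      (norm_nonneg _) ((norm_nonneg _).trans (hβb ω)))
  have hmeas : ∀ s : Finset ι, AEStronglyMeasurable
      (fun ω => ∑ j ∈ s, ⟪D ω, ζ j⟫_ℝ * β ω (ζ j)) P := fun s =>
    (Finset.stronglyMeasurable_fun_sum s fun j _ =>
      (hmD (ζ j)).mul ((hβ (ζ j)).mono hm)).aestronglyMeasurable
  -- The increment is expanded in the basis. Every term is a product of independent factors, one of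
  -- them centred, and Bessel's inequality gives the domination by `b‖D‖` uniformly in `s`.
  have hlim : Tendsto (fun s : Finset ι => ∫ ω, ∑ j ∈ s, ⟪D ω, ζ j⟫_ℝ * β ω (ζ j) ∂P) atTop
      (𝓝 (∫ ω, β ω (D ω) ∂P)) := by
    refine tendsto_integral_filter_of_dominated_convergence (fun ω => b ω * ‖D ω‖)
      (Eventually.of_forall hmeas) (Eventually.of_forall fun s => Eventually.of_forall (hbound s))
      hbi (Eventually.of_forall fun ω => ?_)
    have h1 := (ζ.hasSum_repr (D ω)).mapL (β ω)
    simp only [map_smul, smul_eq_mul, ζ.repr_apply_apply, real_inner_comm] at h1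
    exact h1
  refine tendsto_nhds_unique hlim (tendsto_const_nhds.congr fun s => ?_)
  rw [integral_finsetSum]
  · exact (Finset.sum_eq_zero fun j _ => hterm j).symm
  · intro j _
    refine hbi.mono' ((hmD (ζ j)).mul ((hβ (ζ j)).mono hm)).aestronglyMeasurable
      (Eventually.of_forall fun ω => ?_)
    simpa using hbound {j} ω

end Increment

end BFEuler

end

noncomputable section
namespace BFEuler
open Set Filter Topology

/-! ### Uniform moment bounds for the scheme -/

/-- The map `u ↦ (√λ u, ∇u)`, whose squared norm is `energy λ`. -/
def energyMap (ℓ lam : ℝ) : V ℓ →L[ℝ] WithLp 2 (L2 ℓ × PiLp 2 fun _ : Fin 3 => L2 ℓ) :=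
  ((WithLp.prodContinuousLinearEquiv 2 ℝ (L2 ℓ) (PiLp 2 fun _ : Fin 3 => L2 ℓ)).symm :
    (L2 ℓ × PiLp 2 fun _ : Fin 3 => L2 ℓ) →L[ℝ] _).comp
  ((√lam • velL ℓ).prod
    ((WithLp.sndL 2 ℝ (L2 ℓ) (PiLp 2 fun _ : Fin 3 => L2 ℓ)).comp (V ℓ).subtypeL))

lemma norm_sq_energyMap {ℓ lam : ℝ} (hlam : 0 ≤ lam) (u : V ℓ) :
    ‖energyMap ℓ lam u‖ ^ 2 = energy lam u := by
  rw [WithLp.prod_norm_sq_eq_of_L2]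
  have h1 : (energyMap ℓ lam u).fst = √lam • vel u := rfl
  have h2 : (energyMap ℓ lam u).snd = u.1.snd := rfl
  rw [h1, h2, norm_smul, mul_pow, Real.norm_eq_abs, sq_abs, Real.sq_sqrt hlam,
    PiLp.norm_sq_eq_of_L2]
  rfl

lemma norm_sq_le_energy {ℓ lam : ℝ} (hlam : 1 ≤ lam) (u : V ℓ) : ‖u‖ ^ 2 ≤ energy lam u := by
  rw [norm_sq_V, energy]
  nlinarith [sq_nonneg ‖vel u‖]

lemma energy_le {ℓ lam : ℝ} (hlam : 1 ≤ lam) (u : V ℓ) : energy lam u ≤ lam * ‖u‖ ^ 2 := by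
  rw [norm_sq_V, energy]
  have : 0 ≤ ∑ j, ‖pd u j‖ ^ 2 := Finset.sum_nonneg fun _ _ => sq_nonneg _
  nlinarith

/-- No continuity of `G` into `𝓛(K; V)` is assumed. Measurability in `H` comes from the Lipschitz
condition, and the `V`-valued field is the pointwise limit of its Fourier truncations, which are
continuous from `H` to `V`. -/
lemma ConditionG.stronglyMeasurable_V {Ω K : Type*} {m : MeasurableSpace Ω}
    [NormedAddCommGroup K] [InnerProductSpace ℝ K] {ℓ : ℝ} (hℓ : 0 < ℓ) {G : V ℓ → K →L[ℝ] V ℓ}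
    (hG : ConditionG G) {u : Ω → V ℓ} (hu : StronglyMeasurable[m] u) {y : Ω → K}
    (hy : StronglyMeasurable[m] y) : StronglyMeasurable[m] fun ω => G (u ω) (y ω) := by
  refine stronglyMeasurable_of_tendsto (atTop : Filter (Finset Idx))
    (f := fun s ω => trunc hℓ s (toH ℓ (G (u ω) (y ω)))) (fun s => ?_) ?_
  · exact (trunc hℓ s).continuous.comp_stronglyMeasurable (hG.stronglyMeasurable hu hy)
  · exact tendsto_pi_nhds.2 fun ω => tendsto_trunc hℓ _

lemma ConditionG.exists_energy_growth {K : Type*} [NormedAddCommGroup K] [InnerProductSpace ℝ K]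
    {ℓ lam : ℝ} (hlam : 1 ≤ lam) {G : V ℓ → K →L[ℝ] V ℓ} (hG : ConditionG G) :
    ∃ C₀ : ℝ, 0 ≤ C₀ ∧ ∀ u y,
      ‖energyMap ℓ lam (G u y)‖ ^ 2 ≤ C₀ * (1 + ‖energyMap ℓ lam u‖ ^ 2) * ‖y‖ ^ 2 := by
  obtain ⟨K₀, hK₀, K₁, hK₁, hG'⟩ := hG.growth_V
  have hlam0 : 0 ≤ lam := by linarith
  refine ⟨lam * (K₀ + K₁), by positivity, fun u y => ?_⟩
  rw [norm_sq_energyMap hlam0, norm_sq_energyMap hlam0]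
  have h1 := energy_le hlam (G u y)
  have h2 : ‖G u y‖ ^ 2 ≤ ‖G u‖ ^ 2 * ‖y‖ ^ 2 := by
    rw [← mul_pow]
    gcongr
    exact (G u).le_opNorm y
  have h3 := norm_sq_le_energy hlam u
  have h4 : K₀ + K₁ * ‖u‖ ^ 2 ≤ (K₀ + K₁) * (1 + energy lam u) := by
    nlinarith [sq_nonneg ‖u‖]
  calc energy lam (G u y) ≤ lam * (‖G u‖ ^ 2 * ‖y‖ ^ 2) :=
        h1.trans (mul_le_mul_of_nonneg_left h2 hlam0)
    _ ≤ lam * (((K₀ + K₁) * (1 + energy lam u)) * ‖y‖ ^ 2) := by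
        gcongr
        exact (hG' u).trans h4
    _ = _ := by ring

lemma grid_succ_sub {T : ℝ≥0} {N : ℕ} (k : ℕ) :
    ((grid T N (k + 1) : ℝ≥0) : ℝ) - grid T N k = T / N := by
  simp only [grid]
  push_cast
  ring

section Moment

variable {Ω K : Type*} [mΩ : MeasurableSpace Ω] {P : Measure Ω}
  {ℱ : Filtration ℝ≥0 mΩ} [NormedAddCommGroup K] [InnerProductSpace ℝ K]
  [TopologicalSpace.SeparableSpace K] [MeasurableSpace K] [BorelSpace K] {ℓ : ℝ} {T : ℝ≥0}
  {ν a α : ℝ} {Q : K →L[ℝ] K} {W : ℝ≥0 → Ω → K} {G : V ℓ → K →L[ℝ] V ℓ} {u₀ : Ω → V ℓ} {N : ℕ}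
  {u : ℕ → Ω → V ℓ}

/-- The variance parameter is `(T/N) tr Q`, so `N` times it is independent of the discretisation;
this is the source of uniformity in `N`. -/
lemma IsEulerSolution.energyChain (hℓ : 0 < ℓ) (hN : 1 ≤ N) {ι : Type*} (ζ : HilbertBasis ι ℝ K)
    (hs : Summable fun j => ⟪Q (ζ j), ζ j⟫_ℝ) (hQ : ∀ y, 0 ≤ ⟪Q y, y⟫_ℝ)
    (hW : IsWiener P ℱ T Q W) (hG : ConditionG G) (hu₀ : MemLp u₀ 2 P)
    (hu : IsEulerSolution P ℱ T ν a α G W u₀ N u) {lam C₀ : ℝ} (hC₀ : 0 ≤ C₀)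
    (hgrowth : ∀ v y, ‖energyMap ℓ lam (G v y)‖ ^ 2 ≤
      C₀ * (1 + ‖energyMap ℓ lam v‖ ^ 2) * ‖y‖ ^ 2)
    (hstep : ∀ k < N, ∀ᵐ ω ∂P, ‖energyMap ℓ lam (u (k + 1) ω)‖ ≤ ‖energyMap ℓ lam (u k ω) +
      energyMap ℓ lam (G (u k ω) (W (grid T N (k + 1)) ω - W (grid T N k) ω))‖) :
    EnergyChain P (fun k => ℱ (grid T N k)) N (fun k ω => energyMap ℓ lam (u k ω))
      (fun k ω => energyMap ℓ lam (G (u k ω) (W (grid T N (k + 1)) ω - W (grid T N k) ω)))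
      (fun k ω => ‖W (grid T N (k + 1)) ω - W (grid T N k) ω‖) C₀
      (T / N * ∑' j, ⟪Q (ζ j), ζ j⟫_ℝ) := by
  have hle := grid_mono T N
  have hDm : ∀ k < N, StronglyMeasurable[ℱ (grid T N (k + 1))] fun ω =>
      W (grid T N (k + 1)) ω - W (grid T N k) ω := fun k hk =>
    (hW.adapted _ (grid_le hN hk)).sub
      ((hW.adapted _ (grid_le hN hk.le)).mono (ℱ.mono (hle k.le_succ)))
  have hD : ∀ k < N, StronglyMeasurable fun ω =>
      W (grid T N (k + 1)) ω - W (grid T N k) ω := fun k hk => (hDm k hk).mono (ℱ.le _)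
  have hind : ∀ k < N, Indep (MeasurableSpace.comap (fun ω =>
      W (grid T N (k + 1)) ω - W (grid T N k) ω) ‹MeasurableSpace K›) (ℱ (grid T N k)) P :=
    fun k hk => hW.indep _ _ (hle k.le_succ) (grid_le hN hk)
  have hg : ∀ k < N, ∀ y : K, P.map (fun ω => ⟪W (grid T N (k + 1)) ω - W (grid T N k) ω, y⟫_ℝ) =
      gaussianReal 0 (Real.toNNReal (T / N * ⟪Q y, y⟫_ℝ)) := fun k hk y => by
    rw [hW.gaussian _ _ (hle k.le_succ) (grid_le hN hk) y, grid_succ_sub]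
  have htr : 0 ≤ (T / N : ℝ) * ∑' j, ⟪Q (ζ j), ζ j⟫_ℝ :=
    mul_nonneg (by positivity) (tsum_nonneg fun j => hQ _)
  have hvar : ∀ k < N, ∀ b : Ω → ℝ, StronglyMeasurable[ℱ (grid T N k)] b → (∀ ω, 0 ≤ b ω) →
      Integrable b P → Integrable (fun ω =>
        b ω * ‖W (grid T N (k + 1)) ω - W (grid T N k) ω‖ ^ 2) P ∧
      ∫ ω, b ω * ‖W (grid T N (k + 1)) ω - W (grid T N k) ω‖ ^ 2 ∂P ≤
        (T / N * ∑' j, ⟪Q (ζ j), ζ j⟫_ℝ) * ∫ ω, b ω ∂P := fun k hk b hb hb0 hbi =>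
    integrable_mul_norm_increment_sq htr (ℱ.le _) (hD k hk) (hind k hk)
      (lintegral_norm_increment_sq ζ hs hQ (by positivity) (hD k hk) (hg k hk)).le hb hb0 hbi
  have hxm : ∀ k ≤ N, StronglyMeasurable[ℱ (grid T N k)] fun ω => energyMap ℓ lam (u k ω) :=
    fun k hk => (energyMap ℓ lam).continuous.comp_stronglyMeasurable (hu.adapted k hk)
  refine ⟨fun k => ℱ.le _, fun j k hjk => ℱ.mono (hle hjk), hxm, fun k hk => ?_, hstep,
    fun k hk ω => hgrowth _ _, fun k hk f hf hf2 => ?_, fun k hk hz f hf hf2 => ?_, ?_, hC₀, htr⟩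
  · exact (energyMap ℓ lam).continuous.comp_stronglyMeasurable
      (hG.stronglyMeasurable_V hℓ ((hu.adapted k hk.le).mono (ℱ.mono (hle k.le_succ))) (hDm k hk))
  · exact hvar k hk _ (hf.pow 2) (fun ω => sq_nonneg _) hf2.integrable_sq
  · set J := energyMap ℓ lam with hJ
    set D : Ω → K := fun ω => W (grid T N (k + 1)) ω - W (grid T N k) ω with hDdef
    -- The martingale increment is a functional of the Wiener increment whose coefficients depend on
    -- the past only; `b` bounds its norm through the growth of `G`.
    let β : Ω → K →L[ℝ] ℝ := fun ω => (f ω / bracket (J (u k ω))) •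
      (innerSL ℝ (J (u k ω))).comp (J.comp (G (u k ω)))
    let b : Ω → ℝ := fun ω => |f ω| * (√C₀ * bracket (J (u k ω)))
    have hβ : ∀ ω y, β ω y = f ω * (⟪J (u k ω), J (G (u k ω) y)⟫_ℝ / bracket (J (u k ω))) := by
      intro ω y
      simp only [β, smul_apply, ContinuousLinearMap.comp_apply, innerSL_apply_apply, smul_eq_mul]
      ring
    have hzm := continuous_bracket.comp_stronglyMeasurable (hxm k hk.le)
    have hbm : StronglyMeasurable[ℱ (grid T N k)] b := hf.norm.mul (hzm.const_mul _)
    have hb0 : ∀ ω, 0 ≤ b ω := fun ω =>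
      mul_nonneg (abs_nonneg _) (mul_nonneg (Real.sqrt_nonneg _) (bracket_pos _).le)
    have hbi : Integrable b P := hf2.norm.integrable_mul (hz.const_mul √C₀)
    have hbD : Integrable (fun ω => b ω * ‖D ω‖) P := by
      refine (hbi.add (hvar k hk b hbm hb0 hbi).1).mono'
        ((hbm.mono (ℱ.le _)).mul (hD k hk).norm).aestronglyMeasurable
        (Eventually.of_forall fun ω => ?_)
      rw [Real.norm_of_nonneg (mul_nonneg (hb0 ω) (norm_nonneg _)), Pi.add_apply]
      -- The available second-moment bound yields integrability of `b‖D‖` without computing a first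
      -- moment.
      have h1 : ‖D ω‖ ≤ 1 + ‖D ω‖ ^ 2 := by nlinarith [sq_nonneg (‖D ω‖ - 1)]
      have h2 := mul_le_mul_of_nonneg_left h1 (hb0 ω)
      rw [mul_add, mul_one] at h2
      exact h2
    have hmain := integral_apply_increment ζ (ℱ.le _) (hD k hk) (hind k hk) (hg k hk) (β := β)
      (b := b) (fun y => ?_) (fun ω => ?_) hbD
    · simpa only [hβ] using hmain
    · simp only [hβ]
      refine hf.mul ?_
      exact ((((hxm k hk.le).inner (J.continuous.comp_stronglyMeasurable
        (hG.stronglyMeasurable_V hℓ (hu.adapted k hk.le) stronglyMeasurable_const)))).measurable.div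
          hzm.measurable).stronglyMeasurable
    · refine ContinuousLinearMap.opNorm_le_bound _ (hb0 ω) fun y => ?_
      rw [hβ, norm_mul, Real.norm_eq_abs, Real.norm_eq_abs, mul_assoc]
      refine mul_le_mul_of_nonneg_left ((abs_inner_div_bracket_le _ _).trans ?_) (abs_nonneg _)
      have h0 : 0 ≤ √C₀ * bracket (J (u k ω)) * ‖y‖ :=
        mul_nonneg (mul_nonneg (Real.sqrt_nonneg _) (bracket_pos _).le) (norm_nonneg _)
      refine abs_le_of_sq_le_sq' ?_ h0 |>.2
      rw [mul_pow, mul_pow, Real.sq_sqrt hC₀, bracket_sq]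
      exact hgrowth _ _
  · refine (memLp_congr_ae ?_).2 ((energyMap ℓ lam).comp_memLp' hu₀)
    filter_upwards [hu.initial] with ω hω
    rw [hω]
    rfl

lemma sum_Icc_one_eq {M : Type*} [AddCommMonoid M] (f : ℕ → M) (N : ℕ) :
    ∑ k ∈ Finset.Icc 1 N, f k = ∑ k ∈ Finset.range N, f (k + 1) := by
  rw [Finset.range_eq_Ico, Finset.sum_Ico_add' f 0 N 1, zero_add]
  rfl

variable [IsProbabilityMeasure P]

lemma exists_eulerMoment_le (hℓ : 0 < ℓ) (hν : 0 < ν) (ha : 0 < a) (hα : 1 ≤ α)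
    (hα' : α = 1 → 1 < 4 * ν * a) {ι : Type*} (ζ : HilbertBasis ι ℝ K)
    (hs : Summable fun j => ⟪Q (ζ j), ζ j⟫_ℝ) (hQ : ∀ y, 0 ≤ ⟪Q y, y⟫_ℝ)
    (hW : IsWiener P ℱ T Q W) (hG : ConditionG G) (hu₀ : MemLp u₀ 2 P) :
    ∃ C : ℝ≥0, ∀ N : ℕ, 1 ≤ N → ∀ u : ℕ → Ω → V ℓ,
      IsEulerSolution P ℱ T ν a α G W u₀ N u → eulerMoment P T α N u ≤ C := by
  obtain ⟨lam, hlam, c, hc, henergy⟩ := exists_energy_le hℓ hν ha hα hα'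
  obtain ⟨C₀, hC₀, hgrowth⟩ := hG.exists_energy_growth hlam
  have hlam0 : 0 ≤ lam := by linarith
  set J := energyMap ℓ lam with hJ
  set tr : ℝ := ∑' j, ⟪Q (ζ j), ζ j⟫_ℝ with htr
  set B : ℝ := (5 + C₀ * (T * tr)) *
    (Real.exp (2 * C₀ * (T * tr)) * ∫ ω, (1 + ‖J (u₀ ω)‖ ^ 2) ∂P) with hB
  -- The maximum is bounded by `R` and the dissipation sum, entering the energy balance with weight
  -- `hc`, by `c⁻¹R`; `B` bounds the expectation of `R` and does not involve `N`.
  refine ⟨Real.toNNReal ((1 + c⁻¹) * B), fun N hN u hu => ?_⟩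
  have hN0 : (N : ℝ) ≠ 0 := by positivity
  set h : ℝ := T / N with hh
  have hh0 : 0 ≤ h := by positivity
  set d : ℕ → Ω → ℝ := fun k ω => (dissipation α (u k ω)).toReal with hd
  set g : ℕ → Ω → WithLp 2 (L2 ℓ × PiLp 2 fun _ : Fin 3 => L2 ℓ) := fun k ω =>
    J (G (u k ω) (W (grid T N (k + 1)) ω - W (grid T N k) ω)) with hg
  have key : ∀ k < N, ∀ᵐ ω ∂P, dissipation α (u (k + 1) ω) = ENNReal.ofReal (d (k + 1) ω) ∧
      ‖J (u (k + 1) ω)‖ ^ 2 + h * c * d (k + 1) ω ≤ ‖J (u k ω) + g k ω‖ ^ 2 := by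
    intro k hk
    have hk' : k + 1 ∈ Finset.Icc 1 N := Finset.mem_Icc.2 ⟨by omega, hk⟩
    filter_upwards [hu.mem_domA _ hk', hu.scheme _ hk'] with ω h1 h2
    obtain ⟨e, he0, he, hle⟩ := henergy h _ _ _ hh0 h1 h2
    have h3 : d (k + 1) ω = e := by
      simp only [hd]
      rw [he, ENNReal.toReal_ofReal he0]
    rw [h3, ← map_add, norm_sq_energyMap hlam0, norm_sq_energyMap hlam0]
    exact ⟨he, hle⟩
  have hd0 : ∀ k ω, 0 ≤ d k ω := fun k ω => ENNReal.toReal_nonneg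
  have hchain := IsEulerSolution.energyChain hℓ hN ζ hs hQ hW hG hu₀ hu hC₀ hgrowth
    (fun k hk => by
      filter_upwards [key k hk] with ω hω
      refine abs_le_of_sq_le_sq' (le_trans ?_ hω.2) (norm_nonneg _) |>.2
      have := mul_nonneg (mul_nonneg hh0 hc.le) (hd0 (k + 1) ω)
      linarith)
  obtain ⟨R, hRi, hR, hRle⟩ := hchain.exists_bound (e := fun k ω => h * c * d (k + 1) ω)
    (fun k hk => (key k hk).mono fun ω hω => hω.2)
  have hinit : ∫ ω, (1 + ‖J (u 0 ω)‖ ^ 2) ∂P = ∫ ω, (1 + ‖J (u₀ ω)‖ ^ 2) ∂P := by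
    refine integral_congr_ae ?_
    filter_upwards [hu.initial] with ω hω
    rw [hω]
  have e1 : C₀ * (h * tr) * N = C₀ * (T * tr) := by rw [hh]; field_simp
  have e2 : 2 * C₀ * (h * tr) * N = 2 * C₀ * (T * tr) := by rw [hh]; field_simp
  rw [hinit, e1, e2] at hR
  have hkey : ∀ᵐ ω ∂P, ∀ k, k < N → dissipation α (u (k + 1) ω) = ENNReal.ofReal (d (k + 1) ω) :=
    ae_all_iff.2 fun k => by
      by_cases hk : k < N
      · filter_upwards [key k hk] with ω hω _ using hω.1
      · exact Eventually.of_forall fun ω h => absurd h hk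
  have hpt : ∀ᵐ ω ∂P, ((⨆ k ∈ Finset.range (N + 1), ‖u k ω‖ₑ ^ 2) +
      ((T / N : ℝ≥0) : ℝ≥0∞) * ∑ k ∈ Finset.Icc 1 N, dissipation α (u k ω)) ≤
        ENNReal.ofReal ((1 + c⁻¹) * R ω) ∧ 0 ≤ (1 + c⁻¹) * R ω := by
    filter_upwards [hkey, hRle] with ω h1 h2
    set S := ∑ k ∈ Finset.range N, d (k + 1) ω with hS
    have hS0 : 0 ≤ S := Finset.sum_nonneg fun k _ => hd0 _ _
    have h3 : ∀ k ≤ N, ‖J (u k ω)‖ ^ 2 + h * c * S ≤ R ω := fun k hk => by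
      have := h2 k hk
      rwa [← Finset.mul_sum] at this
    have hhcS : 0 ≤ h * c * S := by positivity
    have hR0 : 0 ≤ R ω := le_trans (by positivity) (h3 0 zero_le)
    have h4 : (⨆ k ∈ Finset.range (N + 1), ‖u k ω‖ₑ ^ 2) ≤ ENNReal.ofReal (R ω) := by
      refine iSup₂_le fun k hk => ?_
      rw [← ofReal_norm, ← ENNReal.ofReal_pow (norm_nonneg _)]
      refine ENNReal.ofReal_le_ofReal ?_
      have h5 := h3 k (Nat.lt_succ_iff.1 (Finset.mem_range.1 hk))
      have h6 := norm_sq_le_energy hlam (u k ω)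
      rw [← norm_sq_energyMap hlam0] at h6
      linarith
    have h5 : ((T / N : ℝ≥0) : ℝ≥0∞) * ∑ k ∈ Finset.Icc 1 N, dissipation α (u k ω) ≤
        ENNReal.ofReal (c⁻¹ * R ω) := by
      rw [sum_Icc_one_eq, Finset.sum_congr rfl fun k hk => h1 k (Finset.mem_range.1 hk),
        ← ENNReal.ofReal_sum_of_nonneg fun k _ => hd0 _ _]
      have h6 : ((T / N : ℝ≥0) : ℝ≥0∞) = ENNReal.ofReal h := by
        rw [← ENNReal.ofReal_coe_nnreal]
        simp [hh]
      rw [h6, ← ENNReal.ofReal_mul hh0]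
      refine ENNReal.ofReal_le_ofReal ?_
      rw [inv_mul_eq_div, le_div_iff₀ hc]
      have h7 := h3 0 zero_le
      have h8 := sq_nonneg ‖J (u 0 ω)‖
      linarith
    refine ⟨(add_le_add h4 h5).trans (le_of_eq ?_), by positivity⟩
    rw [← ENNReal.ofReal_add hR0 (by positivity)]
    congr 1
    ring
  calc eulerMoment P T α N u ≤ ∫⁻ ω, ENNReal.ofReal ((1 + c⁻¹) * R ω) ∂P :=
        lintegral_mono_ae (hpt.mono fun ω hω => hω.1)
    _ = ENNReal.ofReal (∫ ω, (1 + c⁻¹) * R ω ∂P) :=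
        (ofReal_integral_eq_lintegral_ofReal (hRi.const_mul _) (hpt.mono fun ω hω => hω.2)).symm
    _ ≤ ENNReal.ofReal ((1 + c⁻¹) * B) := by
        refine ENNReal.ofReal_le_ofReal ?_
        rw [integral_const_mul]
        gcongr
    _ = _ := rfl

end Moment

end BFEuler

end

/-! ### The main theorem -/

theorem mainTheorem4 {Ω K : Type*} [mΩ : MeasurableSpace Ω] (P : Measure Ω)
    [IsProbabilityMeasure P] (ℱ : Filtration ℝ≥0 mΩ)
    [NormedAddCommGroup K] [InnerProductSpace ℝ K] [CompleteSpace K]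
    [TopologicalSpace.SeparableSpace K] [MeasurableSpace K] [BorelSpace K]
    (ℓ : ℝ) (hℓ : 0 < ℓ) (T : ℝ≥0) (hT : 0 < T) (ν a α : ℝ) (hν : 0 < ν) (ha : 0 < a)
    (hα : α ∈ Set.Icc 1 (3 / 2))
    (Q : K →L[ℝ] K) (hQ : BFEuler.IsPosTraceClass Q)
    (W : ℝ≥0 → Ω → K) (hW : BFEuler.IsWiener P ℱ T Q W)
    (G : BFEuler.V ℓ → K →L[ℝ] BFEuler.V ℓ) (hG : BFEuler.ConditionG G)
    (u₀ : Ω → BFEuler.V ℓ) (hu₀ : StronglyMeasurable[ℱ 0] u₀) (hu₀' : MemLp u₀ 2 P) :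
    (∀ N : ℕ, 1 ≤ N → ∃ u : ℕ → Ω → BFEuler.V ℓ,
      BFEuler.IsEulerSolution P ℱ T ν a α G W u₀ N u) ∧
    ((α = 1 → 1 < 4 * ν * a) →
      ∃ C : ℝ≥0, ∀ N : ℕ, 1 ≤ N → ∀ u : ℕ → Ω → BFEuler.V ℓ,
        BFEuler.IsEulerSolution P ℱ T ν a α G W u₀ N u →
          BFEuler.eulerMoment P T α N u ≤ C) := by
  have hα : 1 ≤ α ∧ α ≤ 3 / 2 := hα
  refine ⟨fun N hN => BFEuler.exists_isEulerSolution P ℱ hℓ hT hν ha (by linarith [hα.1]) hW hG hu₀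
    hN, fun hα' => ?_⟩
  obtain ⟨hpos, s, ζ, hs⟩ := hQ
  exact BFEuler.exists_eulerMoment_le hℓ hν ha hα.1 hα' ζ hs (fun y => hpos.inner_nonneg_left y) hW
    hG hu₀'
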